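/- Let $\mathbb T^d=\mathbb R^d/\mathbb Z^d$, $\nu>0$, $0<T_0<\infty$, let $u_0\in L^2(\mathbb T^d)$ and $f\in L^2([0,T_0];L^2(\mathbb T^d))$ be solenoidal, and let $u\in L^\infty([0,T_0];L^2(\mathbb T^d))\cap L^2([0,T_0];H^1(\mathbb T^d))$, with pressure $p\in L^1([0,T_0]\times\mathbb T^d)$, be a Leray solution of the incompressible Navier–Stokes equations $$\partial_t u+\nabla\cdot(u\otimes u)=-\nabla p+\nu\Delta u+f,\qquad \nabla\cdot u=0,\qquad u|_{t=0}=u_0,$$ that is, a solution in the sense of distributions which satisfies, for a.e. $t\in[0,T_0]$, the global energy inequality $$\tfrac12\int_{\mathbb T^d}|u(\cdot,t)|^2dx+\nu\int_0^t\!\int_{\mathbb T^d}|\nabla u|^2dx\,ds\le\tfrac12\int_{\mathbb T^d}|u_0|^2dx+\int_0^t\!\int_{\mathbb T^d}u\cdot f\,dx\,ds.$$ Let $G\in C_c^\infty(\mathbb R^d)$, $G\ge0$, $\int G=1$, $\operatorname{supp}G\subset\{|r|\le1\}$ be a standard mollifier, and for $\ell>0$ put $\bar v_\ell(x)=\int_{\mathbb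 R^d}\ell^{-d}G(r/\ell)\,v(x+r)\,dr$, $\tau_\ell(g,h)=\overline{(g\otimes h)}_\ell-\bar g_\ell\otimes\bar h_\ell$ and $\tau_\ell(g;h)=\operatorname{Tr}\tau_\ell(g,h)$. Define $$\Pi_\ell[u]=-\nabla\bar u_\ell:\tau_\ell(u,u),\qquad J_\ell=\left(\tfrac12|\bar u_\ell|^2+\bar p_\ell\right)\bar u_\ell+\bar u_\ell\cdot\tau_\ell(u,u)-\nu\nabla\left(\tfrac12|\bar u_\ell|^2\right).$$ (1) For every such $G$ and every $\ell>0$, the fields $\bar u_\ell(\cdot,t)$ and $J_\ell(\cdot,t)$ are smooth for a.e. $t\in[0,T_0]$; and for every $x\in\mathbb T^d$ the function $t\mapsto\frac12|\bar u_\ell(x,t)|^2$ agrees for a.e. $t\in[0,T_0]$ with an absolutely continuous function on $[0,T_0]$ that has the value $\frac12|\overline{(u_0)}_\ell(x)|^2$ at $t=0$ and whose classical derivative $\partial_t$ satisfies, for a.e. $t\in[0,T_0]$, $$\partial_t\left(\tfrac12|\bar u_\ell|^2\right)+\nabla\cdot J_\ell=-\Pi_\ell[u]-\nu|\nabla\bar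 u_\ell|^2+\bar u_\ell\cdot\bar f_\ell .$$ (2) Let $D[u]$ be the defect in the local energy balance, $$D[u]=-\partial_t\left(\tfrac12|u|^2\right)-\nabla\cdot\left[\left(\tfrac12|u|^2+p\right)u-\nu\nabla\left(\tfrac12|u|^2\right)\right]-\nu|\nabla u|^2+u\cdot f .$$ Suppose, as is understood for Leray solutions here, that $D[u]$ is a non-negative distribution on $(0,T_0)\times\mathbb T^d$ (with $(\frac12|u|^2+p)u\in L^1$, which is automatic if $d\le4$). Then $D[u]$ is a Radon measure, and, with $\varepsilon[u]=\nu|\nabla u|^2+D[u]$, for a.e. $T\in[0,T_0]$ and for every standard mollifier $G$ and every $\ell>0$, all the terms below are finite and $$\int_0^T\!\!\int_{\mathbb T^d}\varepsilon[u]\,dx\,dt=\int_0^T\!\!\int_{\mathbb T^d}\Pi_\ell[u]\,dx\,dt+\int_0^T\!\!\int_{\mathbb T^d}\nu|\nabla\bar u_\ell|^2dx\,dt+\tfrac12\int_{\mathbb T^d}\tau_\ell(u_0;u_0)\,dx-\tfrac12\int_{\mathbb T^d}\tau_\ell(u(\cdot,T);u(\cdot,T))\,dx+\int_0^T\!\!\int_{\mathbb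 T^d}\tau_\ell(u;f)\,dx\,dt .$$ -/

import Mathlib

open MeasureTheory Set
open scoped ContDiff NNReal

namespace LeraySol

/-- The space `ℝ^d`. Functions on the torus `𝕋^d = ℝ^d / ℤ^d` are functions on `ℝ^d` which are
`1`-periodic in every coordinate. -/
abbrev E (d : ℕ) := EuclideanSpace ℝ (Fin d)

/-- `1`-periodicity in every coordinate direction. -/
def IsPeriodic {d : ℕ} {F : Type*} (v : E d → F) : Prop :=
  ∀ (i : Fin d) (x : E d), v (x + EuclideanSpace.single i (1 : ℝ)) = v x

/-- The fundamental cell `[0,1)^d`; integrals over `𝕋^d` are integrals over this cell. -/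
def cell (d : ℕ) : Set (E d) := {x | ∀ i, x i ∈ Ico (0 : ℝ) 1}

/-- Lebesgue measure on `𝕋^d`. -/
noncomputable def torus (d : ℕ) : Measure (E d) := volume.restrict (cell d)

/-- Lebesgue measure on `(0,T) × 𝕋^d`. -/
noncomputable def spaceTime (d : ℕ) (T : ℝ) : Measure (ℝ × E d) :=
  (volume.restrict (Ioo 0 T)).prod (torus d)

/-- The classical partial derivative `∂_j g (x)`. -/
noncomputable def pd {d : ℕ} (j : Fin d) (g : E d → ℝ) (x : E d) : ℝ :=
  fderiv ℝ g x (EuclideanSpace.single j (1 : ℝ))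

/-- The Laplacian. -/
noncomputable def lap {d : ℕ} (g : E d → ℝ) (x : E d) : ℝ := ∑ j, pd j (pd j g) x

/-- The divergence of a vector field. -/
noncomputable def divergence {d : ℕ} (v : E d → E d) (x : E d) : ℝ :=
  ∑ j, pd j (fun y => v y j) x

/-- `v` is divergence free on `𝕋^d` in the sense of distributions. -/
def IsSolenoidal {d : ℕ} (v : E d → E d) : Prop :=
  ∀ ψ : E d → ℝ, ContDiff ℝ ∞ ψ → IsPeriodic ψ → ∫ x, ∑ j, v x j * pd j ψ x ∂torus d = 0

/-- `A i j` is the weak derivative `∂_j v_i` on `𝕋^d`. -/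
def IsWeakGradient {d : ℕ} (v : E d → E d) (A : E d → Fin d → Fin d → ℝ) : Prop :=
  ∀ (i j : Fin d) (ψ : E d → ℝ), ContDiff ℝ ∞ ψ → IsPeriodic ψ →
    ∫ x, v x i * pd j ψ x ∂torus d = -∫ x, A x i j * ψ x ∂torus d

/-- Squared Euclidean (Frobenius) norm of a matrix. -/
def sqNorm {d : ℕ} (A : Fin d → Fin d → ℝ) : ℝ := ∑ i, ∑ j, A i j ^ 2

/-- Scalar test functions on `[0,T) × 𝕋^d`: smooth, and vanishing for times near `T`
(but not necessarily at time `0`). -/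
structure IsTest {d : ℕ} (T : ℝ) (φ : ℝ → E d → ℝ) : Prop where
  smooth : ContDiff ℝ ∞ (Function.uncurry φ)
  periodic : ∀ t, IsPeriodic (φ t)
  vanish : ∃ b < T, ∀ t, b ≤ t → ∀ x, φ t x = 0

/-- Scalar test functions on the open set `(0,T) × 𝕋^d`. -/
structure IsInteriorTest {d : ℕ} (T : ℝ) (φ : ℝ → E d → ℝ) : Prop extends IsTest T φ where
  vanish_zero : ∃ a > 0, ∀ t, t ≤ a → ∀ x, φ t x = 0

/-- The distribution `D[u]` on `(0,T) × 𝕋^d`,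
`D[u] = -∂_t(|u|²/2) - ∇·[(|u|²/2 + p) u - ν ∇(|u|²/2)] - ν|∇u|² + u·f`,
evaluated at a test function. -/
noncomputable def energyDefect {d : ℕ} (T ν : ℝ) (f u : ℝ → E d → E d) (p : ℝ → E d → ℝ)
    (Du : ℝ → E d → Fin d → Fin d → ℝ) (φ : ℝ → E d → ℝ) : ℝ :=
  ∫ z : ℝ × E d,
    (1 / 2 * ‖u z.1 z.2‖ ^ 2 * (deriv (fun s => φ s z.2) z.1 + ν * lap (φ z.1) z.2)
      + (1 / 2 * ‖u z.1 z.2‖ ^ 2 + p z.1 z.2) * ∑ j, u z.1 z.2 j * pd j (φ z.1) z.2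
      + inner ℝ (u z.1 z.2) (f z.1 z.2) * φ z.1 z.2
      - ν * sqNorm (Du z.1 z.2) * φ z.1 z.2) ∂spaceTime d T

/-- `(u, p)` is a Leray solution on `[0,T] × 𝕋^d` of the incompressible Navier-Stokes equations with
viscosity `ν`, initial datum `u₀` and force `f`; `Du` is the weak spatial gradient of `u`. -/
structure IsLeraySolution {d : ℕ} (T ν : ℝ) (u₀ : E d → E d) (f u : ℝ → E d → E d)
    (p : ℝ → E d → ℝ) (Du : ℝ → E d → Fin d → Fin d → ℝ) : Prop where
  /-- The data: `u₀ ∈ L²`, `f ∈ L²L²`, both solenoidal. -/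
  u₀_periodic : IsPeriodic u₀
  u₀_memLp : MemLp u₀ 2 (torus d)
  u₀_solenoidal : IsSolenoidal u₀
  f_periodic : ∀ t, IsPeriodic (f t)
  f_memLp : MemLp (Function.uncurry f) 2 (spaceTime d T)
  f_solenoidal : ∀ᵐ t ∂volume.restrict (Ioo 0 T), IsSolenoidal (f t)
  /-- `u ∈ L^∞(0,T; L²) ∩ L²(0,T; H¹)`. -/
  u_periodic : ∀ t, IsPeriodic (u t)
  u_measurable : AEStronglyMeasurable (Function.uncurry u) (spaceTime d T)
  u_bounded : ∃ C : ℝ≥0, ∀ᵐ t ∂volume.restrict (Ioo 0 T), eLpNorm (u t) 2 (torus d) ≤ C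
  Du_memLp : ∀ i j, MemLp (fun z : ℝ × E d => Du z.1 z.2 i j) 2 (spaceTime d T)
  Du_weakGradient : ∀ᵐ t ∂volume.restrict (Ioo 0 T), IsWeakGradient (u t) (Du t)
  /-- The pressure is an integrable function. -/
  p_periodic : ∀ t, IsPeriodic (p t)
  p_integrable : Integrable (Function.uncurry p) (spaceTime d T)
  /-- `∇·u = 0`. -/
  solenoidal : ∀ᵐ t ∂volume.restrict (Ioo 0 T), IsSolenoidal (u t)
  /-- `∂_t u + ∇·(u⊗u) = -∇p + νΔu + f` in the sense of distributions, with `u(0) = u₀`. -/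
  momentum : ∀ (i : Fin d) (φ : ℝ → E d → ℝ), IsTest T φ →
    ∫ z : ℝ × E d,
      (u z.1 z.2 i * deriv (fun s => φ s z.2) z.1
        + ∑ j, u z.1 z.2 i * u z.1 z.2 j * pd j (φ z.1) z.2
        + p z.1 z.2 * pd i (φ z.1) z.2
        + ν * (u z.1 z.2 i * lap (φ z.1) z.2)
        + f z.1 z.2 i * φ z.1 z.2) ∂spaceTime d T
      + ∫ x, u₀ x i * φ 0 x ∂torus d = 0
  /-- The global energy inequality. -/
  energy_le : ∀ᵐ t ∂volume.restrict (Ioo 0 T),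
    1 / 2 * ∫ x, ‖u t x‖ ^ 2 ∂torus d + ν * ∫ z : ℝ × E d, sqNorm (Du z.1 z.2) ∂spaceTime d t
      ≤ 1 / 2 * ∫ x, ‖u₀ x‖ ^ 2 ∂torus d
        + ∫ z : ℝ × E d, inner ℝ (u z.1 z.2) (f z.1 z.2) ∂spaceTime d t

/-- `D[u]` is a non-negative distribution on `(0,T) × 𝕋^d`: the inviscid energy current is integrable
(which is automatic for `d ≤ 4`), so that `D[u]` is a distribution, and `D[u]` is non-negative. -/
structure HasNonnegDefect {d : ℕ} (T ν : ℝ) (f u : ℝ → E d → E d) (p : ℝ → E d → ℝ)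
    (Du : ℝ → E d → Fin d → Fin d → ℝ) : Prop where
  current_integrable : Integrable
    (fun z : ℝ × E d => (1 / 2 * ‖u z.1 z.2‖ ^ 2 + p z.1 z.2) • u z.1 z.2) (spaceTime d T)
  nonneg : ∀ φ : ℝ → E d → ℝ, IsInteriorTest T φ → (∀ t x, 0 ≤ φ t x) →
    0 ≤ energyDefect T ν f u p Du φ

/-- The Borel measure `D` on `(0,T) × 𝕋^d` is the distribution `D[u]`. -/
def RepresentsDefect {d : ℕ} (T ν : ℝ) (f u : ℝ → E d → E d) (p : ℝ → E d → ℝ)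
    (Du : ℝ → E d → Fin d → Fin d → ℝ) (D : Measure (ℝ × E d)) : Prop :=
  D (Ioo 0 T ×ˢ cell d)ᶜ = 0 ∧
    ∀ φ : ℝ → E d → ℝ, IsInteriorTest T φ →
      Integrable (Function.uncurry φ) D ∧
        ∫ z, Function.uncurry φ z ∂D = energyDefect T ν f u p Du φ

/-- Standard mollifiers. -/
structure IsMollifier {d : ℕ} (G : E d → ℝ) : Prop where
  smooth : ContDiff ℝ ∞ G
  nonneg : ∀ r, 0 ≤ G r
  support : tsupport G ⊆ Metric.closedBall 0 1
  integral_eq : ∫ r, G r = 1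

/-- Coarse-graining at scale `ℓ`: convolution with the reflection of `G_ℓ(r) = ℓ^{-d} G(r/ℓ)`, that
is, `x ↦ ∫ G_ℓ(r) v(x + r) dr`. -/
noncomputable def cg {d : ℕ} {F : Type*} [NormedAddCommGroup F] [NormedSpace ℝ F]
    (G : E d → ℝ) (ℓ : ℝ) (v : E d → F) (x : E d) : F :=
  ∫ r, ((ℓ ^ d)⁻¹ * G (ℓ⁻¹ • r)) • v (x + r)

/-- The cumulant `τ_ℓ(g,h)`, a `d × d` matrix at every point. -/
noncomputable def cumulant {d : ℕ} (G : E d → ℝ) (ℓ : ℝ) (g h : E d → E d) (x : E d)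
    (i j : Fin d) : ℝ :=
  cg G ℓ (fun y => g y i * h y j) x - cg G ℓ g x i * cg G ℓ h x j

/-- The trace `τ_ℓ(g;h)` of the cumulant. -/
noncomputable def cumulantTrace {d : ℕ} (G : E d → ℝ) (ℓ : ℝ) (g h : E d → E d) (x : E d) : ℝ :=
  ∑ i, cumulant G ℓ g h x i i

/-- The matrix `(∂_j v̄_i)` of the coarse-grained field `v̄ = cg G ℓ v`. -/
noncomputable def cgGrad {d : ℕ} (G : E d → ℝ) (ℓ : ℝ) (v : E d → E d) (x : E d)
    (i j : Fin d) : ℝ :=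
  pd j (fun y => cg G ℓ v y i) x

/-- The energy flux `Π_ℓ[v] = -∇v̄ : τ_ℓ(v,v)`. -/
noncomputable def flux {d : ℕ} (G : E d → ℝ) (ℓ : ℝ) (v : E d → E d) (x : E d) : ℝ :=
  -∑ i, ∑ j, cgGrad G ℓ v x i j * cumulant G ℓ v v x i j

/-- The resolved energy current `J_ℓ` of a velocity field `v` with pressure `q`. -/
noncomputable def current {d : ℕ} (ν : ℝ) (G : E d → ℝ) (ℓ : ℝ) (v : E d → E d) (q : E d → ℝ)
    (x : E d) : E d :=
  WithLp.toLp 2 fun i =>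
    (1 / 2 * ‖cg G ℓ v x‖ ^ 2 + cg G ℓ q x) * cg G ℓ v x i
      + ∑ j, cg G ℓ v x j * cumulant G ℓ v v x j i
      - ν * pd i (fun y => 1 / 2 * ‖cg G ℓ v y‖ ^ 2) x

end LeraySol

/-! The dissipation formula is the difference of two energy balances: the exact one, which contains
the defect `D[u]`, and the resolved one, which contains the flux. Both are integrated over the
torus, so the spatial currents disappear. The cumulant terms arise because coarse-graining preserves
means, so that `∫ τ_ℓ(v;w) = ∫ v·w - ∫ v̄·w̄`.

Resolved balance. For periodic integrable `v`, `cg G ℓ v x` is the pairing of `v` with the smooth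
periodic kernel `K(· - x)` obtained by summing `G_ℓ` over the lattice (`cg_eq_smoothing`). Hence the
weak momentum equation, tested with `χ(t) K(y - x)`, is an equation in time for `ū_ℓ(x,t)`. A du
Bois-Reymond argument that keeps the initial value (`ae_eq_add_integral_of_weak`) turns it into an
integral identity, so `ū_ℓ(x,·)` and its square have absolutely continuous representatives. The
spatial part of the balance is then an identity for smooth fields (`divergence_current_identity`). A
separability argument (`ae_integral_mul_eq`) gives one null set of times for all test functions,
which is why the exceptional times depend on neither `x` nor `G` nor `ℓ`.

Exact balance. A non-negative distribution is a measure: the functional is extended from test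
functions to compactly supported continuous functions by the M. Riesz extension theorem, and the
Riesz-Markov-Kakutani theorem applies (`exists_representsDefect`). Tested with functions of time
alone, `D[u]` is minus the derivative of the net energy `½‖u(t)‖² - ∫₀ᵗ (u·f - ν|∇u|²)`
(`energyDefect_time`). Interior tests do not see the initial time, so the limit of the net energy at
`0` has to be identified separately: the global energy inequality bounds it above by `½‖u₀‖²`, and
weak continuity with lower semicontinuity of the norm bounds it below (`exists_sub_le_netEnergy`).
Then `ae_measure_Ioo_eq`, with smooth plateaus increasing to cover `(0,T)`, gives the mass of `D[u]`
up to almost every `T`, and `dissipation_eq` combines the two balances. -/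

namespace LeraySol

open scoped Pointwise CompactlySupported

variable {d : ℕ}

/-! ### The lattice `ℤ^d`, its fundamental cell and periodic functions -/

/-- The standard basis of `ℝ^d`, which generates the lattice `ℤ^d`. -/
noncomputable abbrev latticeBasis (d : ℕ) : Module.Basis (Fin d) ℝ (E d) :=
  (EuclideanSpace.basisFun (Fin d) ℝ).toBasis

/-- The lattice `ℤ^d`. -/
noncomputable abbrev lattice (d : ℕ) : Submodule ℤ (E d) :=
  Submodule.span ℤ (range (latticeBasis d))

lemma latticeBasis_apply (i : Fin d) :
    latticeBasis d i = EuclideanSpace.single i (1 : ℝ) := by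
  simp [latticeBasis]

lemma cell_eq : cell d = ZSpan.fundamentalDomain (latticeBasis d) := by
  ext x
  simp [cell, ZSpan.mem_fundamentalDomain, latticeBasis]

lemma measurableSet_cell : MeasurableSet (cell d) := by
  rw [cell_eq]; exact ZSpan.fundamentalDomain_measurableSet _

lemma isBounded_cell : Bornology.IsBounded (cell d) := by
  rw [cell_eq]; exact ZSpan.fundamentalDomain_isBounded _

instance : IsFiniteMeasure (torus d) :=
  ⟨by rw [torus, Measure.restrict_apply_univ]; exact isBounded_cell.measure_lt_top⟩

lemma isAddFundamentalDomain_cell :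
    IsAddFundamentalDomain (lattice d) (cell d) (volume : Measure (E d)) := by
  rw [cell_eq]; exact ZSpan.isAddFundamentalDomain _ _

instance : VAddInvariantMeasure (lattice d) (E d) volume :=
  ⟨fun c _ _ => measure_preimage_add volume (c : E d) _⟩

section Periodic

variable {F : Type*} {v : E d → F}

lemma IsPeriodic.add_mem (hv : IsPeriodic v) {k : E d} (hk : k ∈ lattice d) (x : E d) :
    v (x + k) = v x := by
  induction hk using Submodule.span_induction generalizing x with
  | mem y hy =>
    obtain ⟨i, rfl⟩ := hy
    rw [latticeBasis_apply]; exact hv i x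
  | zero => simp
  | add y z _ _ hy hz => rw [← add_assoc, hz, hy]
  | smul n y _ hy =>
    induction n using Int.induction_on generalizing x with
    | zero => simp
    | succ n ih => rw [add_smul, one_smul, ← add_assoc, hy, ih]
    | pred n ih => rw [sub_smul, one_smul, ← hy (x + _), add_assoc, sub_add_cancel, ih]

lemma IsPeriodic.vadd (hv : IsPeriodic v) (k : lattice d) (x : E d) : v (k +ᵥ x) = v x := by
  rw [Submodule.vadd_def, vadd_eq_add, add_comm]; exact hv.add_mem k.2 x

lemma IsPeriodic.comp_add (hv : IsPeriodic v) (a : E d) : IsPeriodic fun x => v (x + a) := by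
  intro i x
  simp only [add_right_comm x _ a]
  exact hv i _

lemma IsPeriodic.comp_sub (hv : IsPeriodic v) (a : E d) : IsPeriodic fun x => v (x - a) := by
  simpa [sub_eq_add_neg] using hv.comp_add (-a)

lemma IsPeriodic.apply_fract (hv : IsPeriodic v) (x : E d) :
    v (ZSpan.fract (latticeBasis d) x) = v x := by
  have := hv.add_mem (ZSpan.floor (latticeBasis d) x).2 (ZSpan.fract (latticeBasis d) x)
  rw [ZSpan.fract_apply, sub_add_cancel] at this
  rw [ZSpan.fract_apply, this]

lemma fract_mem_cell (x : E d) : ZSpan.fract (latticeBasis d) x ∈ cell d := by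
  rw [cell_eq]; exact ZSpan.fract_mem_fundamentalDomain _ _

variable [NormedAddCommGroup F]

lemma IsPeriodic.exists_bound (hv : IsPeriodic v) (hc : Continuous v) :
    ∃ C : ℝ, 0 ≤ C ∧ ∀ x, ‖v x‖ ≤ C := by
  obtain ⟨C, hC⟩ := (isBounded_cell (d := d)).isCompact_closure.exists_bound_of_continuousOn
    hc.continuousOn
  have h : ∀ x, ‖v x‖ ≤ C := fun x => by
    rw [← hv.apply_fract]; exact hC _ (subset_closure (fract_mem_cell x))
  exact ⟨C, (norm_nonneg _).trans (h 0), h⟩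

lemma torus_map_add (a : E d) :
    (torus d).map (· + a) = volume.restrict (a +ᵥ cell d) := by
  have h := (measurePreserving_add_right (volume : Measure (E d)) a).restrict_preimage_emb
    (MeasurableEquiv.addRight a).measurableEmbedding (a +ᵥ cell d)
  rw [← h.map_eq, torus]
  congr 2
  ext x
  simp only [mem_preimage, mem_vadd_set_iff_neg_vadd_mem, vadd_eq_add]
  rw [show -a + (x + a) = x by abel]

lemma isAddFundamentalDomain_vadd_cell (a : E d) :
    IsAddFundamentalDomain (lattice d) (a +ᵥ cell d) (volume : Measure (E d)) :=
  isAddFundamentalDomain_cell.vadd_of_comm a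

/-- Every translate of the cell is again a fundamental domain of the lattice, and integrability of
an invariant function does not depend on the choice of fundamental domain. -/
lemma IsPeriodic.integrableOn_vadd_iff (hv : IsPeriodic v) (a : E d) :
    IntegrableOn v (a +ᵥ cell d) ↔ Integrable v (torus d) :=
  (isAddFundamentalDomain_vadd_cell a).integrableOn_iff isAddFundamentalDomain_cell hv.vadd

lemma IsPeriodic.integrable_comp_add (hv : IsPeriodic v) (hi : Integrable v (torus d)) (a : E d) :
    Integrable (fun x => v (x + a)) (torus d) := by
  have h := (hv.integrableOn_vadd_iff a).2 hi
  rw [IntegrableOn, ← torus_map_add] at h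
  exact ((MeasurableEquiv.addRight a).measurableEmbedding.integrable_map_iff).1 h

lemma IsPeriodic.integral_comp_add [NormedSpace ℝ F] (hv : IsPeriodic v) (a : E d) :
    ∫ x, v (x + a) ∂torus d = ∫ x, v x ∂torus d := by
  have h := (isAddFundamentalDomain_vadd_cell a).setIntegral_eq isAddFundamentalDomain_cell
    hv.vadd
  rw [← torus_map_add] at h
  exact ((MeasurableEquiv.addRight a).measurableEmbedding.integral_map
    (μ := torus d) v).symm.trans h

/-- A compact set is covered by finitely many lattice translates of the cell, since its points have
integer parts in a bounded set, and integrability on each translate is integrability on the torus.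
-/
lemma IsPeriodic.locallyIntegrable (hv : IsPeriodic v) (hi : Integrable v (torus d)) :
    LocallyIntegrable v := by
  refine locallyIntegrable_iff.2 fun K hK => ?_
  obtain ⟨R, hR⟩ := (isBounded_cell (d := d)).exists_norm_le
  obtain ⟨S, hS⟩ := hK.isBounded.exists_norm_le
  have hfin := ZSpan.setFinite_inter (latticeBasis d)
    (Metric.isBounded_closedBall (x := (0 : E d)) (r := S + R))
  have hsub : K ⊆ ⋃ k ∈ (Metric.closedBall (0 : E d) (S + R) ∩ lattice d), (k +ᵥ cell d) := by
    intro x hx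
    refine mem_biUnion (x := (ZSpan.floor (latticeBasis d) x : E d)) ⟨?_, Subtype.mem _⟩ ?_
    · have h1 := ZSpan.fract_apply (latticeBasis d) x
      have h2 : (ZSpan.floor (latticeBasis d) x : E d) = x - ZSpan.fract (latticeBasis d) x := by
        rw [h1]; abel
      rw [mem_closedBall_zero_iff, h2]
      exact (norm_sub_le _ _).trans (add_le_add (hS x hx) (hR _ (fract_mem_cell x)))
    · rw [mem_vadd_set_iff_neg_vadd_mem, vadd_eq_add, neg_add_eq_sub, ← ZSpan.fract_apply]
      exact fract_mem_cell x
  refine IntegrableOn.mono_set ?_ hsub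
  exact (integrableOn_finite_biUnion hfin).2 fun k _ => (hv.integrableOn_vadd_iff k).2 hi

end Periodic

/-! ### Periodization -/

/-- The sum of the translates of `g` by the lattice `ℤ^d`. -/
noncomputable def periodize (g : E d → ℝ) (x : E d) : ℝ := ∑' k : lattice d, g (x + k)

lemma periodic_periodize (g : E d → ℝ) : IsPeriodic (periodize g) := by
  intro i x
  have hi : EuclideanSpace.single i (1 : ℝ) ∈ lattice d :=
    Submodule.subset_span ⟨i, latticeBasis_apply i⟩
  unfold periodize
  rw [← (Equiv.addLeft (⟨_, hi⟩ : lattice d)).tsum_eq fun k : lattice d => g (x + k)]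
  simp [add_assoc]

/-- Local finiteness of the periodization: one finite set of lattice vectors serves all points of a
ball. This makes the sum smooth and allows it to be exchanged with integrals. -/
lemma exists_finset_periodize {g : E d → ℝ} (hg : HasCompactSupport g) (R : ℝ) :
    ∃ s : Finset (lattice d), ∀ x : E d, ‖x‖ ≤ R → ∀ k ∉ s, g (x + k) = 0 := by
  obtain ⟨S, hS⟩ := hg.isCompact.isBounded.exists_norm_le
  have hfin : {k : lattice d | ‖(k : E d)‖ ≤ S + R}.Finite := by
    have := ZSpan.setFinite_inter (latticeBasis d)
      (Metric.isBounded_closedBall (x := (0 : E d)) (r := S + R))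
    refine Finite.of_injOn (f := ((↑) : lattice d → E d)) ?_ Subtype.val_injective.injOn this
    intro k hk
    exact ⟨mem_closedBall_zero_iff.2 hk, k.2⟩
  refine ⟨hfin.toFinset, fun x hx k hk => ?_⟩
  by_contra hne
  have h1 := hS _ (subset_tsupport _ hne)
  apply hk
  simp only [Finite.mem_toFinset, mem_ofPred_eq]
  calc ‖(k : E d)‖ = ‖(x + k) - x‖ := by congr 1; abel
    _ ≤ S + R := (norm_sub_le _ _).trans (add_le_add h1 hx)

lemma contDiff_periodize {g : E d → ℝ} (hg : HasCompactSupport g) (hs : ContDiff ℝ ∞ g) :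
    ContDiff ℝ ∞ (periodize g) := by
  rw [contDiff_iff_contDiffAt]
  intro x
  obtain ⟨s, h⟩ := exists_finset_periodize hg (‖x‖ + 1)
  have : periodize g =ᶠ[nhds x] fun y => ∑ k ∈ s, g (y + k) := by
    filter_upwards [Metric.ball_mem_nhds x one_pos] with y hy
    refine tsum_eq_sum fun k hk => h y ?_ k hk
    have := norm_le_norm_add_norm_sub' y x
    rw [mem_ball_iff_norm] at hy
    linarith
  refine ContDiffAt.congr_of_eventuallyEq ?_ this
  exact (ContDiff.sum fun k _ => hs.comp (contDiff_id.add contDiff_const)).contDiffAt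

/-- The unfolding trick: the integral over `ℝ^d` splits into lattice translates of the cell,
periodicity of `v` moves each piece back to the cell, and the translates of `g` add up to its
periodization. -/
lemma integral_mul_periodize {g : E d → ℝ} (hg : HasCompactSupport g) (hc : Continuous g)
    {F : Type*} [NormedAddCommGroup F] [NormedSpace ℝ F]
    {v : E d → F} (hv : IsPeriodic v) (hi : Integrable v (torus d)) :
    ∫ x, g x • v x = ∫ x, periodize g x • v x ∂torus d := by
  have hint : Integrable (fun x => g x • v x) :=
    (hv.locallyIntegrable hi).integrable_smul_left_of_hasCompactSupport hc hg
  obtain ⟨R, hR⟩ := (isBounded_cell (d := d)).exists_norm_le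
  obtain ⟨s, h⟩ := exists_finset_periodize hg R
  rw [isAddFundamentalDomain_cell.integral_eq_tsum'' _ hint]
  have hterm : ∀ k : lattice d, ∫ x in cell d, g (k +ᵥ x) • v (k +ᵥ x)
      = ∫ x in cell d, g (x + k) • v x := fun k => by
    simp_rw [hv.vadd, Submodule.vadd_def, vadd_eq_add, add_comm (k : E d)]
  simp_rw [hterm]
  rw [tsum_eq_sum (s := s)]
  · rw [← integral_finsetSum]
    · refine setIntegral_congr_fun measurableSet_cell fun x hx => ?_
      simp only [periodize]
      rw [tsum_eq_sum (s := s) (fun k hk => h x (hR x hx) k hk), Finset.sum_smul]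
    · intro k _
      obtain ⟨C, hC⟩ := hg.exists_bound_of_continuous hc
      exact hi.bdd_smul C (hc.comp (continuous_id.add continuous_const)).aestronglyMeasurable
        (Filter.Eventually.of_forall fun x => hC _)
  · intro k hk
    rw [setIntegral_congr_fun (g := fun _ => 0) measurableSet_cell]
    · simp
    · intro x hx
      simp [h x (hR x hx) k hk]

/-! ### The algebra of smooth periodic functions -/

/-- Smooth functions on the torus. -/
structure IsSmoothPeriodic (ψ : E d → ℝ) : Prop where
  smooth : ContDiff ℝ ∞ ψ
  periodic : IsPeriodic ψ

lemma contDiff_pd {ψ : E d → ℝ} (h : ContDiff ℝ ∞ ψ) (j : Fin d) : ContDiff ℝ ∞ (pd j ψ) :=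
  (h.fderiv_right (m := ∞) (by simp)).clm_apply contDiff_const

lemma fderiv_comp_add {F : Type*} [NormedAddCommGroup F] [NormedSpace ℝ F] (ψ : E d → F)
    (a x : E d) : fderiv ℝ (fun y => ψ (y + a)) x = fderiv ℝ ψ (x + a) := by
  rw [fderiv_comp_add_right]

lemma IsPeriodic.fderiv {F : Type*} [NormedAddCommGroup F] [NormedSpace ℝ F] {ψ : E d → F}
    (h : IsPeriodic ψ) : IsPeriodic (fderiv ℝ ψ) := by
  intro i x
  rw [← fderiv_comp_add]
  congr 1
  ext y
  exact h i y

namespace IsSmoothPeriodic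

variable {ψ φ : E d → ℝ}

lemma continuous (h : IsSmoothPeriodic ψ) : Continuous ψ := h.smooth.continuous

lemma pd (h : IsSmoothPeriodic ψ) (j : Fin d) : IsSmoothPeriodic (pd j ψ) :=
  ⟨contDiff_pd h.smooth j, fun i x => by simp only [LeraySol.pd, h.periodic.fderiv i x]⟩

lemma sum {ι : Type*} {s : Finset ι} {ψ : ι → E d → ℝ} (h : ∀ k ∈ s, IsSmoothPeriodic (ψ k)) :
    IsSmoothPeriodic fun x => ∑ k ∈ s, ψ k x :=
  ⟨ContDiff.sum fun k hk => (h k hk).smooth,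
    fun i x => Finset.sum_congr rfl fun k hk => (h k hk).periodic i x⟩

lemma lap (h : IsSmoothPeriodic ψ) : IsSmoothPeriodic (lap ψ) :=
  sum fun j _ => (h.pd j).pd j

lemma mul (h : IsSmoothPeriodic ψ) (h' : IsSmoothPeriodic φ) :
    IsSmoothPeriodic fun x => ψ x * φ x :=
  ⟨h.smooth.mul h'.smooth, fun i x => by rw [h.periodic, h'.periodic]⟩

lemma add (h : IsSmoothPeriodic ψ) (h' : IsSmoothPeriodic φ) :
    IsSmoothPeriodic fun x => ψ x + φ x :=
  ⟨h.smooth.add h'.smooth, fun i x => by rw [h.periodic, h'.periodic]⟩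

lemma sub (h : IsSmoothPeriodic ψ) (h' : IsSmoothPeriodic φ) :
    IsSmoothPeriodic fun x => ψ x - φ x :=
  ⟨h.smooth.sub h'.smooth, fun i x => by rw [h.periodic, h'.periodic]⟩

lemma neg (h : IsSmoothPeriodic ψ) : IsSmoothPeriodic fun x => -ψ x :=
  ⟨h.smooth.neg, fun i x => by rw [h.periodic]⟩

lemma const (c : ℝ) : IsSmoothPeriodic fun _ : E d => c := ⟨contDiff_const, fun _ _ => rfl⟩

lemma const_mul (h : IsSmoothPeriodic ψ) (c : ℝ) : IsSmoothPeriodic fun x => c * ψ x :=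
  (const c).mul h

lemma comp_sub (h : IsSmoothPeriodic ψ) (a : E d) : IsSmoothPeriodic fun x => ψ (x - a) :=
  ⟨h.smooth.comp (contDiff_id.sub contDiff_const), h.periodic.comp_sub a⟩

lemma exists_bound (h : IsSmoothPeriodic ψ) : ∃ C : ℝ, 0 ≤ C ∧ ∀ x, |ψ x| ≤ C :=
  h.periodic.exists_bound h.continuous

lemma integrable (h : IsSmoothPeriodic ψ) : Integrable ψ (torus d) := by
  obtain ⟨C, -, hC⟩ := h.exists_bound
  exact Integrable.of_bound h.continuous.aestronglyMeasurable C (Filter.Eventually.of_forall hC)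

lemma integrable_mul (h : IsSmoothPeriodic ψ) {v : E d → ℝ} (hv : Integrable v (torus d)) :
    Integrable (fun x => v x * ψ x) (torus d) := by
  obtain ⟨C, -, hC⟩ := h.exists_bound
  exact hv.mul_bdd h.continuous.aestronglyMeasurable (Filter.Eventually.of_forall hC)

end IsSmoothPeriodic

lemma pd_comp_sub (j : Fin d) (ψ : E d → ℝ) (a x : E d) :
    pd j (fun y => ψ (y - a)) x = pd j ψ (x - a) := by
  simp only [pd, sub_eq_add_neg, fderiv_comp_add]

lemma lap_comp_sub (ψ : E d → ℝ) (a x : E d) :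
    lap (fun y => ψ (y - a)) x = lap ψ (x - a) := by
  simp only [lap]
  refine Finset.sum_congr rfl fun j _ => ?_
  rw [← pd_comp_sub]
  congr 1
  ext y
  exact pd_comp_sub j ψ a y

/-! ### Correlation with a smooth periodic kernel -/

/-- The correlation `x ↦ ∫ v(y) Ψ(y - x) dy` on the torus. -/
noncomputable def smoothing {F : Type*} [NormedAddCommGroup F] [NormedSpace ℝ F]
    (Ψ : E d → F) (v : E d → ℝ) (x : E d) : F :=
  ∫ y, v y • Ψ (y - x) ∂torus d

section Smoothing

variable {F : Type} [NormedAddCommGroup F] [NormedSpace ℝ F] {Ψ : E d → F} {v : E d → ℝ}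

lemma integrable_smoothing (hp : IsPeriodic Ψ) (hc : Continuous Ψ) (hv : Integrable v (torus d))
    (x : E d) : Integrable (fun y => v y • Ψ (y - x)) (torus d) := by
  obtain ⟨C, -, hC⟩ := hp.exists_bound hc
  exact hv.smul_bdd C (hc.comp (continuous_id.sub continuous_const)).aestronglyMeasurable
    (Filter.Eventually.of_forall fun y => hC _)

/-- The integral is differentiated under the sign, with dominating function `C |v|`. The minus sign
comes from the argument `y - x` of the kernel. -/
lemma hasFDerivAt_smoothing (hp : IsPeriodic Ψ) (hs : ContDiff ℝ 1 Ψ)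
    (hv : Integrable v (torus d)) (x : E d) :
    HasFDerivAt (smoothing Ψ v) (smoothing (fun z => -fderiv ℝ Ψ z) v x) x := by
  have hc' : Continuous fun z => -fderiv ℝ Ψ z := (hs.continuous_fderiv one_ne_zero).neg
  have hp' : IsPeriodic fun z => -fderiv ℝ Ψ z := fun i z => congrArg Neg.neg (hp.fderiv i z)
  obtain ⟨C, hC0, hC⟩ := hp'.exists_bound hc'
  refine hasFDerivAt_integral_of_dominated_of_fderiv_le (bound := fun y => |v y| * C)
    (F' := fun x y => v y • (-fderiv ℝ Ψ (y - x))) Filter.univ_mem ?_ ?_ ?_ ?_ ?_ ?_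
  · exact Filter.Eventually.of_forall fun x' =>
      (integrable_smoothing hp hs.continuous hv x').aestronglyMeasurable
  · exact integrable_smoothing hp hs.continuous hv x
  · exact (integrable_smoothing hp' hc' hv x).aestronglyMeasurable
  · refine Filter.Eventually.of_forall fun y x' _ => ?_
    rw [norm_smul]
    exact mul_le_mul_of_nonneg_left (hC _) (norm_nonneg _)
  · exact hv.abs.mul_const C
  · refine Filter.Eventually.of_forall fun y x' _ => ?_
    have h1 : HasFDerivAt Ψ (fderiv ℝ Ψ (y - x')) (y - x') :=
      (hs.differentiable one_ne_zero _).hasFDerivAt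
    have h2 : HasFDerivAt (fun z => y - z) (-ContinuousLinearMap.id ℝ (E d)) x' :=
      (hasFDerivAt_id x').const_sub y
    have h3 : HasFDerivAt (fun z => v y • Ψ (y - z)) _ x' := (h1.comp x' h2).const_smul (v y)
    refine h3.congr_fderiv (ContinuousLinearMap.ext fun z => ?_)
    simp

/-- The derivative is again a correlation, with a kernel valued in `E d →L[ℝ] F`; the induction
therefore runs over all target spaces at once. -/
lemma contDiff_nat_smoothing (hp : IsPeriodic Ψ) (hs : ContDiff ℝ ∞ Ψ)
    (hv : Integrable v (torus d)) (n : ℕ) : ContDiff ℝ n (smoothing Ψ v) := by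
  induction n generalizing F with
  | zero =>
    refine contDiff_zero.2 (continuous_iff_continuousAt.2 fun x => ?_)
    exact (hasFDerivAt_smoothing hp (hs.of_le (by simp)) hv x).continuousAt
  | succ n ih =>
    refine contDiff_succ_iff_hasFDerivAt.2
      ⟨_, ih (fun i z => ?_) ?_, hasFDerivAt_smoothing hp (hs.of_le (by simp)) hv⟩
    · exact congrArg Neg.neg (hp.fderiv i z)
    · exact (hs.fderiv_right (m := ∞) (by simp)).neg

lemma contDiff_smoothing (hp : IsPeriodic Ψ) (hs : ContDiff ℝ ∞ Ψ)
    (hv : Integrable v (torus d)) : ContDiff ℝ ∞ (smoothing Ψ v) :=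
  contDiff_infty.2 (contDiff_nat_smoothing hp hs hv)

lemma periodic_smoothing (hp : IsPeriodic Ψ) : IsPeriodic (smoothing Ψ v) := by
  intro i x
  unfold smoothing
  congr 1
  ext y
  have := hp.comp_sub (EuclideanSpace.single i (1 : ℝ)) i (y - x)
  simp only [add_sub_cancel_right] at this
  rw [← sub_sub, ← this]

end Smoothing

section RealSmoothing

variable {Ψ v : E d → ℝ}

lemma IsSmoothPeriodic.smoothing (h : IsSmoothPeriodic Ψ) (hv : Integrable v (torus d)) :
    IsSmoothPeriodic (smoothing Ψ v) :=
  ⟨contDiff_smoothing h.periodic h.smooth hv, periodic_smoothing h.periodic⟩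

lemma pd_smoothing (h : IsSmoothPeriodic Ψ) (hv : Integrable v (torus d)) (j : Fin d) (x : E d) :
    pd j (smoothing Ψ v) x = -smoothing (pd j Ψ) v x := by
  rw [pd, (hasFDerivAt_smoothing h.periodic (h.smooth.of_le (by simp)) hv x).fderiv,
    LeraySol.smoothing, ContinuousLinearMap.integral_apply, LeraySol.smoothing, ← integral_neg]
  · simp [pd]
  · exact integrable_smoothing
      (fun i z => congrArg (Neg.neg : (E d →L[ℝ] ℝ) → _) (h.periodic.fderiv i z))
      ((h.smooth.continuous_fderiv (by simp)).neg) hv x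

lemma pd_neg (j : Fin d) (g : E d → ℝ) (x : E d) : pd j (fun y => -g y) x = -pd j g x := by
  simp [pd]

lemma pd_pd_smoothing (h : IsSmoothPeriodic Ψ) (hv : Integrable v (torus d)) (j k : Fin d)
    (x : E d) : pd k (pd j (smoothing Ψ v)) x = smoothing (pd k (pd j Ψ)) v x := by
  have : pd j (smoothing Ψ v) = fun x => -smoothing (pd j Ψ) v x :=
    funext fun x => pd_smoothing h hv j x
  rw [this, pd_neg, pd_smoothing (h.pd j) hv, neg_neg]

lemma lap_smoothing (h : IsSmoothPeriodic Ψ) (hv : Integrable v (torus d)) (x : E d) :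
    lap (smoothing Ψ v) x = smoothing (lap Ψ) v x := by
  simp only [lap, pd_pd_smoothing h hv]
  unfold smoothing
  rw [← integral_finsetSum]
  · simp only [smul_eq_mul, Finset.mul_sum, lap]
  · intro j _
    exact integrable_smoothing ((h.pd j).pd j).periodic ((h.pd j).pd j).continuous hv x

lemma abs_smoothing_le {C : ℝ} (hC : ∀ x, |Ψ x| ≤ C) (hv : Integrable v (torus d)) (x : E d) :
    |smoothing Ψ v x| ≤ C * ∫ y, |v y| ∂torus d := by
  rw [← integral_const_mul]
  refine norm_integral_le_of_norm_le (f := fun y => v y • Ψ (y - x)) (hv.abs.const_mul C)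
    (Filter.Eventually.of_forall fun y => ?_)
  rw [smul_eq_mul, Real.norm_eq_abs, abs_mul, mul_comm]
  exact mul_le_mul_of_nonneg_right (hC _) (abs_nonneg _)

/-- Correlating with the constant `1` gives a constant function, by translation invariance, and its
derivative is minus the integral in question. -/
lemma IsSmoothPeriodic.integral_pd (h : IsSmoothPeriodic Ψ) (j : Fin d) :
    ∫ x, LeraySol.pd j Ψ x ∂torus d = 0 := by
  have h1 := pd_smoothing h (integrable_const (1 : ℝ)) j 0
  have h2 : LeraySol.smoothing Ψ (fun _ => (1 : ℝ)) = fun _ => ∫ y, Ψ y ∂torus d := by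
    ext x
    simpa [LeraySol.smoothing, sub_eq_add_neg] using h.periodic.integral_comp_add (-x)
  rw [h2] at h1
  simpa [LeraySol.smoothing, LeraySol.pd] using h1

end RealSmoothing

section Measurability

variable {Ψ : E d → ℝ} {α : Type*} [MeasurableSpace α] {μ : Measure α}
  {w : α → E d → ℝ}

/-- Joint measurability in the parameter and the point: the correlation is a partial integral of a
function that is measurable on the triple product. -/
lemma aestronglyMeasurable_smoothing [SFinite μ] (hc : Continuous Ψ)
    (hw : AEStronglyMeasurable (Function.uncurry w) (μ.prod (torus d))) :
    AEStronglyMeasurable (fun z : α × E d => smoothing Ψ (w z.1) z.2) (μ.prod (torus d)) := by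
  have h1 : AEStronglyMeasurable (fun q : (α × E d) × E d => Function.uncurry w (q.1.1, q.2))
      ((μ.prod (torus d)).prod (torus d)) := by
    refine hw.comp_quasiMeasurePreserving (f := fun q : (α × E d) × E d => (q.1.1, q.2)) ?_
    exact QuasiMeasurePreserving.prodMap Measure.quasiMeasurePreserving_fst
      (Measure.QuasiMeasurePreserving.id (torus d))
  have h2 : AEStronglyMeasurable (fun q : (α × E d) × E d => Ψ (q.2 - q.1.2))
      ((μ.prod (torus d)).prod (torus d)) := by
    have : Measurable fun q : (α × E d) × E d => q.2 - q.1.2 := by fun_prop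
    exact (hc.measurable.comp this).aestronglyMeasurable
  exact (h1.mul h2).integral_prod_right'

end Measurability

/-! ### The coarse-graining kernel -/

/-- The periodic kernel with `cg G ℓ v x = ∫ v(y) K(y - x) dy`. -/
noncomputable def cgKernel (G : E d → ℝ) (ℓ : ℝ) : E d → ℝ :=
  periodize fun r => (ℓ ^ d)⁻¹ * G (ℓ⁻¹ • r)

section Kernel

variable {G : E d → ℝ} {ℓ : ℝ}

lemma IsMollifier.hasCompactSupport (hG : IsMollifier G) : HasCompactSupport G :=
  HasCompactSupport.of_support_subset_isCompact (isCompact_closedBall 0 1)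
    ((subset_tsupport G).trans hG.support)

lemma IsMollifier.hasCompactSupport_scaled (hG : IsMollifier G) (hℓ : 0 < ℓ) :
    HasCompactSupport fun r => (ℓ ^ d)⁻¹ * G (ℓ⁻¹ • r) :=
  (hG.hasCompactSupport.comp_smul (inv_ne_zero hℓ.ne')).mul_left

lemma IsMollifier.contDiff_scaled (hG : IsMollifier G) :
    ContDiff ℝ ∞ fun r => (ℓ ^ d)⁻¹ * G (ℓ⁻¹ • r) :=
  contDiff_const.mul (hG.smooth.comp (contDiff_const_smul ℓ⁻¹))

lemma IsMollifier.integral_scaled (hG : IsMollifier G) (hℓ : 0 < ℓ) :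
    ∫ r, (ℓ ^ d)⁻¹ * G (ℓ⁻¹ • r) = 1 := by
  rw [integral_const_mul, Measure.integral_comp_inv_smul_of_nonneg _ _ hℓ.le, hG.integral_eq]
  simp [hℓ.ne']

lemma IsMollifier.cgKernel (hG : IsMollifier G) (hℓ : 0 < ℓ) : IsSmoothPeriodic (cgKernel G ℓ) :=
  ⟨contDiff_periodize (hG.hasCompactSupport_scaled hℓ) hG.contDiff_scaled, periodic_periodize _⟩

/-- Unfolding replaces the mollifier on `ℝ^d` by its periodization, and the shift `r = y - x` is
harmless because the integrand is periodic. From here on coarse-graining is handled only as a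
correlation on the torus. -/
lemma cg_eq_smoothing (hG : IsMollifier G) (hℓ : 0 < ℓ) {v : E d → ℝ} (hp : IsPeriodic v)
    (hv : Integrable v (torus d)) : cg G ℓ v = smoothing (cgKernel G ℓ) v := by
  ext x
  have h := integral_mul_periodize (hG.hasCompactSupport_scaled hℓ)
    (hG.contDiff_scaled (ℓ := ℓ)).continuous (hp.comp_add x) (hp.integrable_comp_add hv x)
  have hK := hG.cgKernel hℓ
  have h2 := IsPeriodic.integral_comp_add (v := fun y => v y * LeraySol.cgKernel G ℓ (y - x))
    (fun i y => congrArg₂ (· * ·) (hp i y) ((hK.comp_sub x).periodic i y)) x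
  unfold cg smoothing
  simp only [smul_eq_mul, add_sub_cancel_right, add_comm x] at h h2 ⊢
  rw [h, ← h2]
  simp only [LeraySol.cgKernel, mul_comm]

lemma cg_apply (hG : IsMollifier G) (hℓ : 0 < ℓ) {v : E d → E d} (hp : IsPeriodic v)
    (hv : Integrable v (torus d)) (x : E d) (i : Fin d) :
    cg G ℓ v x i = cg G ℓ (fun y => v y i) x := by
  have hint : Integrable (fun r => ((ℓ ^ d)⁻¹ * G (ℓ⁻¹ • r)) • v (x + r)) := by
    have := (hp.comp_add x).locallyIntegrable (hp.integrable_comp_add hv x)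
    simp only [add_comm x]
    exact this.integrable_smul_left_of_hasCompactSupport
      (hG.contDiff_scaled (ℓ := ℓ)).continuous (hG.hasCompactSupport_scaled hℓ)
  exact ((EuclideanSpace.proj i : E d →L[ℝ] ℝ).integral_comp_comm hint).symm

lemma periodize_neg (g : E d → ℝ) (x : E d) :
    periodize g (-x) = periodize (fun r => g (-r)) x := by
  unfold periodize
  rw [← (Equiv.neg (lattice d)).tsum_eq]
  simp [add_comm]

/-- The variable enters the kernel with a minus sign, so the scaled mollifier is reflected before it
is unfolded; the reflection does not change its integral over `ℝ^d`. -/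
lemma integral_cgKernel_sub (hG : IsMollifier G) (hℓ : 0 < ℓ) (y : E d) :
    ∫ x, cgKernel G ℓ (y - x) ∂torus d = 1 := by
  have h1 : ∀ x, cgKernel G ℓ (y - x)
      = periodize (fun r => (ℓ ^ d)⁻¹ * G (ℓ⁻¹ • (-r))) (x + -y) := fun x => by
    rw [← periodize_neg (fun r => (ℓ ^ d)⁻¹ * G (ℓ⁻¹ • r)), cgKernel]
    congr 1; abel
  simp_rw [h1]
  rw [(periodic_periodize _).integral_comp_add (-y)]
  have h2 := integral_mul_periodize (v := fun _ : E d => (1 : ℝ))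
    ((hG.hasCompactSupport_scaled hℓ).comp_homeomorph (Homeomorph.neg (E d)))
    ((hG.contDiff_scaled (ℓ := ℓ)).continuous.comp continuous_neg) (fun _ _ => rfl)
    (integrable_const _)
  simp only [Function.comp_def, smul_eq_mul, mul_one, Homeomorph.coe_neg] at h2
  rw [← h2, integral_neg_eq_self (fun r => (ℓ ^ d)⁻¹ * G (ℓ⁻¹ • r)), hG.integral_scaled hℓ]

/-- By Fubini and the unit mass of the kernel, coarse-graining preserves means. The integrated
cumulants are computed from this. -/
lemma integral_smoothing_cgKernel (hG : IsMollifier G) (hℓ : 0 < ℓ) {v : E d → ℝ}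
    (hv : Integrable v (torus d)) :
    ∫ x, smoothing (cgKernel G ℓ) v x ∂torus d = ∫ x, v x ∂torus d := by
  have hK := hG.cgKernel hℓ
  obtain ⟨C, -, hC⟩ := hK.exists_bound
  unfold smoothing
  rw [integral_integral_swap]
  · refine integral_congr_ae (Filter.Eventually.of_forall fun y => ?_)
    simp only [smul_eq_mul]
    rw [integral_const_mul, integral_cgKernel_sub hG hℓ, mul_one]
  · have h1 : Integrable (fun q : E d × E d => v q.2) ((torus d).prod (torus d)) := hv.comp_snd _
    refine h1.smul_bdd C ?_ (Filter.Eventually.of_forall fun q => hC _)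
    exact (hK.continuous.comp (continuous_snd.sub continuous_fst)).aestronglyMeasurable

end Kernel

/-! ### From weak to absolutely continuous functions of time -/

section Time

/-- A du Bois-Reymond lemma with initial value. -/
lemma ae_eq_add_integral_of_weak {T c : ℝ} (hT : 0 < T) {m g : ℝ → ℝ}
    (hm : Integrable m (volume.restrict (Ioo 0 T)))
    (hg : Integrable g (volume.restrict (Ioo 0 T)))
    (h : ∀ χ : ℝ → ℝ, ContDiff ℝ ∞ χ → (∃ b < T, ∀ t, b ≤ t → χ t = 0) →
      ∫ t, (m t * deriv χ t + g t * χ t) ∂volume.restrict (Ioo 0 T) + c * χ 0 = 0) :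
    ∀ᵐ t ∂volume.restrict (Ioo 0 T), m t = c + ∫ s in 0..t, g s := by
  have hgi : IntervalIntegrable g volume 0 T := by
    rw [intervalIntegrable_iff_integrableOn_Ioo_of_le hT.le]; exact hg
  have hac : AbsolutelyContinuousOnInterval (fun t => ∫ s in 0..t, g s) 0 T :=
    hgi.absolutelyContinuousOnInterval_intervalIntegral left_mem_uIcc
  have hGc : ContinuousOn (fun t => ∫ s in 0..t, g s) (Icc 0 T) := by
    rw [← uIcc_of_le hT.le]; exact hac.continuousOn
  have hGi : Integrable (fun t => ∫ s in 0..t, g s) (volume.restrict (Ioo 0 T)) :=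
    (hGc.integrableOn_Icc).mono_set Ioo_subset_Icc_self
  have hloc : Integrable (fun t => m t - c - ∫ s in 0..t, g s) (volume.restrict (Ioo 0 T)) :=
    (hm.sub (integrable_const c)).sub hGi
  have key : ∀ᵐ t, t ∈ Ioo 0 T → m t - c - ∫ s in 0..t, g s = 0 := by
    refine isOpen_Ioo.ae_eq_zero_of_integral_contDiff_smul_eq_zero
      (IntegrableOn.locallyIntegrableOn hloc) fun η hη hηc hηs => ?_
    -- The primitive of `η` that starts at `T` vanishes to the right of the support of `η`, so it is
    -- an admissible test function, and `χ 0 = -∫ η` produces the constant `c`.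
    set χ : ℝ → ℝ := fun t => ∫ s in T..t, η s with hχ
    have hd : ∀ t, HasDerivAt χ (η t) t := fun t =>
      intervalIntegral.integral_hasDerivAt_right (hη.continuous.intervalIntegrable _ _)
        (hη.continuous.stronglyMeasurableAtFilter _ _) hη.continuous.continuousAt
    have hdχ : deriv χ = η := funext fun t => (hd t).deriv
    have hχs : ContDiff ℝ ∞ χ := by
      refine contDiff_infty_iff_deriv.2 ⟨fun t => (hd t).differentiableAt, ?_⟩
      rw [hdχ]; exact hη
    have hvan : ∃ b < T, ∀ t, b ≤ t → χ t = 0 := by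
      obtain ⟨b, hbT, hb⟩ : ∃ b < T, ∀ t ∈ tsupport η, t ≤ b := by
        rcases (tsupport η).eq_empty_or_nonempty with he | hne
        · exact ⟨0, hT, by simp [he]⟩
        · obtain ⟨b, hb, hmax⟩ := hηc.isCompact.exists_isGreatest hne
          exact ⟨b, (hηs hb).2, hmax⟩
      refine ⟨b, hbT, fun t hbt => ?_⟩
      refine intervalIntegral.integral_zero_ae ?_
      have hne : ∀ᵐ s : ℝ, s ≠ b := by simp [ae_iff, measure_singleton]
      filter_upwards [hne] with s hsb hs
      by_contra hs0
      have h1 := hb s (subset_tsupport _ hs0)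
      have h2 : min T t < s := hs.1
      have : b ≤ min T t := le_min hbT.le hbt
      linarith
    have h1 := h χ hχs hvan
    rw [hdχ] at h1
    have hχT : χ T = 0 := by simp [hχ]
    have hχac : AbsolutelyContinuousOnInterval χ 0 T :=
      (hχs.of_le (by simp)).contDiffOn.absolutelyContinuousOnInterval
    -- Integration by parts moves the primitive from the test function to `g`. Both boundary terms
    -- vanish: the integral of `g` is zero at `0`, and `χ` is zero at `T`.
    have hparts := hac.integral_mul_deriv_eq_deriv_mul hχac
    rw [hdχ, hχT] at hparts
    have hderiv : ∫ t in 0..T, deriv (fun t => ∫ s in 0..t, g s) t * χ t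
        = ∫ t in 0..T, g t * χ t := by
      refine intervalIntegral.integral_congr_ae ?_
      filter_upwards [hgi.ae_hasDerivAt_integral] with t ht hmem
      rw [(ht (uIoc_subset_uIcc hmem) 0 left_mem_uIcc).deriv]
    rw [hderiv] at hparts
    have hηT : ∫ t in 0..T, η t = -χ 0 := by
      simp only [hχ]; rw [intervalIntegral.integral_symm]
    simp only [intervalIntegral.integral_same, mul_zero, zero_mul, sub_zero, zero_sub,
      intervalIntegral.integral_of_le hT.le, integral_Ioc_eq_integral_Ioo] at hparts hηT
    obtain ⟨Cη, hCη⟩ := hηc.exists_bound_of_continuous hη.continuous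
    have ib : ∀ {w : ℝ → ℝ}, Integrable w (volume.restrict (Ioo 0 T)) →
        Integrable (fun t => w t * η t) (volume.restrict (Ioo 0 T)) := fun hw =>
      hw.mul_bdd hη.continuous.aestronglyMeasurable (Filter.Eventually.of_forall hCη)
    have igχ : Integrable (fun t => g t * χ t) (volume.restrict (Ioo 0 T)) := by
      obtain ⟨C, hC⟩ := (isCompact_Icc (a := (0 : ℝ)) (b := T)).exists_bound_of_continuousOn
        hχs.continuous.continuousOn
      refine hg.mul_bdd (c := C) hχs.continuous.aestronglyMeasurable ?_
      filter_upwards [ae_restrict_mem measurableSet_Ioo] with t ht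
      exact hC t (Ioo_subset_Icc_self ht)
    rw [integral_add (ib hm) igχ] at h1
    have hsupp : ∫ t, η t • (m t - c - ∫ s in 0..t, g s)
        = ∫ t in Ioo 0 T, η t • (m t - c - ∫ s in 0..t, g s) := by
      refine (setIntegral_eq_integral_of_forall_compl_eq_zero fun t ht => ?_).symm
      rw [image_eq_zero_of_notMem_tsupport fun hmem => ht (hηs hmem), zero_smul]
    have hexp : ∀ t, η t • (m t - c - ∫ s in 0..t, g s)
        = m t * η t - c * η t - (∫ s in 0..t, g s) * η t := fun t => by
      rw [smul_eq_mul]; ring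
    have e1 : ∫ t in Ioo 0 T, (m t * η t - c * η t - (∫ s in 0..t, g s) * η t)
        = (∫ t in Ioo 0 T, m t * η t) - (∫ t in Ioo 0 T, c * η t)
          - ∫ t in Ioo 0 T, (∫ s in 0..t, g s) * η t := by
      have i1 : Integrable (fun t => m t * η t - c * η t) (volume.restrict (Ioo 0 T)) :=
        (ib hm).sub (ib (integrable_const c))
      rw [integral_sub i1 (ib hGi), integral_sub (ib hm) (ib (integrable_const c))]
    rw [hsupp]
    simp_rw [hexp]
    rw [e1, integral_const_mul, hparts, hηT]
    linarith
  rw [ae_restrict_iff' measurableSet_Ioo]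
  filter_upwards [key] with t ht hmem
  linarith [ht hmem]

end Time

/-! ### The momentum equation at almost every time, for all tests simultaneously -/

/-- A countable family of smooth periodic functions that is dense in the `C²` sense relevant for
the Navier-Stokes equations. -/
lemma exists_countable_dense_tests (d : ℕ) : ∃ D : ℕ → E d → ℝ, (∀ n, IsSmoothPeriodic (D n)) ∧
    ∀ ψ, IsSmoothPeriodic ψ → ∀ ε > 0, ∃ n, ∀ x, |D n x - ψ x| ≤ ε ∧
      (∀ j, |pd j (D n) x - pd j ψ x| ≤ ε) ∧ |lap (D n) x - lap ψ x| ≤ ε := by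
  let K : Set (E d) := closure (cell d)
  have : CompactSpace K := isCompact_iff_compactSpace.1 isBounded_cell.isCompact_closure
  let S := {ψ : E d → ℝ // IsSmoothPeriodic ψ}
  let Φ : S → C(K, ℝ × (Fin d → ℝ) × ℝ) := fun ψ =>
    ⟨fun x => (ψ.1 x, fun j => pd j ψ.1 x, lap ψ.1 x), by
      have h1 := ψ.2.continuous
      have h2 := fun j => (ψ.2.pd j).continuous
      have h3 := ψ.2.lap.continuous
      fun_prop⟩
  -- Values, gradients and Laplacians on the compact closed cell embed the tests in a second
  -- countable space of continuous maps. The induced topology is second countable as well, hence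
  -- separable.
  let : TopologicalSpace S := TopologicalSpace.induced Φ inferInstance
  have : SecondCountableTopology S := TopologicalSpace.secondCountableTopology_induced _ _ Φ
  have : Nonempty S := ⟨⟨fun _ => 0, .const 0⟩⟩
  refine ⟨fun n => (TopologicalSpace.denseSeq S n).1,
    fun n => (TopologicalSpace.denseSeq S n).2, fun ψ hψ ε hε => ?_⟩
  have hopen : IsOpen (Φ ⁻¹' Metric.ball (Φ ⟨ψ, hψ⟩) ε) :=
    Metric.isOpen_ball.preimage continuous_induced_dom
  obtain ⟨n, hn⟩ := (TopologicalSpace.denseRange_denseSeq S).exists_mem_open hopen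
    ⟨⟨ψ, hψ⟩, Metric.mem_ball_self hε⟩
  refine ⟨n, fun x => ?_⟩
  have hD := (TopologicalSpace.denseSeq S n).2
  have hx := (ContinuousMap.dist_apply_le_dist
    (⟨ZSpan.fract (latticeBasis d) x, subset_closure (fract_mem_cell x)⟩ : K)).trans
    (le_of_lt (Metric.mem_ball.1 hn))
  simp only [Φ, ContinuousMap.coe_mk, Prod.dist_eq, max_le_iff, Real.dist_eq,
    dist_pi_le_iff hε.le] at hx
  rw [hD.periodic.apply_fract, hψ.periodic.apply_fract, hD.lap.periodic.apply_fract,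
    hψ.lap.periodic.apply_fract] at hx
  refine ⟨hx.1, fun j => ?_, hx.2.2⟩
  have := hx.2.1 j
  rwa [(hD.pd j).periodic.apply_fract, (hψ.pd j).periodic.apply_fract] at this

/-- The regularity of a Leray solution at almost every fixed time. -/
structure IsSlice (v w : E d → E d) (q : E d → ℝ) : Prop where
  v_periodic : IsPeriodic v
  v_memLp : MemLp v 2 (torus d)
  v_solenoidal : IsSolenoidal v
  w_periodic : IsPeriodic w
  w_memLp : MemLp w 2 (torus d)
  q_periodic : IsPeriodic q
  q_integrable : Integrable q (torus d)

/-- The right hand side of the momentum equation, tested with `ψ`. -/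
noncomputable def momentumRhs (ν : ℝ) (v w : E d → E d) (q : E d → ℝ) (i : Fin d) (ψ : E d → ℝ) :
    ℝ :=
  ∫ y, (∑ j, v y i * v y j * pd j ψ y + q y * pd i ψ y + ν * (v y i * lap ψ y) + w y i * ψ y)
    ∂torus d

section Coordinates

variable {α : Type*} [MeasurableSpace α] {μ : Measure α}

lemma memLp_apply {v : α → E d} (hv : MemLp v 2 μ) (i : Fin d) : MemLp (fun y => v y i) 2 μ :=
  (EuclideanSpace.proj i : E d →L[ℝ] ℝ).comp_memLp' hv

lemma integrable_apply [IsFiniteMeasure μ] {v : α → E d} (hv : MemLp v 2 μ) (i : Fin d) :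
    Integrable (fun y => v y i) μ :=
  (memLp_apply hv i).integrable one_le_two

lemma integrable_apply_mul {v w : α → E d} (hv : MemLp v 2 μ) (hw : MemLp w 2 μ) (i j : Fin d) :
    Integrable (fun y => v y i * w y j) μ :=
  (memLp_apply hv i).integrable_mul (memLp_apply hw j)

lemma inner_eq_sum (a b : E d) : inner ℝ a b = ∑ i, a i * b i := by
  simp [PiLp.inner_apply, mul_comm]

lemma norm_sq_eq_sum (a : E d) : ‖a‖ ^ 2 = ∑ i, a i * a i := by
  rw [EuclideanSpace.real_norm_sq_eq]; simp [sq]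

lemma integrable_inner_of_memLp {v w : α → E d} (hv : MemLp v 2 μ) (hw : MemLp w 2 μ) :
    Integrable (fun y => inner ℝ (v y) (w y)) μ := by
  simp_rw [inner_eq_sum]
  exact integrable_finsetSum _ fun i _ => integrable_apply_mul hv hw i i

lemma integrable_norm_sq_of_memLp {v : α → E d} (hv : MemLp v 2 μ) :
    Integrable (fun y => ‖v y‖ ^ 2) μ := by
  simp_rw [norm_sq_eq_sum]
  exact integrable_finsetSum _ fun i _ => integrable_apply_mul hv hv i i

end Coordinates

namespace IsSlice

variable {v w : E d → E d} {q : E d → ℝ} {ν : ℝ} {ψ φ : E d → ℝ}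

lemma integrable_momentumRhs (h : IsSlice v w q) (hψ : IsSmoothPeriodic ψ) (ν : ℝ) (i : Fin d) :
    Integrable (fun y => ∑ j, v y i * v y j * pd j ψ y + q y * pd i ψ y + ν * (v y i * lap ψ y)
      + w y i * ψ y) (torus d) :=
  (((integrable_finsetSum _ fun j _ =>
    (hψ.pd j).integrable_mul (integrable_apply_mul h.v_memLp h.v_memLp i j)).add
    ((hψ.pd i).integrable_mul h.q_integrable)).add
    ((hψ.lap.integrable_mul (integrable_apply h.v_memLp i)).const_mul ν)).add
    (hψ.integrable_mul (integrable_apply h.w_memLp i))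

/-- Continuity of the tested equation in the test function. The constant is a first-order integral
of the solution at the given time, and for a Leray solution it is integrable in time, so the
estimate survives integration over `(0,t)`. -/
lemma abs_momentumRhs_sub_le (h : IsSlice v w q) (hψ : IsSmoothPeriodic ψ)
    (hφ : IsSmoothPeriodic φ) (hν : 0 ≤ ν) (i : Fin d) {ε : ℝ}
    (h0 : ∀ x, |ψ x - φ x| ≤ ε) (h1 : ∀ x j, |pd j ψ x - pd j φ x| ≤ ε)
    (h2 : ∀ x, |lap ψ x - lap φ x| ≤ ε) :
    |momentumRhs ν v w q i ψ - momentumRhs ν v w q i φ| ≤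
      ε * ∫ y, (∑ j, |v y i * v y j| + |q y| + ν * |v y i| + |w y i|) ∂torus d := by
  unfold momentumRhs
  rw [← integral_sub (h.integrable_momentumRhs hψ ν i) (h.integrable_momentumRhs hφ ν i),
    ← integral_const_mul, ← Real.norm_eq_abs]
  have hb : Integrable (fun y => ∑ j, |v y i * v y j| + |q y| + ν * |v y i| + |w y i|)
      (torus d) :=
    (((integrable_finsetSum _ fun j _ => (integrable_apply_mul h.v_memLp h.v_memLp i j).abs).add
      h.q_integrable.abs).add ((integrable_apply h.v_memLp i).abs.const_mul ν)).add
      (integrable_apply h.w_memLp i).abs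
  refine norm_integral_le_of_norm_le (hb.const_mul ε) (Filter.Eventually.of_forall fun y => ?_)
  have hsplit : (∑ j, v y i * v y j * pd j ψ y + q y * pd i ψ y + ν * (v y i * lap ψ y)
      + w y i * ψ y) - (∑ j, v y i * v y j * pd j φ y + q y * pd i φ y + ν * (v y i * lap φ y)
      + w y i * φ y) = ∑ j, v y i * v y j * (pd j ψ y - pd j φ y) + q y * (pd i ψ y - pd i φ y)
      + ν * (v y i * (lap ψ y - lap φ y)) + w y i * (ψ y - φ y) := by
    simp only [mul_sub, Finset.sum_sub_distrib]; ring
  have e : ∀ a b : ℝ, |b| ≤ ε → |a * b| ≤ ε * |a| := fun a b hb => by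
    rw [abs_mul, mul_comm]; exact mul_le_mul_of_nonneg_right hb (abs_nonneg a)
  rw [hsplit, Real.norm_eq_abs]
  calc _ ≤ ∑ j, |v y i * v y j * (pd j ψ y - pd j φ y)| + |q y * (pd i ψ y - pd i φ y)|
      + |ν * (v y i * (lap ψ y - lap φ y))| + |w y i * (ψ y - φ y)| :=
        (abs_add_le _ _).trans (add_le_add_left ((abs_add_le _ _).trans (add_le_add_left
          ((abs_add_le _ _).trans (add_le_add_left (Finset.abs_sum_le_sum_abs _ _) _)) _)) _)
    _ ≤ ∑ j, ε * |v y i * v y j| + ε * |q y| + ν * (ε * |v y i|) + ε * |w y i| := by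
        rw [abs_mul ν, abs_of_nonneg hν]
        exact add_le_add (add_le_add (add_le_add (Finset.sum_le_sum fun j _ => e _ _ (h1 y j))
          (e _ _ (h1 y i))) (mul_le_mul_of_nonneg_left (e _ _ (h2 y)) hν)) (e _ _ (h0 y))
    _ = _ := by rw [← Finset.mul_sum]; ring

end IsSlice

section SpaceTime

lemma spaceTime_eq (d : ℕ) (T : ℝ) :
    spaceTime d T = (volume.restrict (Ioo 0 T)).prod (torus d) := rfl

instance (T : ℝ) : IsFiniteMeasure (spaceTime d T) := by
  rw [spaceTime_eq]; infer_instance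

lemma spaceTime_mono {s T : ℝ} (h : s ≤ T) : spaceTime d s ≤ spaceTime d T :=
  Measure.prod_mono (Measure.restrict_mono (Ioo_subset_Ioo_right h) le_rfl) le_rfl

lemma ae_restrict_Ioo_mono {s T : ℝ} (h : s ≤ T) {P : ℝ → Prop}
    (hP : ∀ᵐ t ∂volume.restrict (Ioo 0 T), P t) : ∀ᵐ t ∂volume.restrict (Ioo 0 s), P t :=
  ae_mono (Measure.restrict_mono (Ioo_subset_Ioo_right h) le_rfl) hP

/-- A continuous function is bounded on `(0,T) × cell`. -/
lemma exists_bound_spaceTime {g : ℝ × E d → ℝ} (hg : Continuous g) (T : ℝ) :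
    ∃ C : ℝ, ∀ᵐ z ∂spaceTime d T, ‖g z‖ ≤ C := by
  have hK : IsCompact (Icc 0 T ×ˢ closure (cell d)) :=
    isCompact_Icc.prod isBounded_cell.isCompact_closure
  obtain ⟨C, hC⟩ := hK.exists_bound_of_continuousOn hg.continuousOn
  refine ⟨C, ?_⟩
  rw [spaceTime_eq, torus, Measure.prod_restrict, ← Measure.volume_eq_prod]
  filter_upwards [ae_restrict_mem (measurableSet_Ioo.prod measurableSet_cell)] with z hz
  exact hC z ⟨Ioo_subset_Icc_self hz.1, subset_closure hz.2⟩

lemma Integrable.mul_continuous_spaceTime {T : ℝ} {F g : ℝ × E d → ℝ}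
    (hF : Integrable F (spaceTime d T)) (hg : Continuous g) :
    Integrable (fun z => F z * g z) (spaceTime d T) := by
  obtain ⟨C, hC⟩ := exists_bound_spaceTime hg T
  exact hF.mul_bdd hg.aestronglyMeasurable hC

lemma isTest_mul {T : ℝ} {χ : ℝ → ℝ} {ψ : E d → ℝ} (hχ : ContDiff ℝ ∞ χ)
    (hv : ∃ b < T, ∀ t, b ≤ t → χ t = 0) (hψ : IsSmoothPeriodic ψ) :
    IsTest T fun t x => χ t * ψ x where
  smooth := (hχ.comp contDiff_fst).mul (hψ.smooth.comp contDiff_snd)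
  periodic t i x := by simp only [hψ.periodic i x]
  vanish := by
    obtain ⟨b, hb, h⟩ := hv
    exact ⟨b, hb, fun t ht x => by rw [h t ht, zero_mul]⟩

lemma pd_const_mul (c : ℝ) {ψ : E d → ℝ} (hψ : ContDiff ℝ ∞ ψ) (j : Fin d) (x : E d) :
    pd j (fun y => c * ψ y) x = c * pd j ψ x := by
  simp [pd, fderiv_const_mul (hψ.differentiable (by simp) x)]

lemma lap_const_mul (c : ℝ) {ψ : E d → ℝ} (hψ : ContDiff ℝ ∞ ψ) (x : E d) :
    lap (fun y => c * ψ y) x = c * lap ψ x := by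
  unfold lap
  rw [Finset.mul_sum]
  refine Finset.sum_congr rfl fun j _ => ?_
  rw [← pd_const_mul c (contDiff_pd hψ j)]
  congr 1
  ext y
  exact pd_const_mul c hψ j y

end SpaceTime

namespace IsLeraySolution

variable {T₀ ν : ℝ} {u₀ : E d → E d} {f u : ℝ → E d → E d} {p : ℝ → E d → ℝ}
  {Du : ℝ → E d → Fin d → Fin d → ℝ}

lemma ae_isSlice (hu : IsLeraySolution T₀ ν u₀ f u p Du) :
    ∀ᵐ t ∂volume.restrict (Ioo 0 T₀), IsSlice (u t) (f t) (p t) := by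
  obtain ⟨C, hC⟩ := hu.u_bounded
  have hf : Integrable (fun z : ℝ × E d => ‖f z.1 z.2‖ ^ 2) (spaceTime d T₀) :=
    integrable_norm_sq_of_memLp hu.f_memLp
  filter_upwards [hC, hu.solenoidal, hu.u_measurable.prodMk_left,
    hu.f_memLp.aestronglyMeasurable.prodMk_left, hf.prod_right_ae,
    hu.p_integrable.prod_right_ae] with t h1 h2 h3 h4 h5 h6
  exact ⟨hu.u_periodic t, ⟨h3, h1.trans_lt ENNReal.coe_lt_top⟩, h2, hu.f_periodic t,
    (memLp_two_iff_integrable_sq_norm h4).2 h5, hu.p_periodic t, h6⟩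

lemma exists_bound_sq (hu : IsLeraySolution T₀ ν u₀ f u p Du) :
    ∃ C : ℝ, 0 ≤ C ∧ ∀ᵐ t ∂volume.restrict (Ioo 0 T₀), ∫ x, ‖u t x‖ ^ 2 ∂torus d ≤ C := by
  obtain ⟨C, hC⟩ := hu.u_bounded
  refine ⟨(C : ℝ) ^ 2, by positivity, ?_⟩
  filter_upwards [hC, hu.ae_isSlice] with t h1 h2
  have h3 := h2.v_memLp.eLpNorm_eq_integral_rpow_norm (by simp) (by simp)
  rw [h3] at h1
  have h4 : (∫ x, ‖u t x‖ ^ 2 ∂torus d) ^ (2⁻¹ : ℝ) ≤ C := by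
    have := ENNReal.ofReal_le_iff_le_toReal (ENNReal.coe_ne_top) |>.1 h1
    simpa using this
  have h0 : 0 ≤ ∫ x, ‖u t x‖ ^ 2 ∂torus d := integral_nonneg fun x => by positivity
  calc _ = ((∫ x, ‖u t x‖ ^ 2 ∂torus d) ^ (2⁻¹ : ℝ)) ^ 2 := by
        rw [← Real.rpow_natCast, ← Real.rpow_mul h0]; norm_num
    _ ≤ _ := by gcongr

/-- The `L^∞L²` bound on a finite time interval, integrated in time. Products of velocity components
thereby become integrable on space-time. -/
lemma u_memLp (hu : IsLeraySolution T₀ ν u₀ f u p Du) :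
    MemLp (Function.uncurry u) 2 (spaceTime d T₀) := by
  rw [memLp_two_iff_integrable_sq_norm hu.u_measurable, spaceTime_eq,
    integrable_prod_iff (by exact hu.u_measurable.norm.pow 2)]
  obtain ⟨C, hC0, hC⟩ := hu.exists_bound_sq
  constructor
  · filter_upwards [hu.ae_isSlice] with t ht
    exact integrable_norm_sq_of_memLp ht.v_memLp
  · refine Integrable.of_bound (C := C) ?_ ?_
    · exact (hu.u_measurable.norm.pow 2).norm.integral_prod_right'
    · filter_upwards [hC] with t ht
      simp only [Function.uncurry, norm_pow, norm_norm]
      rwa [Real.norm_of_nonneg (integral_nonneg fun x => by positivity)]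

lemma integrable_momentumRhs_uncurry (hu : IsLeraySolution T₀ ν u₀ f u p Du) (i : Fin d)
    {ψ : E d → ℝ} (hψ : IsSmoothPeriodic ψ) :
    Integrable (fun z : ℝ × E d => ∑ j, u z.1 z.2 i * u z.1 z.2 j * pd j ψ z.2
      + p z.1 z.2 * pd i ψ z.2 + ν * (u z.1 z.2 i * lap ψ z.2) + f z.1 z.2 i * ψ z.2)
      (spaceTime d T₀) := by
  have hc : ∀ {g : E d → ℝ}, IsSmoothPeriodic g → Continuous fun z : ℝ × E d => g z.2 :=
    fun hg => hg.continuous.comp continuous_snd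
  exact (((integrable_finsetSum _ fun j _ => Integrable.mul_continuous_spaceTime
    (integrable_apply_mul hu.u_memLp hu.u_memLp i j) (hc (hψ.pd j))).add
    (Integrable.mul_continuous_spaceTime hu.p_integrable (hc (hψ.pd i)))).add
    ((Integrable.mul_continuous_spaceTime
      (integrable_apply hu.u_memLp i) (hc hψ.lap)).const_mul ν)).add
    (Integrable.mul_continuous_spaceTime (integrable_apply hu.f_memLp i) (hc hψ))

lemma integrable_momentumRhs (hu : IsLeraySolution T₀ ν u₀ f u p Du) (i : Fin d)
    {ψ : E d → ℝ} (hψ : IsSmoothPeriodic ψ) :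
    Integrable (fun t => momentumRhs ν (u t) (f t) (p t) i ψ) (volume.restrict (Ioo 0 T₀)) :=
  (hu.integrable_momentumRhs_uncurry i hψ).integral_prod_left

lemma integrable_test (hu : IsLeraySolution T₀ ν u₀ f u p Du) (i : Fin d)
    {ψ : E d → ℝ} (hψ : IsSmoothPeriodic ψ) :
    Integrable (fun z : ℝ × E d => u z.1 z.2 i * ψ z.2) (spaceTime d T₀) :=
  Integrable.mul_continuous_spaceTime (integrable_apply hu.u_memLp i)
    (hψ.continuous.comp continuous_snd)

/-- The momentum equation is tested with products `χ(t) ψ(x)`. After Fubini it says that `t ↦ ∫ u_i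
ψ` has the tested right hand side as weak derivative and `∫ (u₀)_i ψ` as initial value. The null set
still depends on `ψ`. -/
lemma ae_integral_mul_eq_of_test (hT₀ : 0 < T₀) (hu : IsLeraySolution T₀ ν u₀ f u p Du) (i : Fin d)
    {ψ : E d → ℝ} (hψ : IsSmoothPeriodic ψ) :
    ∀ᵐ t ∂volume.restrict (Ioo 0 T₀), ∫ x, u t x i * ψ x ∂torus d =
      ∫ x, u₀ x i * ψ x ∂torus d + ∫ s in 0..t, momentumRhs ν (u s) (f s) (p s) i ψ := by
  refine ae_eq_add_integral_of_weak hT₀ (hu.integrable_test i hψ).integral_prod_left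
    (hu.integrable_momentumRhs i hψ) fun χ hχ hvan => ?_
  have hm := hu.momentum i _ (isTest_mul hχ hvan hψ)
  have hχd : Continuous (deriv χ) := hχ.continuous_deriv (by simp)
  have e0 : ∀ z : ℝ × E d, deriv (fun s => χ s * ψ z.2) z.1 = deriv χ z.1 * ψ z.2 := fun z =>
    deriv_mul_const (hχ.differentiable (by simp) _) _
  simp only [e0, pd_const_mul _ hψ.smooth, lap_const_mul _ hψ.smooth] at hm
  have e1 : ∀ z : ℝ × E d, u z.1 z.2 i * (deriv χ z.1 * ψ z.2)
      + ∑ j, u z.1 z.2 i * u z.1 z.2 j * (χ z.1 * pd j ψ z.2) + p z.1 z.2 * (χ z.1 * pd i ψ z.2)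
      + ν * (u z.1 z.2 i * (χ z.1 * lap ψ z.2)) + f z.1 z.2 i * (χ z.1 * ψ z.2)
      = u z.1 z.2 i * ψ z.2 * deriv χ z.1 + (∑ j, u z.1 z.2 i * u z.1 z.2 j * pd j ψ z.2
      + p z.1 z.2 * pd i ψ z.2 + ν * (u z.1 z.2 i * lap ψ z.2) + f z.1 z.2 i * ψ z.2) * χ z.1 :=
    fun z => by
      have : ∑ j, u z.1 z.2 i * u z.1 z.2 j * (χ z.1 * pd j ψ z.2)
          = (∑ j, u z.1 z.2 i * u z.1 z.2 j * pd j ψ z.2) * χ z.1 := by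
        rw [Finset.sum_mul]; exact Finset.sum_congr rfl fun j _ => by ring
      rw [this]; ring
  simp only [e1] at hm
  rw [spaceTime_eq, integral_prod] at hm
  · have e2 : ∀ᵐ t ∂volume.restrict (Ioo 0 T₀),
        ∫ x, (u t x i * ψ x * deriv χ t + (∑ j, u t x i * u t x j * pd j ψ x
          + p t x * pd i ψ x + ν * (u t x i * lap ψ x) + f t x i * ψ x) * χ t) ∂torus d
        = (∫ x, u t x i * ψ x ∂torus d) * deriv χ t
          + momentumRhs ν (u t) (f t) (p t) i ψ * χ t := by
      filter_upwards [hu.ae_isSlice] with t ht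
      rw [integral_add ((hψ.integrable_mul (integrable_apply ht.v_memLp i)).mul_const _)
        ((ht.integrable_momentumRhs hψ ν i).mul_const _), integral_mul_const, integral_mul_const]
      rfl
    rw [integral_congr_ae e2] at hm
    have e3 : ∫ x, u₀ x i * (χ 0 * ψ x) ∂torus d = (∫ x, u₀ x i * ψ x ∂torus d) * χ 0 := by
      rw [← integral_mul_const]
      exact integral_congr_ae (Filter.Eventually.of_forall fun x => by simp only; ring)
    rwa [e3] at hm
  · exact (Integrable.mul_continuous_spaceTime (hu.integrable_test i hψ)
      (hχd.comp continuous_fst)).add (Integrable.mul_continuous_spaceTime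
      (hu.integrable_momentumRhs_uncurry i hψ) (hχ.continuous.comp continuous_fst))

/-- The weakly continuous representation of `u`, at almost every time and for all test functions
simultaneously. -/
lemma ae_integral_mul_eq (hT₀ : 0 < T₀) (hν : 0 ≤ ν) (hu : IsLeraySolution T₀ ν u₀ f u p Du) :
    ∀ᵐ t ∂volume.restrict (Ioo 0 T₀), ∀ (i : Fin d) (ψ : E d → ℝ), IsSmoothPeriodic ψ →
      ∫ x, u t x i * ψ x ∂torus d =
      ∫ x, u₀ x i * ψ x ∂torus d + ∫ s in 0..t, momentumRhs ν (u s) (f s) (p s) i ψ := by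
  obtain ⟨D, hD, hdense⟩ := exists_countable_dense_tests d
  have hall : ∀ᵐ t ∂volume.restrict (Ioo 0 T₀), ∀ (i : Fin d) (n : ℕ),
      ∫ x, u t x i * D n x ∂torus d =
      ∫ x, u₀ x i * D n x ∂torus d + ∫ s in 0..t, momentumRhs ν (u s) (f s) (p s) i (D n) :=
    ae_all_iff.2 fun i => ae_all_iff.2 fun n => hu.ae_integral_mul_eq_of_test hT₀ i (hD n)
  filter_upwards [hall, hu.ae_isSlice, ae_restrict_mem measurableSet_Ioo] with t h1 h2 htm i ψ hψ
  set k : ℝ → ℝ := fun s =>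
    ∫ y, (∑ j, |u s y i * u s y j| + |p s y| + ν * |u s y i| + |f s y i|) ∂torus d with hk
  have hki : Integrable k (volume.restrict (Ioo 0 T₀)) :=
    Integrable.integral_prod_left (f := fun z : ℝ × E d =>
      ∑ j, |u z.1 z.2 i * u z.1 z.2 j| + |p z.1 z.2| + ν * |u z.1 z.2 i| + |f z.1 z.2 i|)
      ((((integrable_finsetSum _ fun j _ =>
      (integrable_apply_mul hu.u_memLp hu.u_memLp i j).abs).add
      hu.p_integrable.abs).add ((integrable_apply hu.u_memLp i).abs.const_mul ν)).add
      (integrable_apply hu.f_memLp i).abs)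
  have hsub : Ioc 0 t ⊆ Ioo 0 T₀ := fun s hs => ⟨hs.1, hs.2.trans_lt htm.2⟩
  have hrestr : ∀ {g : ℝ → ℝ}, Integrable g (volume.restrict (Ioo 0 T₀)) →
      IntervalIntegrable g volume 0 t := fun hg => by
    rw [intervalIntegrable_iff_integrableOn_Ioc_of_le htm.1.le]
    exact IntegrableOn.mono_set hg hsub
  -- This constant bounds the error of replacing `ψ` by a member of the dense family, per unit of
  -- `C²` distance. It is the sum of the errors at time `t`, at the initial time and in the time
  -- integral.
  set A : ℝ := ∫ y, |u t y i| ∂torus d + ∫ y, |u₀ y i| ∂torus d + ∫ s in 0..t, k s with hA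
  have hclose : ∀ (v : E d → ℝ), Integrable v (torus d) → ∀ ε n, (∀ x, |D n x - ψ x| ≤ ε) →
      |∫ x, v x * D n x ∂torus d - ∫ x, v x * ψ x ∂torus d| ≤ ε * ∫ y, |v y| ∂torus d := by
    intro v hv ε n hn
    rw [← integral_sub ((hD n).integrable_mul hv) (hψ.integrable_mul hv), ← integral_const_mul]
    rw [← Real.norm_eq_abs]
    refine norm_integral_le_of_norm_le (hv.abs.const_mul ε)
      (Filter.Eventually.of_forall fun y => ?_)
    rw [← mul_sub, Real.norm_eq_abs, abs_mul, mul_comm]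
    exact mul_le_mul_of_nonneg_right (hn y) (abs_nonneg _)
  have hmain : ∀ ε > 0, |∫ x, u t x i * ψ x ∂torus d - (∫ x, u₀ x i * ψ x ∂torus d
      + ∫ s in 0..t, momentumRhs ν (u s) (f s) (p s) i ψ)| ≤ ε * A := by
    intro ε hε
    obtain ⟨n, hn⟩ := hdense ψ hψ ε hε
    have b1 := hclose _ (integrable_apply h2.v_memLp i) ε n fun x => (hn x).1
    have b2 := hclose _ (integrable_apply hu.u₀_memLp i) ε n fun x => (hn x).1
    have b3 : |(∫ s in 0..t, momentumRhs ν (u s) (f s) (p s) i (D n))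
        - ∫ s in 0..t, momentumRhs ν (u s) (f s) (p s) i ψ| ≤ ε * ∫ s in 0..t, k s := by
      rw [← intervalIntegral.integral_sub (hrestr (hu.integrable_momentumRhs i (hD n)))
        (hrestr (hu.integrable_momentumRhs i hψ)), ← intervalIntegral.integral_const_mul,
        ← Real.norm_eq_abs]
      refine intervalIntegral.norm_integral_le_of_norm_le htm.1.le ?_ ((hrestr hki).const_mul ε)
      have := (ae_restrict_iff' measurableSet_Ioo).1 hu.ae_isSlice
      filter_upwards [this] with s hs hst
      exact (hs (hsub hst)).abs_momentumRhs_sub_le (hD n) hψ hν i (fun x => (hn x).1)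
        (fun x => (hn x).2.1) (fun x => (hn x).2.2)
    have h3 := h1 i n
    rw [abs_le] at b1 b2 b3 ⊢
    have : ε * A = ε * ∫ y, |u t y i| ∂torus d + ε * ∫ y, |u₀ y i| ∂torus d
      + ε * ∫ s in 0..t, k s := by rw [hA]; ring
    constructor <;> linarith [b1.1, b1.2, b2.1, b2.2, b3.1, b3.2]
  have hA0 : 0 ≤ A := by simpa using (abs_nonneg _).trans (hmain 1 one_pos)
  rw [← sub_eq_zero, ← abs_nonpos_iff]
  refine le_of_forall_pos_le_add fun ε hε => ?_
  -- Division by `A + 1` instead of `A` covers the case `A = 0`.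
  have := hmain (ε / (A + 1)) (by positivity)
  refine this.trans ?_
  rw [zero_add, div_mul_eq_mul_div, div_le_iff₀ (by positivity)]
  nlinarith

end IsLeraySolution

/-! ### The resolved energy balance at a fixed time -/

section Calculus

variable {g h : E d → ℝ} {x : E d}

lemma pd_add (hg : DifferentiableAt ℝ g x) (hh : DifferentiableAt ℝ h x) (i : Fin d) :
    pd i (fun y => g y + h y) x = pd i g x + pd i h x := by
  simp [pd, fderiv_fun_add hg hh]

lemma pd_sub (hg : DifferentiableAt ℝ g x) (hh : DifferentiableAt ℝ h x) (i : Fin d) :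
    pd i (fun y => g y - h y) x = pd i g x - pd i h x := by
  simp [pd, fderiv_fun_sub hg hh]

lemma pd_mul (hg : DifferentiableAt ℝ g x) (hh : DifferentiableAt ℝ h x) (i : Fin d) :
    pd i (fun y => g y * h y) x = pd i g x * h x + g x * pd i h x := by
  simp [pd, fderiv_fun_mul hg hh]; ring

lemma pd_sum {ι : Type*} {s : Finset ι} {g : ι → E d → ℝ}
    (hg : ∀ k ∈ s, DifferentiableAt ℝ (g k) x) (i : Fin d) :
    pd i (fun y => ∑ k ∈ s, g k y) x = ∑ k ∈ s, pd i (g k) x := by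
  simp [pd, fderiv_fun_sum hg]

/-- The resolved energy balance, as an identity for smooth fields. -/
lemma divergence_current_identity {V W : Fin d → E d → ℝ} {R : Fin d → Fin d → E d → ℝ}
    {P : E d → ℝ} (ν : ℝ) (hV : ∀ i, ContDiff ℝ ∞ (V i)) (hR : ∀ i j, ContDiff ℝ ∞ (R i j))
    (hP : ContDiff ℝ ∞ P) (x : E d) (hdiv : ∑ i, pd i (V i) x = 0) :
    ∑ i, V i x * (-∑ j, pd j (R i j) x - pd i P x + ν * lap (V i) x + W i x)
      + ∑ i, pd i (fun y => (1 / 2 * ∑ k, V k y * V k y + P y) * V i y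
          + ∑ j, V j y * (R j i y - V j y * V i y)
          - ν * pd i (fun z => 1 / 2 * ∑ k, V k z * V k z) y) x
      = ∑ i, ∑ j, pd j (V i) x * (R i j x - V i x * V j x)
        - ν * ∑ i, ∑ j, pd j (V i) x ^ 2 + ∑ i, V i x * W i x := by
  have dV : ∀ i y, DifferentiableAt ℝ (V i) y := fun i y => (hV i).differentiable (by simp) y
  have dR : ∀ i j y, DifferentiableAt ℝ (R i j) y :=
    fun i j y => (hR i j).differentiable (by simp) y
  have dP : ∀ y, DifferentiableAt ℝ P y := fun y => hP.differentiable (by simp) y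
  have dVV : ∀ i j y, DifferentiableAt ℝ (fun y => V i y * V j y) y :=
    fun i j y => (dV i y).mul (dV j y)
  have dpV : ∀ i j y, DifferentiableAt ℝ (pd j (V i)) y :=
    fun i j y => (contDiff_pd (hV i) j).differentiable (by simp) y
  have hS : ContDiff ℝ ∞ fun y => ∑ k, V k y * V k y :=
    ContDiff.sum fun k _ => (hV k).mul (hV k)
  have dS : ∀ y, DifferentiableAt ℝ (fun y => ∑ k, V k y * V k y) y :=
    fun y => hS.differentiable (by simp) y
  have hen : ∀ i y, pd i (fun z => 1 / 2 * ∑ k, V k z * V k z) y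
      = ∑ k, V k y * pd i (V k) y := fun i y => by
    rw [pd_const_mul _ hS, pd_sum fun k _ => dVV k k y, Finset.mul_sum]
    refine Finset.sum_congr rfl fun k _ => ?_
    rw [pd_mul (dV k y) (dV k y)]; ring
  set S := ∑ k, V k x * V k x with hSx
  -- The product rule, with the cubic terms already cancelled: the transport of `½|V|²` is offset by
  -- differentiating `V_j V_i` in the stress term. What remains of the divergence carries the factor
  -- `P - S/2` and disappears on summing over `i`.
  have hpd : ∀ i, pd i (fun y => (1 / 2 * ∑ k, V k y * V k y + P y) * V i y
          + ∑ j, V j y * (R j i y - V j y * V i y)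
          - ν * pd i (fun z => 1 / 2 * ∑ k, V k z * V k z) y) x
      = ∑ j, pd i (V j) x * (R j i x - V j x * V i x) + ∑ j, V j x * pd i (R j i) x
        + V i x * pd i P x - ν * ∑ j, pd i (V j) x ^ 2
        - ν * ∑ j, V j x * pd i (pd i (V j)) x + (P x - 1 / 2 * S) * pd i (V i) x := by
    intro i
    simp_rw [hen]
    have hsum : ContDiff ℝ ∞ fun y => ∑ k, V k y * pd i (V k) y :=
      ContDiff.sum fun k _ => (hV k).mul (contDiff_pd (hV k) i)
    have d1 : DifferentiableAt ℝ (fun y => (1 / 2 * ∑ k, V k y * V k y + P y) * V i y) x :=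
      (((dS x).const_mul _).add (dP x)).mul (dV i x)
    have d0 : DifferentiableAt ℝ (fun y => 1 / 2 * ∑ k, V k y * V k y) x := (dS x).const_mul _
    have d0' : DifferentiableAt ℝ (fun y => 1 / 2 * ∑ k, V k y * V k y + P y) x := d0.add (dP x)
    have d2 : ∀ j, DifferentiableAt ℝ (fun y => V j y * (R j i y - V j y * V i y)) x := fun j =>
      (dV j x).mul ((dR j i x).sub ((dV j x).mul (dV i x)))
    have d2' : DifferentiableAt ℝ (fun y => ∑ j, V j y * (R j i y - V j y * V i y)) x :=
      DifferentiableAt.fun_sum fun j _ => d2 j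
    have d3 : DifferentiableAt ℝ (fun y => (1 / 2 * ∑ k, V k y * V k y + P y) * V i y
        + ∑ j, V j y * (R j i y - V j y * V i y)) x := d1.add d2'
    have d4 : DifferentiableAt ℝ (fun y => ν * ∑ k, V k y * pd i (V k) y) x :=
      (hsum.differentiable (by simp) x).const_mul ν
    have d5 : ∀ j, DifferentiableAt ℝ (fun y => V j y * pd i (V j) y) x := fun j =>
      (dV j x).mul (dpV j i x)
    have d6 : ∀ j, DifferentiableAt ℝ (fun y => R j i y - V j y * V i y) x := fun j =>
      (dR j i x).sub (dVV j i x)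
    rw [pd_sub d3 d4, pd_add d1 d2', pd_mul d0' (dV i x), pd_add d0 (dP x),
      hen, pd_sum (fun j _ => d2 j), pd_const_mul ν hsum, pd_sum (fun j _ => d5 j)]
    have t1 : ∀ j, pd i (fun y => V j y * (R j i y - V j y * V i y)) x
        = pd i (V j) x * (R j i x - V j x * V i x) + V j x * pd i (R j i) x
          - V j x * pd i (V j) x * V i x - V j x * V j x * pd i (V i) x := fun j => by
      rw [pd_mul (dV j x) (d6 j), pd_sub (dR j i x) (dVV j i x), pd_mul (dV j x) (dV i x)]
      ring
    have t2 : ∀ j, pd i (fun y => V j y * pd i (V j) y) x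
        = pd i (V j) x ^ 2 + V j x * pd i (pd i (V j)) x := fun j => by
      rw [pd_mul (dV j x) (dpV j i x)]; ring
    simp only [t1, t2, Finset.sum_add_distrib, Finset.sum_sub_distrib, ← Finset.sum_mul]
    rw [← hSx]
    ring
  simp_rw [hpd]
  simp only [Finset.sum_add_distrib, Finset.sum_sub_distrib, mul_add, mul_sub, mul_neg,
    Finset.sum_neg_distrib, ← Finset.mul_sum, lap, hdiv]
  -- The current and the equation produce the same double sums with the roles of the two indices
  -- exchanged. Only dummy indices are renamed here; symmetry of `R` plays no role.
  have c1 : ∑ i, ∑ j, pd i (V j) x * (R j i x) = ∑ i, ∑ j, pd j (V i) x * R i j x :=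
    Finset.sum_comm
  have c2 : ∑ i, ∑ j, pd i (V j) x * (V j x * V i x) = ∑ i, ∑ j, pd j (V i) x * (V i x * V j x) :=
    Finset.sum_comm
  have c3 : ∑ i, ∑ j, V j x * pd i (R j i) x = ∑ i, V i x * ∑ j, pd j (R i j) x := by
    rw [Finset.sum_comm]; simp_rw [Finset.mul_sum]
  have c4 : ∑ i, ∑ j, pd i (V j) x ^ 2 = ∑ i, ∑ j, pd j (V i) x ^ 2 := Finset.sum_comm
  have c5 : ∑ i, V i x * (ν * ∑ j, pd j (pd j (V i)) x)
      = ν * ∑ i, ∑ j, V j x * pd i (pd i (V j)) x := by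
    rw [Finset.sum_comm, Finset.mul_sum]
    refine Finset.sum_congr rfl fun i _ => ?_
    rw [← Finset.mul_sum]; ring
  rw [c1, c2, c3, c4, c5]
  ring

end Calculus

namespace IsSlice

variable {v w : E d → E d} {q : E d → ℝ} {ν ℓ : ℝ} {G : E d → ℝ}

lemma periodic_apply {v : E d → E d} (h : IsPeriodic v) (i : Fin d) :
    IsPeriodic fun y => v y i := fun k y => by simp only [h k y]

lemma cg_apply_eq {v : E d → E d} (hp : IsPeriodic v) (hv : MemLp v 2 (torus d))
    (hG : IsMollifier G) (hℓ : 0 < ℓ) (x : E d) (i : Fin d) :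
    cg G ℓ v x i = smoothing (cgKernel G ℓ) (fun y => v y i) x := by
  rw [cg_apply hG hℓ hp (hv.integrable one_le_two),
    cg_eq_smoothing hG hℓ (periodic_apply hp i) (integrable_apply hv i)]

lemma cg_mul_eq {v w : E d → E d} (hp : IsPeriodic v) (hv : MemLp v 2 (torus d))
    (hp' : IsPeriodic w) (hw : MemLp w 2 (torus d))
    (hG : IsMollifier G) (hℓ : 0 < ℓ) (i j : Fin d) :
    cg G ℓ (fun y => v y i * w y j) = smoothing (cgKernel G ℓ) (fun y => v y i * w y j) :=
  cg_eq_smoothing hG hℓ (fun k y => by simp only [hp k y, hp' k y]) (integrable_apply_mul hv hw i j)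

lemma cgGrad_eq {v : E d → E d} (hp : IsPeriodic v) (hv : MemLp v 2 (torus d))
    (hG : IsMollifier G) (hℓ : 0 < ℓ) (x : E d) (i j : Fin d) :
    cgGrad G ℓ v x i j = pd j (smoothing (cgKernel G ℓ) (fun y => v y i)) x := by
  unfold cgGrad
  congr 1
  ext y
  exact cg_apply_eq hp hv hG hℓ y i

lemma cumulant_eq {v w : E d → E d} (hp : IsPeriodic v) (hv : MemLp v 2 (torus d))
    (hp' : IsPeriodic w) (hw : MemLp w 2 (torus d))
    (hG : IsMollifier G) (hℓ : 0 < ℓ) (x : E d) (i j : Fin d) :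
    cumulant G ℓ v w x i j = smoothing (cgKernel G ℓ) (fun y => v y i * w y j) x
      - smoothing (cgKernel G ℓ) (fun y => v y i) x
        * smoothing (cgKernel G ℓ) (fun y => w y j) x := by
  rw [cumulant, cg_mul_eq hp hv hp' hw hG hℓ, cg_apply_eq hp hv hG hℓ, cg_apply_eq hp' hw hG hℓ]

lemma smooth_v (h : IsSlice v w q) (hG : IsMollifier G) (hℓ : 0 < ℓ) (i : Fin d) :
    IsSmoothPeriodic (smoothing (cgKernel G ℓ) fun y => v y i) :=
  (hG.cgKernel hℓ).smoothing (integrable_apply h.v_memLp i)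

lemma smooth_mul (h : IsSlice v w q) (hG : IsMollifier G) (hℓ : 0 < ℓ) (i j : Fin d) :
    IsSmoothPeriodic (smoothing (cgKernel G ℓ) fun y => v y i * v y j) :=
  (hG.cgKernel hℓ).smoothing (integrable_apply_mul h.v_memLp h.v_memLp i j)

lemma smooth_q (h : IsSlice v w q) (hG : IsMollifier G) (hℓ : 0 < ℓ) :
    IsSmoothPeriodic (smoothing (cgKernel G ℓ) q) :=
  (hG.cgKernel hℓ).smoothing h.q_integrable

lemma norm_sq_cg {v : E d → E d} (hp : IsPeriodic v) (hv : MemLp v 2 (torus d))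
    (hG : IsMollifier G) (hℓ : 0 < ℓ) (x : E d) :
    ‖cg G ℓ v x‖ ^ 2 = ∑ i, smoothing (cgKernel G ℓ) (fun y => v y i) x
      * smoothing (cgKernel G ℓ) (fun y => v y i) x := by
  simp_rw [norm_sq_eq_sum, cg_apply_eq hp hv hG hℓ]

lemma current_apply (h : IsSlice v w q) (hG : IsMollifier G) (hℓ : 0 < ℓ) (ν : ℝ) (i : Fin d) :
    (fun x => current ν G ℓ v q x i) =
      fun x => (1 / 2 * ∑ k, smoothing (cgKernel G ℓ) (fun y => v y k) x
          * smoothing (cgKernel G ℓ) (fun y => v y k) x + smoothing (cgKernel G ℓ) q x)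
          * smoothing (cgKernel G ℓ) (fun y => v y i) x
        + ∑ j, smoothing (cgKernel G ℓ) (fun y => v y j) x
          * (smoothing (cgKernel G ℓ) (fun y => v y j * v y i) x
            - smoothing (cgKernel G ℓ) (fun y => v y j) x
              * smoothing (cgKernel G ℓ) (fun y => v y i) x)
        - ν * pd i (fun z => 1 / 2 * ∑ k, smoothing (cgKernel G ℓ) (fun y => v y k) z
          * smoothing (cgKernel G ℓ) (fun y => v y k) z) x := by
  ext x
  simp only [current, norm_sq_cg h.v_periodic h.v_memLp hG hℓ,
    cg_apply_eq h.v_periodic h.v_memLp hG hℓ,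
    cumulant_eq h.v_periodic h.v_memLp h.v_periodic h.v_memLp hG hℓ,
    cg_eq_smoothing hG hℓ h.q_periodic h.q_integrable]

lemma smooth_current_apply (h : IsSlice v w q) (hG : IsMollifier G) (hℓ : 0 < ℓ) (ν : ℝ)
    (i : Fin d) : IsSmoothPeriodic fun x => current ν G ℓ v q x i := by
  rw [h.current_apply hG hℓ]
  have hS : IsSmoothPeriodic fun x => 1 / 2 * ∑ k, smoothing (cgKernel G ℓ) (fun y => v y k) x
      * smoothing (cgKernel G ℓ) (fun y => v y k) x :=
    (IsSmoothPeriodic.sum fun k _ => (h.smooth_v hG hℓ k).mul (h.smooth_v hG hℓ k)).const_mul _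
  exact (((hS.add (h.smooth_q hG hℓ)).mul (h.smooth_v hG hℓ i)).add
    (IsSmoothPeriodic.sum fun j _ => (h.smooth_v hG hℓ j).mul
      ((h.smooth_mul hG hℓ j i).sub ((h.smooth_v hG hℓ j).mul (h.smooth_v hG hℓ i))))).sub
    ((hS.pd i).const_mul ν)

lemma contDiff_current (h : IsSlice v w q) (hG : IsMollifier G) (hℓ : 0 < ℓ) (ν : ℝ) :
    ContDiff ℝ ∞ (current ν G ℓ v q) :=
  contDiff_euclidean.2 fun i => (h.smooth_current_apply hG hℓ ν i).smooth

lemma contDiff_cg (h : IsSlice v w q) (hG : IsMollifier G) (hℓ : 0 < ℓ) :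
    ContDiff ℝ ∞ (cg G ℓ v) := by
  refine contDiff_euclidean.2 fun i => ?_
  simp_rw [cg_apply_eq h.v_periodic h.v_memLp hG hℓ]
  exact (h.smooth_v hG hℓ i).smooth

/-- Testing with `K(· - x)` yields the coarse-grained equation at `x`: derivatives of the kernel in
`y` are minus derivatives of the correlation in `x`, so first-order terms change sign and the
Laplacian does not. -/
lemma momentumRhs_comp_sub (h : IsSlice v w q) (hG : IsMollifier G) (hℓ : 0 < ℓ) (ν : ℝ)
    (i : Fin d) (x : E d) :
    momentumRhs ν v w q i (fun y => cgKernel G ℓ (y - x)) =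
      -∑ j, pd j (smoothing (cgKernel G ℓ) fun y => v y i * v y j) x
        - pd i (smoothing (cgKernel G ℓ) q) x
        + ν * lap (smoothing (cgKernel G ℓ) fun y => v y i) x
        + smoothing (cgKernel G ℓ) (fun y => w y i) x := by
  have hK := hG.cgKernel hℓ
  have hKx := hK.comp_sub x
  simp only [pd_smoothing hK (integrable_apply_mul h.v_memLp h.v_memLp _ _),
    pd_smoothing hK h.q_integrable, lap_smoothing hK (integrable_apply h.v_memLp _),
    Finset.sum_neg_distrib, neg_neg, sub_neg_eq_add]
  unfold momentumRhs smoothing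
  have i1 : ∀ j, Integrable (fun y => v y i * v y j * pd j (fun y => cgKernel G ℓ (y - x)) y)
      (torus d) := fun j =>
    (hKx.pd j).integrable_mul (integrable_apply_mul h.v_memLp h.v_memLp i j)
  have i2 := (hKx.pd i).integrable_mul h.q_integrable
  have i3 := (hKx.lap.integrable_mul (integrable_apply h.v_memLp i)).const_mul ν
  have i4 := hKx.integrable_mul (integrable_apply h.w_memLp i)
  have i1' : Integrable (fun y => ∑ j, v y i * v y j * pd j (fun y => cgKernel G ℓ (y - x)) y)
      (torus d) := integrable_finsetSum _ fun j _ => i1 j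
  rw [integral_add (by exact (i1'.add i2).add i3) i4, integral_add (by exact i1'.add i2) i3,
    integral_add i1' i2, integral_finsetSum _ fun j _ => i1 j, integral_const_mul]
  simp only [pd_comp_sub, lap_comp_sub, smul_eq_mul]

/-- The translated kernel is itself an admissible test function for the weak divergence condition.
-/
lemma sum_pd_eq_zero (h : IsSlice v w q) (hG : IsMollifier G) (hℓ : 0 < ℓ) (x : E d) :
    ∑ i, pd i (smoothing (cgKernel G ℓ) fun y => v y i) x = 0 := by
  have hK := hG.cgKernel hℓ
  have hKx := hK.comp_sub x
  have h1 := h.v_solenoidal _ hKx.smooth hKx.periodic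
  rw [integral_finsetSum _
    fun j _ => (hKx.pd j).integrable_mul (integrable_apply h.v_memLp j)] at h1
  simp only [pd_smoothing hK (integrable_apply h.v_memLp _), Finset.sum_neg_distrib, smoothing,
    smul_eq_mul, neg_eq_zero]
  simpa only [pd_comp_sub] using h1

/-- The resolved energy balance at a fixed time. -/
lemma energy_balance (h : IsSlice v w q) (hG : IsMollifier G) (hℓ : 0 < ℓ) (ν : ℝ) (x : E d) :
    ∑ i, smoothing (cgKernel G ℓ) (fun y => v y i) x
        * momentumRhs ν v w q i (fun y => cgKernel G ℓ (y - x))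
      + divergence (current ν G ℓ v q) x
      = -flux G ℓ v x - ν * sqNorm (cgGrad G ℓ v x) + inner ℝ (cg G ℓ v x) (cg G ℓ w x) := by
  simp only [h.momentumRhs_comp_sub hG hℓ, divergence, h.current_apply hG hℓ, flux, neg_neg,
    sqNorm, inner_eq_sum, cgGrad_eq h.v_periodic h.v_memLp hG hℓ,
    cg_apply_eq h.v_periodic h.v_memLp hG hℓ, cg_apply_eq h.w_periodic h.w_memLp hG hℓ,
    cumulant_eq h.v_periodic h.v_memLp h.v_periodic h.v_memLp hG hℓ]
  exact divergence_current_identity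
    (V := fun i => smoothing (cgKernel G ℓ) fun y => v y i)
    (W := fun i => smoothing (cgKernel G ℓ) fun y => w y i)
    (R := fun i j => smoothing (cgKernel G ℓ) fun y => v y i * v y j) ν
    (fun i => (h.smooth_v hG hℓ i).smooth) (fun i j => (h.smooth_mul hG hℓ i j).smooth)
    (h.smooth_q hG hℓ).smooth x (h.sum_pd_eq_zero hG hℓ x)

end IsSlice

lemma absolutelyContinuousOnInterval_sum {ι : Type*} (s : Finset ι) {g : ι → ℝ → ℝ} {a b : ℝ}
    (hg : ∀ i ∈ s, AbsolutelyContinuousOnInterval (g i) a b) :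
    AbsolutelyContinuousOnInterval (fun t => ∑ i ∈ s, g i t) a b := by
  classical
  induction s using Finset.induction_on with
  | empty =>
    simp only [Finset.sum_empty]
    exact (LipschitzWith.const (0 : ℝ)).lipschitzOnWith.absolutelyContinuousOnInterval
  | insert i s hi ih =>
    simp only [Finset.sum_insert hi]
    exact (hg i (Finset.mem_insert_self _ _)).fun_add
      (ih fun j hj => hg j (Finset.mem_insert_of_mem hj))

/-! ### The resolved energy as an absolutely continuous function of time -/

/-- A time at which the weakly continuous representative of a Leray solution takes the value
of the solution. -/
structure IsGoodTime (ν : ℝ) (u₀ : E d → E d) (f u : ℝ → E d → E d) (p : ℝ → E d → ℝ) (t : ℝ) :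
    Prop where
  slice : IsSlice (u t) (f t) (p t)
  integral_eq : ∀ (i : Fin d) (ψ : E d → ℝ), IsSmoothPeriodic ψ →
      ∫ x, u t x i * ψ x ∂torus d =
      ∫ x, u₀ x i * ψ x ∂torus d + ∫ s in 0..t, momentumRhs ν (u s) (f s) (p s) i ψ

/-- The absolutely continuous representative of the resolved energy at a point. -/
noncomputable def resolvedEnergy (ν : ℝ) (u₀ : E d → E d) (f u : ℝ → E d → E d) (p : ℝ → E d → ℝ)
    (K : E d → ℝ) (x : E d) (t : ℝ) : ℝ :=
  1 / 2 * ∑ i, (smoothing K (fun y => u₀ y i) x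
    + ∫ s in 0..t, momentumRhs ν (u s) (f s) (p s) i (fun y => K (y - x)))
    * (smoothing K (fun y => u₀ y i) x
    + ∫ s in 0..t, momentumRhs ν (u s) (f s) (p s) i (fun y => K (y - x)))

namespace IsGoodTime

variable {ν t : ℝ} {u₀ : E d → E d} {f u : ℝ → E d → E d} {p : ℝ → E d → ℝ} {K : E d → ℝ}

lemma smoothing_eq (h : IsGoodTime ν u₀ f u p t) (hK : IsSmoothPeriodic K) (i : Fin d) (x : E d) :
    smoothing K (fun y => u t y i) x = smoothing K (fun y => u₀ y i) x
      + ∫ s in 0..t, momentumRhs ν (u s) (f s) (p s) i (fun y => K (y - x)) :=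
  h.integral_eq i _ (hK.comp_sub x)

lemma resolvedEnergy_eq (h : IsGoodTime ν u₀ f u p t) {G : E d → ℝ} {ℓ : ℝ} (hG : IsMollifier G)
    (hℓ : 0 < ℓ) (x : E d) :
    resolvedEnergy ν u₀ f u p (cgKernel G ℓ) x t = 1 / 2 * ‖cg G ℓ (u t) x‖ ^ 2 := by
  rw [IsSlice.norm_sq_cg h.slice.v_periodic h.slice.v_memLp hG hℓ, resolvedEnergy]
  simp only [h.smoothing_eq (hG.cgKernel hℓ)]

end IsGoodTime

namespace IsLeraySolution

variable {T₀ ν : ℝ} {u₀ : E d → E d} {f u : ℝ → E d → E d} {p : ℝ → E d → ℝ}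
  {Du : ℝ → E d → Fin d → Fin d → ℝ} {K : E d → ℝ}

lemma ae_isGoodTime (hT₀ : 0 < T₀) (hν : 0 ≤ ν) (hu : IsLeraySolution T₀ ν u₀ f u p Du) :
    ∀ᵐ t ∂volume.restrict (Ioo 0 T₀), IsGoodTime ν u₀ f u p t := by
  filter_upwards [hu.ae_isSlice, hu.ae_integral_mul_eq hT₀ hν] with t h1 h2
  exact ⟨h1, h2⟩

lemma intervalIntegrable_momentumRhs (hT₀ : 0 < T₀) (hu : IsLeraySolution T₀ ν u₀ f u p Du)
    (i : Fin d) {ψ : E d → ℝ} (hψ : IsSmoothPeriodic ψ) :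
    IntervalIntegrable (fun t => momentumRhs ν (u t) (f t) (p t) i ψ) volume 0 T₀ := by
  rw [intervalIntegrable_iff_integrableOn_Ioo_of_le hT₀.le]
  exact hu.integrable_momentumRhs i hψ

lemma absolutelyContinuous_resolvedEnergy (hT₀ : 0 < T₀) (hu : IsLeraySolution T₀ ν u₀ f u p Du)
    (hK : IsSmoothPeriodic K) (x : E d) :
    AbsolutelyContinuousOnInterval (resolvedEnergy ν u₀ f u p K x) 0 T₀ := by
  refine AbsolutelyContinuousOnInterval.const_mul _
    (absolutelyContinuousOnInterval_sum _ fun i _ => ?_)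
  have h1 := (hu.intervalIntegrable_momentumRhs hT₀ i
    (hK.comp_sub x)).absolutelyContinuousOnInterval_intervalIntegral left_mem_uIcc
  have h2 : AbsolutelyContinuousOnInterval (fun _ : ℝ => smoothing K (fun y => u₀ y i) x) 0 T₀ :=
    (LipschitzWith.const _).lipschitzOnWith.absolutelyContinuousOnInterval
  exact (h2.fun_add h1).fun_mul (h2.fun_add h1)

/-- Lebesgue differentiation of each momentum integral and the product rule. At good times the
representative in the product is the actual coarse-grained velocity. -/
lemma ae_hasDerivAt_resolvedEnergy (hT₀ : 0 < T₀) (hν : 0 ≤ ν)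
    (hu : IsLeraySolution T₀ ν u₀ f u p Du) (hK : IsSmoothPeriodic K) (x : E d) :
    ∀ᵐ t ∂volume.restrict (Ioo 0 T₀), HasDerivAt (resolvedEnergy ν u₀ f u p K x)
      (∑ i, smoothing K (fun y => u t y i) x
        * momentumRhs ν (u t) (f t) (p t) i (fun y => K (y - x))) t := by
  have h1 : ∀ᵐ t ∂volume.restrict (Ioo 0 T₀), ∀ i : Fin d,
      HasDerivAt (fun t => ∫ s in 0..t, momentumRhs ν (u s) (f s) (p s) i (fun y => K (y - x)))
        (momentumRhs ν (u t) (f t) (p t) i (fun y => K (y - x))) t := by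
    refine ae_all_iff.2 fun i => ?_
    rw [ae_restrict_iff' measurableSet_Ioo]
    filter_upwards [(hu.intervalIntegrable_momentumRhs hT₀ i
      (hK.comp_sub x)).ae_hasDerivAt_integral] with t ht hmem
    refine ht ?_ 0 left_mem_uIcc
    rw [uIcc_of_le hT₀.le]
    exact Ioo_subset_Icc_self hmem
  filter_upwards [h1, hu.ae_isGoodTime hT₀ hν] with t h2 h3
  have h4 := (HasDerivAt.fun_sum (u := Finset.univ) fun i _ =>
    ((h2 i).const_add (smoothing K (fun y => u₀ y i) x)).mul
      ((h2 i).const_add (smoothing K (fun y => u₀ y i) x))).const_mul (1 / 2 : ℝ)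
  refine h4.congr_deriv ?_
  rw [Finset.mul_sum]
  refine Finset.sum_congr rfl fun i _ => ?_
  rw [h3.smoothing_eq hK]
  ring

/-- The resolved energy balance of a Leray solution. -/
theorem resolved_energy_balance (hT₀ : 0 < T₀) (hν : 0 < ν)
    (hu : IsLeraySolution T₀ ν u₀ f u p Du) {G : E d → ℝ} (hG : IsMollifier G) {ℓ : ℝ}
    (hℓ : 0 < ℓ) (x : E d) : ∃ e : ℝ → ℝ,
        AbsolutelyContinuousOnInterval e 0 T₀ ∧
        e 0 = 1 / 2 * ‖cg G ℓ u₀ x‖ ^ 2 ∧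
        ∀ᵐ t ∂volume.restrict (Ioo 0 T₀),
          e t = 1 / 2 * ‖cg G ℓ (u t) x‖ ^ 2 ∧
          ∃ e' : ℝ, HasDerivAt e e' t ∧
            e' + divergence (current ν G ℓ (u t) (p t)) x
              = -flux G ℓ (u t) x
                - ν * sqNorm (cgGrad G ℓ (u t) x)
                + inner ℝ (cg G ℓ (u t) x) (cg G ℓ (f t) x) := by
  refine ⟨resolvedEnergy ν u₀ f u p (cgKernel G ℓ) x,
    hu.absolutelyContinuous_resolvedEnergy hT₀ (hG.cgKernel hℓ) x, ?_, ?_⟩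
  · simp [resolvedEnergy, IsSlice.norm_sq_cg hu.u₀_periodic hu.u₀_memLp hG hℓ]
  · filter_upwards [hu.ae_isGoodTime hT₀ hν.le,
      hu.ae_hasDerivAt_resolvedEnergy hT₀ hν.le (hG.cgKernel hℓ) x] with t h1 h2
    exact ⟨h1.resolvedEnergy_eq hG hℓ x, _, h2, h1.slice.energy_balance hG hℓ ν x⟩

end IsLeraySolution

/-! ### Space-time integrability and the integrated resolved balance -/

section Joint

variable {Ψ : E d → ℝ} {α : Type*} [MeasurableSpace α] {μ : Measure α}
  {w : α → E d → ℝ}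

lemma ae_prod_of_ae_fst {β : Type*} [MeasurableSpace β] {ν : Measure β} {P : α → Prop}
    (h : ∀ᵐ t ∂μ, P t) : ∀ᵐ z ∂μ.prod ν, P z.1 :=
  Measure.quasiMeasurePreserving_fst.ae h

lemma integrable_smoothing_uncurry [SFinite μ] (hΨ : IsSmoothPeriodic Ψ)
    (hw : Integrable (Function.uncurry w) (μ.prod (torus d))) :
    Integrable (fun z : α × E d => smoothing Ψ (w z.1) z.2) (μ.prod (torus d)) := by
  obtain ⟨C, -, hC⟩ := hΨ.exists_bound
  have h1 : Integrable (fun t => C * ∫ y, |w t y| ∂torus d) μ :=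
    hw.abs.integral_prod_left.const_mul C
  refine Integrable.mono' (h1.comp_fst (torus d))
    (aestronglyMeasurable_smoothing hΨ.continuous hw.aestronglyMeasurable) ?_
  filter_upwards [ae_prod_of_ae_fst hw.prod_right_ae] with z hz
  exact abs_smoothing_le hC hz z.2

/-- An `L¹` bound uniform in the parameter becomes a uniform pointwise bound after smoothing. For
the velocity this converts the `L^∞L²` hypothesis into boundedness of the coarse-grained field and
its derivatives. -/
lemma exists_bound_smoothing_uncurry [SFinite μ] (hΨ : IsSmoothPeriodic Ψ)
    (hw : Integrable (Function.uncurry w) (μ.prod (torus d)))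
    (hb : ∃ B : ℝ, ∀ᵐ t ∂μ, ∫ y, |w t y| ∂torus d ≤ B) :
    ∃ B : ℝ, ∀ᵐ z ∂μ.prod (torus d), ‖smoothing Ψ (w z.1) z.2‖ ≤ B := by
  obtain ⟨C, hC0, hC⟩ := hΨ.exists_bound
  obtain ⟨B, hB⟩ := hb
  refine ⟨C * B, ?_⟩
  filter_upwards [ae_prod_of_ae_fst hw.prod_right_ae, ae_prod_of_ae_fst hB] with z h1 h2
  exact (abs_smoothing_le hC h1 z.2).trans (mul_le_mul_of_nonneg_left h2 hC0)

end Joint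

lemma abs_apply_le_one_add (a : E d) (i : Fin d) : |a i| ≤ 1 + ‖a‖ ^ 2 := by
  have h : |a i| ≤ ‖a‖ := PiLp.norm_apply_le a i
  nlinarith [sq_nonneg (‖a‖ - 1)]

namespace IsSlice

variable {v w : E d → E d} {q : E d → ℝ} {ν ℓ : ℝ} {G : E d → ℝ}

lemma cgGrad_eq_smoothing {v : E d → E d} (hp : IsPeriodic v) (hv : MemLp v 2 (torus d))
    (hG : IsMollifier G) (hℓ : 0 < ℓ) (x : E d) (i j : Fin d) :
    cgGrad G ℓ v x i j = -smoothing (pd j (cgKernel G ℓ)) (fun y => v y i) x := by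
  rw [cgGrad_eq hp hv hG hℓ, pd_smoothing (hG.cgKernel hℓ) (integrable_apply hv i)]

lemma momentumRhs_eq_smoothing (h : IsSlice v w q) (hG : IsMollifier G) (hℓ : 0 < ℓ) (ν : ℝ)
    (i : Fin d) (x : E d) :
    momentumRhs ν v w q i (fun y => cgKernel G ℓ (y - x)) =
      ∑ j, smoothing (pd j (cgKernel G ℓ)) (fun y => v y i * v y j) x
        + smoothing (pd i (cgKernel G ℓ)) q x
        + ν * smoothing (lap (cgKernel G ℓ)) (fun y => v y i) x
        + smoothing (cgKernel G ℓ) (fun y => w y i) x := by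
  have hK := hG.cgKernel hℓ
  rw [h.momentumRhs_comp_sub hG hℓ, pd_smoothing hK h.q_integrable,
    lap_smoothing hK (integrable_apply h.v_memLp i)]
  simp only [pd_smoothing hK (integrable_apply_mul h.v_memLp h.v_memLp i _),
    Finset.sum_neg_distrib, neg_neg, sub_neg_eq_add]

lemma smooth_flux (h : IsSlice v w q) (hG : IsMollifier G) (hℓ : 0 < ℓ) :
    IsSmoothPeriodic (flux G ℓ v) := by
  unfold flux
  simp only [cgGrad_eq h.v_periodic h.v_memLp hG hℓ,
    cumulant_eq h.v_periodic h.v_memLp h.v_periodic h.v_memLp hG hℓ]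
  exact (IsSmoothPeriodic.sum fun i _ => IsSmoothPeriodic.sum fun j _ =>
    ((h.smooth_v hG hℓ i).pd j).mul ((h.smooth_mul hG hℓ i j).sub
      ((h.smooth_v hG hℓ i).mul (h.smooth_v hG hℓ j)))).neg

lemma smooth_sqNorm_cgGrad (h : IsSlice v w q) (hG : IsMollifier G) (hℓ : 0 < ℓ) :
    IsSmoothPeriodic fun x => sqNorm (cgGrad G ℓ v x) := by
  simp only [sqNorm, cgGrad_eq h.v_periodic h.v_memLp hG hℓ, sq]
  exact IsSmoothPeriodic.sum fun i _ => IsSmoothPeriodic.sum fun j _ =>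
    ((h.smooth_v hG hℓ i).pd j).mul ((h.smooth_v hG hℓ i).pd j)

lemma smooth_inner_cg {v w : E d → E d} (hp : IsPeriodic v) (hv : MemLp v 2 (torus d))
    (hp' : IsPeriodic w) (hw : MemLp w 2 (torus d)) (hG : IsMollifier G) (hℓ : 0 < ℓ) :
    IsSmoothPeriodic fun x => inner ℝ (cg G ℓ v x) (cg G ℓ w x) := by
  simp only [inner_eq_sum, cg_apply_eq hp hv hG hℓ, cg_apply_eq hp' hw hG hℓ]
  exact IsSmoothPeriodic.sum fun i _ =>
    ((hG.cgKernel hℓ).smoothing (integrable_apply hv i)).mul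
      ((hG.cgKernel hℓ).smoothing (integrable_apply hw i))

/-- The current is smooth and periodic, so its divergence integrates to zero. -/
lemma integral_energy_balance (h : IsSlice v w q) (hG : IsMollifier G) (hℓ : 0 < ℓ) (ν : ℝ) :
    ∫ x, ∑ i, smoothing (cgKernel G ℓ) (fun y => v y i) x
        * momentumRhs ν v w q i (fun y => cgKernel G ℓ (y - x)) ∂torus d
      = ∫ x, (-flux G ℓ v x - ν * sqNorm (cgGrad G ℓ v x)
        + inner ℝ (cg G ℓ v x) (cg G ℓ w x)) ∂torus d := by
  have hdiv : IsSmoothPeriodic (divergence (current ν G ℓ v q)) :=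
    IsSmoothPeriodic.sum fun i _ => (h.smooth_current_apply hG hℓ ν i).pd i
  have hR : Integrable (fun x => -flux G ℓ v x - ν * sqNorm (cgGrad G ℓ v x)
        + inner ℝ (cg G ℓ v x) (cg G ℓ w x)) (torus d) :=
    (((h.smooth_flux hG hℓ).neg.sub ((h.smooth_sqNorm_cgGrad hG hℓ).const_mul ν)).add
      (smooth_inner_cg h.v_periodic h.v_memLp h.w_periodic h.w_memLp hG hℓ)).integrable
  have h0 : ∫ x, divergence (current ν G ℓ v q) x ∂torus d = 0 := by
    unfold divergence
    rw [integral_finsetSum _ fun i _ => ((h.smooth_current_apply hG hℓ ν i).pd i).integrable]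
    exact Finset.sum_eq_zero fun i _ => (h.smooth_current_apply hG hℓ ν i).integral_pd i
  simp_rw [fun x => eq_sub_of_add_eq (h.energy_balance hG hℓ ν x)]
  rw [integral_sub hR hdiv.integrable, h0, sub_zero]

end IsSlice

section CumulantTrace

variable {v w : E d → E d} {ℓ : ℝ} {G : E d → ℝ}

lemma cumulantTrace_eq (hp : IsPeriodic v) (hv : MemLp v 2 (torus d))
    (hp' : IsPeriodic w) (hw : MemLp w 2 (torus d)) (hG : IsMollifier G) (hℓ : 0 < ℓ) (x : E d) :
    cumulantTrace G ℓ v w x = ∑ i, smoothing (cgKernel G ℓ) (fun y => v y i * w y i) x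
      - inner ℝ (cg G ℓ v x) (cg G ℓ w x) := by
  simp only [cumulantTrace, inner_eq_sum, IsSlice.cumulant_eq hp hv hp' hw hG hℓ,
    IsSlice.cg_apply_eq hp hv hG hℓ, IsSlice.cg_apply_eq hp' hw hG hℓ, Finset.sum_sub_distrib]

lemma integrable_cumulantTrace (hp : IsPeriodic v) (hv : MemLp v 2 (torus d))
    (hp' : IsPeriodic w) (hw : MemLp w 2 (torus d)) (hG : IsMollifier G) (hℓ : 0 < ℓ) :
    Integrable (cumulantTrace G ℓ v w) (torus d) := by
  simp only [funext (cumulantTrace_eq hp hv hp' hw hG hℓ)]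
  exact ((IsSmoothPeriodic.sum fun i _ =>
    (hG.cgKernel hℓ).smoothing (integrable_apply_mul hv hw i i)).sub
    (IsSlice.smooth_inner_cg hp hv hp' hw hG hℓ)).integrable

/-- The first term of the trace is the coarse-graining of `v·w`, whose mean is the mean of `v·w`
itself. -/
lemma integral_cumulantTrace (hp : IsPeriodic v) (hv : MemLp v 2 (torus d))
    (hp' : IsPeriodic w) (hw : MemLp w 2 (torus d)) (hG : IsMollifier G) (hℓ : 0 < ℓ) :
    ∫ x, cumulantTrace G ℓ v w x ∂torus d = ∫ x, inner ℝ (v x) (w x) ∂torus d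
      - ∫ x, inner ℝ (cg G ℓ v x) (cg G ℓ w x) ∂torus d := by
  have hs : ∀ i, IsSmoothPeriodic (smoothing (cgKernel G ℓ) fun y => v y i * w y i) := fun i =>
    (hG.cgKernel hℓ).smoothing (integrable_apply_mul hv hw i i)
  simp only [cumulantTrace_eq hp hv hp' hw hG hℓ]
  rw [integral_sub (IsSmoothPeriodic.sum fun i _ => hs i).integrable
    (IsSlice.smooth_inner_cg hp hv hp' hw hG hℓ).integrable,
    integral_finsetSum _ fun i _ => (hs i).integrable]
  simp only [integral_smoothing_cgKernel hG hℓ (integrable_apply_mul hv hw _ _),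
    inner_eq_sum (v _)]
  rw [integral_finsetSum _ fun i _ => integrable_apply_mul hv hw i i]

lemma integral_cumulantTrace_self (hp : IsPeriodic v) (hv : MemLp v 2 (torus d))
    (hG : IsMollifier G) (hℓ : 0 < ℓ) :
    ∫ x, cumulantTrace G ℓ v v x ∂torus d = ∫ x, ‖v x‖ ^ 2 ∂torus d
      - ∫ x, ‖cg G ℓ v x‖ ^ 2 ∂torus d := by
  simpa only [real_inner_self_eq_norm_sq] using integral_cumulantTrace hp hv hp hv hG hℓ

end CumulantTrace

namespace IsLeraySolution

variable {T₀ ν ℓ : ℝ} {u₀ : E d → E d} {f u : ℝ → E d → E d} {p : ℝ → E d → ℝ}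
  {Du : ℝ → E d → Fin d → Fin d → ℝ} {K G : E d → ℝ}

lemma exists_bound_apply (hu : IsLeraySolution T₀ ν u₀ f u p Du) (hK : IsSmoothPeriodic K)
    (i : Fin d) :
    ∃ B : ℝ, ∀ᵐ z ∂spaceTime d T₀, ‖smoothing K (fun y => u z.1 y i) z.2‖ ≤ B := by
  refine exists_bound_smoothing_uncurry (w := fun t y => u t y i) hK
    (integrable_apply hu.u_memLp i) ?_
  obtain ⟨C, -, hC⟩ := hu.exists_bound_sq
  refine ⟨∫ _, 1 ∂torus d + C, ?_⟩
  filter_upwards [hC, hu.ae_isSlice] with t h1 h2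
  have hi := integrable_norm_sq_of_memLp h2.v_memLp
  calc _ ≤ ∫ y, (1 + ‖u t y‖ ^ 2) ∂torus d :=
        integral_mono (integrable_apply h2.v_memLp i).abs ((integrable_const _).add hi)
          fun y => abs_apply_le_one_add _ i
    _ ≤ _ := by rw [integral_add (integrable_const _) hi]; gcongr

lemma integrable_smoothing_apply (hu : IsLeraySolution T₀ ν u₀ f u p Du)
    (hK : IsSmoothPeriodic K) (i : Fin d) :
    Integrable (fun z : ℝ × E d => smoothing K (fun y => u z.1 y i) z.2) (spaceTime d T₀) :=
  integrable_smoothing_uncurry (w := fun t y => u t y i) hK (integrable_apply hu.u_memLp i)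

lemma integrable_smoothing_mul (hu : IsLeraySolution T₀ ν u₀ f u p Du)
    (hK : IsSmoothPeriodic K) (i j : Fin d) :
    Integrable (fun z : ℝ × E d => smoothing K (fun y => u z.1 y i * u z.1 y j) z.2)
      (spaceTime d T₀) :=
  integrable_smoothing_uncurry (w := fun t y => u t y i * u t y j) hK
    (integrable_apply_mul hu.u_memLp hu.u_memLp i j)

lemma integrable_smoothing_force (hu : IsLeraySolution T₀ ν u₀ f u p Du)
    (hK : IsSmoothPeriodic K) (i : Fin d) :
    Integrable (fun z : ℝ × E d => smoothing K (fun y => f z.1 y i) z.2) (spaceTime d T₀) :=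
  integrable_smoothing_uncurry (w := fun t y => f t y i) hK (integrable_apply hu.f_memLp i)

/-- Bounded times integrable. Each product in the flux, the resolved dissipation and the resolved
work has a smoothed velocity component as one factor, so no higher integrability of the other factor
is required. -/
lemma integrable_mul_smoothing (hu : IsLeraySolution T₀ ν u₀ f u p Du)
    (hK : IsSmoothPeriodic K) (i : Fin d) {F : ℝ × E d → ℝ} (hF : Integrable F (spaceTime d T₀)) :
    Integrable (fun z : ℝ × E d => smoothing K (fun y => u z.1 y i) z.2 * F z)
      (spaceTime d T₀) := by
  obtain ⟨B, hB⟩ := hu.exists_bound_apply hK i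
  exact hF.bdd_mul (hu.integrable_smoothing_apply hK i).aestronglyMeasurable hB

lemma ae_spaceTime (hu : IsLeraySolution T₀ ν u₀ f u p Du) :
    ∀ᵐ z ∂spaceTime d T₀, IsSlice (u z.1) (f z.1) (p z.1) :=
  ae_prod_of_ae_fst hu.ae_isSlice

lemma integrable_flux (hu : IsLeraySolution T₀ ν u₀ f u p Du) (hG : IsMollifier G)
    (hℓ : 0 < ℓ) : Integrable (fun z : ℝ × E d => flux G ℓ (u z.1) z.2) (spaceTime d T₀) := by
  have hK := hG.cgKernel hℓ
  have h1 : Integrable (fun z : ℝ × E d => ∑ i, ∑ j,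
      smoothing (pd j (cgKernel G ℓ)) (fun y => u z.1 y i) z.2
      * (smoothing (cgKernel G ℓ) (fun y => u z.1 y i * u z.1 y j) z.2
        - smoothing (cgKernel G ℓ) (fun y => u z.1 y i) z.2
          * smoothing (cgKernel G ℓ) (fun y => u z.1 y j) z.2)) (spaceTime d T₀) :=
    integrable_finsetSum _ fun i _ => integrable_finsetSum _ fun j _ =>
      hu.integrable_mul_smoothing (hK.pd j) i ((hu.integrable_smoothing_mul hK i j).sub
        (hu.integrable_mul_smoothing hK i (hu.integrable_smoothing_apply hK j)))
  refine h1.congr ?_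
  filter_upwards [hu.ae_spaceTime] with z hz
  simp only [flux, IsSlice.cgGrad_eq_smoothing hz.v_periodic hz.v_memLp hG hℓ,
    IsSlice.cumulant_eq hz.v_periodic hz.v_memLp hz.v_periodic hz.v_memLp hG hℓ, neg_mul,
    Finset.sum_neg_distrib, neg_neg]

lemma integrable_sqNorm_cgGrad (hu : IsLeraySolution T₀ ν u₀ f u p Du) (hG : IsMollifier G)
    (hℓ : 0 < ℓ) :
    Integrable (fun z : ℝ × E d => sqNorm (cgGrad G ℓ (u z.1) z.2)) (spaceTime d T₀) := by
  have hK := hG.cgKernel hℓ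
  have h1 : Integrable (fun z : ℝ × E d => ∑ i, ∑ j,
      smoothing (pd j (cgKernel G ℓ)) (fun y => u z.1 y i) z.2
      * smoothing (pd j (cgKernel G ℓ)) (fun y => u z.1 y i) z.2) (spaceTime d T₀) :=
    integrable_finsetSum _ fun i _ => integrable_finsetSum _ fun j _ =>
      hu.integrable_mul_smoothing (hK.pd j) i (hu.integrable_smoothing_apply (hK.pd j) i)
  refine h1.congr ?_
  filter_upwards [hu.ae_spaceTime] with z hz
  simp only [sqNorm, IsSlice.cgGrad_eq_smoothing hz.v_periodic hz.v_memLp hG hℓ, sq, neg_mul_neg]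

lemma integrable_inner_cg (hu : IsLeraySolution T₀ ν u₀ f u p Du) (hG : IsMollifier G)
    (hℓ : 0 < ℓ) :
    Integrable (fun z : ℝ × E d => inner ℝ (cg G ℓ (u z.1) z.2) (cg G ℓ (f z.1) z.2))
      (spaceTime d T₀) := by
  have hK := hG.cgKernel hℓ
  have h1 : Integrable (fun z : ℝ × E d => ∑ i,
      smoothing (cgKernel G ℓ) (fun y => u z.1 y i) z.2
      * smoothing (cgKernel G ℓ) (fun y => f z.1 y i) z.2) (spaceTime d T₀) :=
    integrable_finsetSum _ fun i _ =>
      hu.integrable_mul_smoothing hK i (hu.integrable_smoothing_force hK i)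
  refine h1.congr ?_
  filter_upwards [hu.ae_spaceTime] with z hz
  simp only [inner_eq_sum, IsSlice.cg_apply_eq hz.v_periodic hz.v_memLp hG hℓ,
    IsSlice.cg_apply_eq hz.w_periodic hz.w_memLp hG hℓ]

lemma integrable_cumulantTrace (hu : IsLeraySolution T₀ ν u₀ f u p Du) (hG : IsMollifier G)
    (hℓ : 0 < ℓ) :
    Integrable (fun z : ℝ × E d => cumulantTrace G ℓ (u z.1) (f z.1) z.2) (spaceTime d T₀) := by
  have hK := hG.cgKernel hℓ
  have h1 : Integrable (fun z : ℝ × E d => ∑ i,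
      smoothing (cgKernel G ℓ) (fun y => u z.1 y i * f z.1 y i) z.2) (spaceTime d T₀) :=
    integrable_finsetSum _ fun i _ => integrable_smoothing_uncurry
      (w := fun t y => u t y i * f t y i) hK (integrable_apply_mul hu.u_memLp hu.f_memLp i i)
  refine (h1.sub (hu.integrable_inner_cg hG hℓ)).congr ?_
  filter_upwards [hu.ae_spaceTime] with z hz
  exact (cumulantTrace_eq hz.v_periodic hz.v_memLp hz.w_periodic hz.w_memLp hG hℓ z.2).symm

/-- This integrability justifies exchanging the time and space integrals of the resolved power. The
pressure is merely integrable, but it is smoothed and multiplied by a bounded field. -/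
lemma integrable_resolved_work (hu : IsLeraySolution T₀ ν u₀ f u p Du) (hG : IsMollifier G)
    (hℓ : 0 < ℓ) :
    Integrable (fun z : ℝ × E d => ∑ i, smoothing (cgKernel G ℓ) (fun y => u z.1 y i) z.2
      * momentumRhs ν (u z.1) (f z.1) (p z.1) i (fun y => cgKernel G ℓ (y - z.2)))
      (spaceTime d T₀) := by
  have hK := hG.cgKernel hℓ
  refine integrable_finsetSum _ fun i _ => hu.integrable_mul_smoothing hK i ?_
  have h1 : Integrable (fun z : ℝ × E d =>
      ∑ j, smoothing (pd j (cgKernel G ℓ)) (fun y => u z.1 y i * u z.1 y j) z.2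
        + smoothing (pd i (cgKernel G ℓ)) (p z.1) z.2
        + ν * smoothing (lap (cgKernel G ℓ)) (fun y => u z.1 y i) z.2
        + smoothing (cgKernel G ℓ) (fun y => f z.1 y i) z.2) (spaceTime d T₀) :=
    (((integrable_finsetSum _ fun j _ => hu.integrable_smoothing_mul (hK.pd j) i j).add
      (integrable_smoothing_uncurry (w := p) (hK.pd i) hu.p_integrable)).add
      ((hu.integrable_smoothing_apply hK.lap i).const_mul ν)).add
      (hu.integrable_smoothing_force hK i)
  refine h1.congr ?_
  filter_upwards [hu.ae_spaceTime] with z hz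
  exact (hz.momentumRhs_eq_smoothing hG hℓ ν i z.2).symm

/-- The resolved energy balance, integrated over the torus. -/
theorem integral_resolved_energy (hT₀ : 0 < T₀) (hν : 0 < ν)
    (hu : IsLeraySolution T₀ ν u₀ f u p Du) {T : ℝ} (hT : T ∈ Ioo 0 T₀)
    (hgood : IsGoodTime ν u₀ f u p T) (hG : IsMollifier G) (hℓ : 0 < ℓ) :
    1 / 2 * ∫ x, ‖cg G ℓ (u T) x‖ ^ 2 ∂torus d - 1 / 2 * ∫ x, ‖cg G ℓ u₀ x‖ ^ 2 ∂torus d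
      = -∫ z : ℝ × E d, flux G ℓ (u z.1) z.2 ∂spaceTime d T
        - ∫ z : ℝ × E d, ν * sqNorm (cgGrad G ℓ (u z.1) z.2) ∂spaceTime d T
        + ∫ z : ℝ × E d, inner ℝ (cg G ℓ (u z.1) z.2) (cg G ℓ (f z.1) z.2) ∂spaceTime d T := by
  have hK := hG.cgKernel hℓ
  have hmono : spaceTime d T ≤ spaceTime d T₀ := spaceTime_mono hT.2.le
  have iw := (hu.integrable_resolved_work hG hℓ).mono_measure hmono
  have i1 := (hu.integrable_flux hG hℓ).mono_measure hmono
  have i1' : Integrable (fun z : ℝ × E d => -flux G ℓ (u z.1) z.2) (spaceTime d T) := i1.neg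
  have i2 := ((hu.integrable_sqNorm_cgGrad hG hℓ).const_mul ν).mono_measure hmono
  have i3 := (hu.integrable_inner_cg hG hℓ).mono_measure hmono
  have isq : ∀ {v : E d → E d}, IsPeriodic v → MemLp v 2 (torus d) →
      Integrable (fun x => 1 / 2 * ‖cg G ℓ v x‖ ^ 2) (torus d) := fun hp hv => by
    have := ((IsSlice.smooth_inner_cg hp hv hp hv hG hℓ).const_mul (1 / 2)).integrable
    simpa only [real_inner_self_eq_norm_sq] using this
  -- The fundamental theorem of calculus for the absolutely continuous representative, pointwise in
  -- `x`; at the good time `T` its value is the resolved energy itself.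
  have hx : ∀ x, 1 / 2 * ‖cg G ℓ (u T) x‖ ^ 2 - 1 / 2 * ‖cg G ℓ u₀ x‖ ^ 2
      = ∫ t, ∑ i, smoothing (cgKernel G ℓ) (fun y => u t y i) x
        * momentumRhs ν (u t) (f t) (p t) i (fun y => cgKernel G ℓ (y - x))
        ∂volume.restrict (Ioo 0 T) := by
    intro x
    have hac := (hu.absolutelyContinuous_resolvedEnergy hT₀ hK x).mono
      (c := 0) (d := T) (by
        rw [uIcc_of_le hT.1.le, uIcc_of_le hT₀.le]; exact Icc_subset_Icc_right hT.2.le)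
    have h1 := hac.integral_deriv_eq_sub
    have h0 : resolvedEnergy ν u₀ f u p (cgKernel G ℓ) x 0 = 1 / 2 * ‖cg G ℓ u₀ x‖ ^ 2 := by
      simp [resolvedEnergy, IsSlice.norm_sq_cg hu.u₀_periodic hu.u₀_memLp hG hℓ]
    rw [hgood.resolvedEnergy_eq hG hℓ, h0] at h1
    rw [← h1, intervalIntegral.integral_of_le hT.1.le, integral_Ioc_eq_integral_Ioo]
    refine integral_congr_ae ?_
    filter_upwards [ae_restrict_Ioo_mono hT.2.le
      (hu.ae_hasDerivAt_resolvedEnergy hT₀ hν.le hK x)] with t ht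
    exact ht.deriv
  rw [← integral_const_mul, ← integral_const_mul,
    ← integral_sub (isq hgood.slice.v_periodic hgood.slice.v_memLp)
      (isq hu.u₀_periodic hu.u₀_memLp), ← integral_neg,
    ← integral_sub i1' i2, ← integral_add (by exact i1'.sub i2) i3]
  simp_rw [hx]
  -- With the space integral innermost, the balance at almost every time can be used in its
  -- integrated form, where the divergence is gone.
  rw [integral_integral_swap (by exact iw.swap), spaceTime_eq, integral_prod]
  · refine integral_congr_ae ?_
    filter_upwards [ae_restrict_Ioo_mono hT.2.le hu.ae_isSlice] with t ht
    exact ht.integral_energy_balance hG hℓ ν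
  · exact (i1'.sub i2).add i3

end IsLeraySolution

/-! ### The defect as a positive linear functional on test functions -/

section TestDerivatives

variable {φ : ℝ → E d → ℝ}

lemma deriv_time_eq (h : ContDiff ℝ ∞ (Function.uncurry φ)) (t : ℝ) (x : E d) :
    deriv (fun s => φ s x) t = fderiv ℝ (Function.uncurry φ) (t, x) (1, 0) := by
  have h1 : HasFDerivAt (Function.uncurry φ) _ (t, x) :=
    (h.differentiable (by simp) (t, x)).hasFDerivAt
  have h2 : HasDerivAt (fun s : ℝ => (s, x)) ((1 : ℝ), (0 : E d)) t :=
    (hasDerivAt_id t).prodMk (hasDerivAt_const t x)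
  exact (h1.comp_hasDerivAt t h2).deriv

lemma pd_space_eq (h : ContDiff ℝ ∞ (Function.uncurry φ)) (j : Fin d) (t : ℝ) (x : E d) :
    pd j (φ t) x
      = fderiv ℝ (Function.uncurry φ) (t, x) (0, EuclideanSpace.single j (1 : ℝ)) := by
  have h1 : HasFDerivAt (Function.uncurry φ) _ (t, x) :=
    (h.differentiable (by simp) (t, x)).hasFDerivAt
  have h2 : HasFDerivAt (fun y : E d => (t, y)) (ContinuousLinearMap.inr ℝ ℝ (E d)) x :=
    hasFDerivAt_prodMk_right t x
  have h3 : HasFDerivAt (φ t) _ x := h1.comp x h2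
  rw [pd, h3.fderiv]
  simp

/-- A partial derivative is the joint derivative evaluated at a fixed vector, so joint smoothness is
inherited. The spatial case below works in the same way. -/
lemma contDiff_deriv_time (h : ContDiff ℝ ∞ (Function.uncurry φ)) :
    ContDiff ℝ ∞ (Function.uncurry fun t x => deriv (fun s => φ s x) t) := by
  have : (Function.uncurry fun t x => deriv (fun s => φ s x) t)
      = fun z => fderiv ℝ (Function.uncurry φ) z (1, 0) := funext fun z => deriv_time_eq h z.1 z.2
  rw [this]
  exact (h.fderiv_right (m := ∞) (by simp)).clm_apply contDiff_const

lemma contDiff_pd_space (h : ContDiff ℝ ∞ (Function.uncurry φ)) (j : Fin d) :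
    ContDiff ℝ ∞ (Function.uncurry fun t x => pd j (φ t) x) := by
  have : (Function.uncurry fun t x => pd j (φ t) x)
      = fun z => fderiv ℝ (Function.uncurry φ) z (0, EuclideanSpace.single j (1 : ℝ)) :=
    funext fun z => pd_space_eq h j z.1 z.2
  rw [this]
  exact (h.fderiv_right (m := ∞) (by simp)).clm_apply contDiff_const

lemma contDiff_lap_space (h : ContDiff ℝ ∞ (Function.uncurry φ)) :
    ContDiff ℝ ∞ (Function.uncurry fun t x => lap (φ t) x) := by
  change ContDiff ℝ ∞ fun z : ℝ × E d => ∑ j, pd j (pd j (φ z.1)) z.2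
  exact ContDiff.sum fun j _ =>
    contDiff_pd_space (φ := fun t => pd j (φ t)) (contDiff_pd_space h j) j

lemma contDiff_slice (h : ContDiff ℝ ∞ (Function.uncurry φ)) (t : ℝ) : ContDiff ℝ ∞ (φ t) :=
  h.comp (contDiff_const.prodMk contDiff_id)

lemma contDiff_time (h : ContDiff ℝ ∞ (Function.uncurry φ)) (x : E d) :
    ContDiff ℝ ∞ fun t => φ t x :=
  h.comp (contDiff_id.prodMk contDiff_const)

end TestDerivatives

lemma lap_add {g h : E d → ℝ} (hg : ContDiff ℝ ∞ g) (hh : ContDiff ℝ ∞ h) (x : E d) :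
    lap (fun y => g y + h y) x = lap g x + lap h x := by
  unfold lap
  rw [← Finset.sum_add_distrib]
  refine Finset.sum_congr rfl fun j _ => ?_
  rw [← pd_add ((contDiff_pd hg j).differentiable (by simp) x)
    ((contDiff_pd hh j).differentiable (by simp) x)]
  congr 1
  ext y
  exact pd_add (hg.differentiable (by simp) y) (hh.differentiable (by simp) y) j

/-- The test functions on `(0,T) × 𝕋^d`. -/
def interiorTests (d : ℕ) (T : ℝ) : Submodule ℝ (ℝ → E d → ℝ) where
  carrier := {φ | IsInteriorTest T φ}
  add_mem' := by
    rintro φ χ ⟨⟨h1, h2, b, hb, h3⟩, a, ha, h4⟩ ⟨⟨k1, k2, b', hb', k3⟩, a', ha', k4⟩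
    refine ⟨⟨h1.add k1, fun t i x => ?_, max b b', max_lt hb hb', fun t ht x => ?_⟩,
      min a a', lt_min ha ha', fun t ht x => ?_⟩
    · simp only [Pi.add_apply, h2 t i x, k2 t i x]
    · simp only [Pi.add_apply, h3 t ((le_max_left _ _).trans ht) x,
        k3 t ((le_max_right _ _).trans ht) x, add_zero]
    · simp only [Pi.add_apply, h4 t (ht.trans (min_le_left _ _)) x,
        k4 t (ht.trans (min_le_right _ _)) x, add_zero]
  zero_mem' := ⟨⟨contDiff_const, fun _ _ _ => rfl, T - 1, by simp, fun _ _ _ => rfl⟩, 1, one_pos,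
    fun _ _ _ => rfl⟩
  smul_mem' := by
    rintro c φ ⟨⟨h1, h2, b, hb, h3⟩, a, ha, h4⟩
    refine ⟨⟨contDiff_const.mul h1, fun t i x => ?_, b, hb, fun t ht x => ?_⟩, a, ha,
      fun t ht x => ?_⟩
    · simp only [Pi.smul_apply, h2 t i x]
    · simp only [Pi.smul_apply, h3 t ht x, smul_zero]
    · simp only [Pi.smul_apply, h4 t ht x, smul_zero]

lemma integrable_sqNorm_of_memLp {α : Type*} [MeasurableSpace α] {μ : Measure α}
    {A : α → Fin d → Fin d → ℝ} (h : ∀ i j, MemLp (fun z => A z i j) 2 μ) :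
    Integrable (fun z => sqNorm (A z)) μ :=
  integrable_finsetSum _ fun i _ => integrable_finsetSum _ fun j _ => (h i j).integrable_sq

namespace IsLeraySolution

variable {T₀ ν ℓ : ℝ} {u₀ : E d → E d} {f u : ℝ → E d → E d} {p : ℝ → E d → ℝ}
  {Du : ℝ → E d → Fin d → Fin d → ℝ}

/-- The quadratic terms are integrable by the `L²` bounds on `u`, `f` and `Du`; the current term is
the only one that needs the separate integrability hypothesis. -/
lemma integrable_energyDefect (hu : IsLeraySolution T₀ ν u₀ f u p Du)
    (hD : HasNonnegDefect T₀ ν f u p Du) {φ : ℝ → E d → ℝ}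
    (hφ : ContDiff ℝ ∞ (Function.uncurry φ)) :
    Integrable (fun z : ℝ × E d =>
      1 / 2 * ‖u z.1 z.2‖ ^ 2 * (deriv (fun s => φ s z.2) z.1 + ν * lap (φ z.1) z.2)
      + (1 / 2 * ‖u z.1 z.2‖ ^ 2 + p z.1 z.2) * ∑ j, u z.1 z.2 j * pd j (φ z.1) z.2
      + inner ℝ (u z.1 z.2) (f z.1 z.2) * φ z.1 z.2
      - ν * sqNorm (Du z.1 z.2) * φ z.1 z.2) (spaceTime d T₀) := by
  have h1 : Integrable (fun z : ℝ × E d => 1 / 2 * ‖u z.1 z.2‖ ^ 2) (spaceTime d T₀) :=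
    (integrable_norm_sq_of_memLp hu.u_memLp).const_mul _
  have h2 : Integrable (fun z : ℝ × E d => inner ℝ (u z.1 z.2) (f z.1 z.2)) (spaceTime d T₀) :=
    integrable_inner_of_memLp hu.u_memLp hu.f_memLp
  have h3 : Integrable (fun z : ℝ × E d => ν * sqNorm (Du z.1 z.2)) (spaceTime d T₀) :=
    (integrable_sqNorm_of_memLp hu.Du_memLp).const_mul _
  have h4 : ∀ j, Integrable (fun z : ℝ × E d =>
      (1 / 2 * ‖u z.1 z.2‖ ^ 2 + p z.1 z.2) * u z.1 z.2 j) (spaceTime d T₀) := fun j =>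
    (EuclideanSpace.proj j : E d →L[ℝ] ℝ).integrable_comp hD.current_integrable
  have h5 : Integrable (fun z : ℝ × E d => (1 / 2 * ‖u z.1 z.2‖ ^ 2 + p z.1 z.2)
      * ∑ j, u z.1 z.2 j * pd j (φ z.1) z.2) (spaceTime d T₀) := by
    simp only [Finset.mul_sum, ← mul_assoc]
    exact integrable_finsetSum _ fun j _ =>
      Integrable.mul_continuous_spaceTime (h4 j) (contDiff_pd_space hφ j).continuous
  have h6 := Integrable.mul_continuous_spaceTime h1
    ((contDiff_deriv_time hφ).add ((contDiff_lap_space hφ).const_smul ν)).continuous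
  exact ((h6.add h5).add (Integrable.mul_continuous_spaceTime h2 hφ.continuous)).sub
    (Integrable.mul_continuous_spaceTime h3 hφ.continuous)

/-- The distribution `D[u]`, as a linear functional. -/
noncomputable def defectFunctional (hu : IsLeraySolution T₀ ν u₀ f u p Du)
    (hD : HasNonnegDefect T₀ ν f u p Du) : interiorTests d T₀ →ₗ[ℝ] ℝ where
  toFun φ := energyDefect T₀ ν f u p Du φ.1
  map_add' := by
    rintro ⟨φ, hφ⟩ ⟨χ, hχ⟩
    have h1 : ContDiff ℝ ∞ (Function.uncurry φ) := hφ.smooth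
    have h2 : ContDiff ℝ ∞ (Function.uncurry χ) := hχ.smooth
    unfold energyDefect
    rw [← integral_add (hu.integrable_energyDefect hD h1) (hu.integrable_energyDefect hD h2)]
    refine integral_congr_ae (Filter.Eventually.of_forall fun z => ?_)
    have e1 : deriv (fun s => φ s z.2 + χ s z.2) z.1
        = deriv (fun s => φ s z.2) z.1 + deriv (fun s => χ s z.2) z.1 :=
      deriv_add ((contDiff_time h1 z.2).differentiable (by simp) _)
        ((contDiff_time h2 z.2).differentiable (by simp) _)
    have e2 : lap (φ z.1 + χ z.1) z.2 = lap (φ z.1) z.2 + lap (χ z.1) z.2 :=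
      lap_add (contDiff_slice h1 _) (contDiff_slice h2 _) _
    have e3 : ∀ j, pd j (φ z.1 + χ z.1) z.2 = pd j (φ z.1) z.2 + pd j (χ z.1) z.2 := fun j =>
      pd_add ((contDiff_slice h1 _).differentiable (by simp) _)
        ((contDiff_slice h2 _).differentiable (by simp) _) j
    simp only [Submodule.coe_add, e1, e2, e3, Pi.add_apply, mul_add, Finset.sum_add_distrib]
    ring
  map_smul' := by
    rintro c ⟨φ, hφ⟩
    have h1 : ContDiff ℝ ∞ (Function.uncurry φ) := hφ.smooth
    unfold energyDefect
    rw [RingHom.id_apply, smul_eq_mul, ← integral_const_mul]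
    refine integral_congr_ae (Filter.Eventually.of_forall fun z => ?_)
    have e1 : deriv (fun s => c * φ s z.2) z.1 = c * deriv (fun s => φ s z.2) z.1 :=
      deriv_const_mul c ((contDiff_time h1 z.2).differentiable (by simp) _)
    have e2 : lap (c • φ z.1) z.2 = c * lap (φ z.1) z.2 :=
      lap_const_mul c (contDiff_slice h1 _) _
    have e3 : ∀ j, pd j (c • φ z.1) z.2 = c * pd j (φ z.1) z.2 := fun j =>
      pd_const_mul c (contDiff_slice h1 _) j _
    have e4 : ∑ j, u z.1 z.2 j * (c * pd j (φ z.1) z.2)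
        = c * ∑ j, u z.1 z.2 j * pd j (φ z.1) z.2 := by
      rw [Finset.mul_sum]; exact Finset.sum_congr rfl fun j _ => by ring
    simp only [Submodule.coe_smul, e1, e2, e3, e4, Pi.smul_apply, smul_eq_mul]
    ring

end IsLeraySolution

/-! ### Representation of the defect by a Radon measure -/

/-- The space `(0,T) × [0,1]^d`. -/
abbrev ClosedCylinder (d : ℕ) (T : ℝ) : Type := ↥(Ioo (0 : ℝ) T) × ↥(closure (cell d))

section Cylinder

instance : CompactSpace ↥(closure (cell d)) :=
  isCompact_iff_compactSpace.1 isBounded_cell.isCompact_closure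

instance (T : ℝ) : LocallyCompactSpace ↥(Ioo (0 : ℝ) T) := isOpen_Ioo.locallyCompactSpace

lemma measurable_lattice_fract : Measurable (ZSpan.fract (latticeBasis d) : E d → E d) := by
  have : (ZSpan.fract (latticeBasis d) : E d → E d)
      = fun x => WithLp.toLp 2 fun i => Int.fract (x i) := by
    ext x i
    have h : ∀ y : E d, (latticeBasis d).repr y i = y i := fun y => by simp [latticeBasis]
    rw [← h, ZSpan.repr_fract_apply, h]
  rw [this]
  refine (WithLp.measurable_toLp 2 _).comp (measurable_pi_lambda _ fun i => ?_)
  exact _root_.measurable_fract.comp (by fun_prop)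

/-- The restriction of a test function to the cylinder over the closed cell. -/
noncomputable def restrictCylinder (d : ℕ) (T : ℝ) :
    interiorTests d T →ₗ[ℝ] C_c(ClosedCylinder d T, ℝ) where
  toFun φ :=
    { toFun := fun z => φ.1 z.1 z.2
      continuous_toFun := by
        have : Continuous (Function.uncurry φ.1) := φ.2.smooth.continuous
        exact this.comp (by fun_prop : Continuous fun z : ClosedCylinder d T =>
          ((z.1 : ℝ), (z.2 : E d)))
      hasCompactSupport' := by
        obtain ⟨b, hb, h3⟩ := φ.2.vanish
        obtain ⟨a, ha, h4⟩ := φ.2.vanish_zero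
        have hK : IsCompact ((Subtype.val : Ioo (0 : ℝ) T → ℝ) ⁻¹' Icc a b) :=
          Topology.IsInducing.subtypeVal.isCompact_preimage' isCompact_Icc (by
            rw [Subtype.range_coe]; exact fun t ht => ⟨ha.trans_le ht.1, ht.2.trans_lt hb⟩)
        refine HasCompactSupport.intro (hK.prod isCompact_univ) fun z hz => ?_
        by_contra hne
        refine hz ⟨⟨?_, ?_⟩, trivial⟩
        · by_contra hlt; exact hne (h4 _ (not_le.1 hlt).le _)
        · by_contra hlt; exact hne (h3 _ (not_le.1 hlt).le _) }
  map_add' _ _ := rfl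
  map_smul' _ _ := rfl

lemma restrictCylinder_apply {T : ℝ} (φ : interiorTests d T) (z : ClosedCylinder d T) :
    restrictCylinder d T φ z = φ.1 z.1 z.2 := rfl

lemma restrictCylinder_fract {T : ℝ} (φ : interiorTests d T) (t : Ioo (0 : ℝ) T) (x : E d) :
    restrictCylinder d T φ
      (t, ⟨ZSpan.fract (latticeBasis d) x, subset_closure (fract_mem_cell x)⟩) = φ.1 t x :=
  (φ.2.periodic t).apply_fract x

/-- Periodicity recovers a test function from one cell, and it vanishes outside `(0,T)`. The defect
therefore descends to a functional on the restrictions. -/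
lemma restrictCylinder_injective (T : ℝ) : Function.Injective (restrictCylinder d T) := by
  rw [← LinearMap.ker_eq_bot, LinearMap.ker_eq_bot']
  intro φ hφ
  ext t x
  obtain ⟨b, hb, h3⟩ := φ.2.vanish
  obtain ⟨a, ha, h4⟩ := φ.2.vanish_zero
  by_cases h1 : t ≤ 0
  · exact h4 t (h1.trans ha.le) x
  by_cases h2 : T ≤ t
  · exact h3 t (hb.le.trans h2) x
  · rw [← restrictCylinder_fract φ ⟨t, not_le.1 h1, not_le.1 h2⟩ x, hφ]; rfl

lemma nonneg_of_restrictCylinder {T : ℝ} {φ : interiorTests d T}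
    (h : ∀ z, 0 ≤ restrictCylinder d T φ z) (t : ℝ) (x : E d) : 0 ≤ φ.1 t x := by
  obtain ⟨b, hb, h3⟩ := φ.2.vanish
  obtain ⟨a, ha, h4⟩ := φ.2.vanish_zero
  by_cases h1 : t ≤ 0
  · rw [h4 t (h1.trans ha.le) x]
  by_cases h2 : T ≤ t
  · rw [h3 t (hb.le.trans h2) x]
  · rw [← restrictCylinder_fract φ ⟨t, not_le.1 h1, not_le.1 h2⟩ x]; exact h _

/-- Test functions dominate every compactly supported continuous function. -/
lemma exists_restrictCylinder_add_nonneg {T : ℝ} (hT : 0 < T) (y : C_c(ClosedCylinder d T, ℝ)) :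
    ∃ φ : interiorTests d T, ∀ z, 0 ≤ restrictCylinder d T φ z + y z := by
  obtain ⟨C, hC⟩ := y.hasCompactSupport.exists_bound_of_continuous y.continuous
  have hK : IsCompact ((fun z : ClosedCylinder d T => (z.1 : ℝ)) '' tsupport y) :=
    y.hasCompactSupport.isCompact.image (by fun_prop)
  obtain ⟨δ, hδ0, hδT, hδ⟩ : ∃ δ > 0, δ < T / 2 ∧
      ∀ z ∈ tsupport y, δ ≤ (z.1 : ℝ) ∧ (z.1 : ℝ) ≤ T - δ := by
    rcases (tsupport y).eq_empty_or_nonempty with he | hne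
    · exact ⟨T / 4, by linarith, by linarith, by simp [he]⟩
    · obtain ⟨_, ⟨z1, hz1, rfl⟩, h1⟩ := hK.exists_isLeast (hne.image _)
      obtain ⟨_, ⟨z2, hz2, rfl⟩, h2⟩ := hK.exists_isGreatest (hne.image _)
      have p1 := z1.1.2.1
      have p2 := z2.1.2.2
      refine ⟨min (min (z1.1 : ℝ) (T - z2.1)) (T / 4), lt_min (lt_min p1 (by linarith))
        (by linarith), (min_le_right _ _).trans_lt (by linarith), fun z hz => ⟨?_, ?_⟩⟩
      · exact ((min_le_left _ _).trans (min_le_left _ _)).trans (h1 ⟨z, hz, rfl⟩)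
      · have a1 : (z.1 : ℝ) ≤ z2.1 := h2 ⟨z, hz, rfl⟩
        have a2 := (min_le_left (min (z1.1 : ℝ) (T - z2.1)) (T / 4)).trans (min_le_right _ _)
        linarith
  -- A bump in time equal to `1` on `[δ, T - δ]`, which contains all times in the support of `y`,
  -- and zero outside `(δ/2, T - δ/2)`. Multiplied by a bound `C` for `|y|`, it is the dominating
  -- test function.
  let χ : ContDiffBump (T / 2) := ⟨T / 2 - δ, T / 2 - δ / 2, by linarith, by linarith⟩
  have hχ : ContDiff ℝ ∞ (χ : ℝ → ℝ) := χ.contDiff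
  have hzero : ∀ t, T / 2 - δ / 2 ≤ |t - T / 2| → χ t = 0 := fun t ht =>
    χ.zero_of_le_dist (by rwa [Real.dist_eq])
  have h1 := isTest_mul (T := T) hχ ⟨T - δ / 2, by linarith, fun t ht => hzero t (by
    rw [abs_of_nonneg (by linarith)]; linarith)⟩ (IsSmoothPeriodic.const (d := d) C)
  refine ⟨⟨_, h1, δ / 2, by linarith, fun t ht x => ?_⟩, fun z => ?_⟩
  · rw [hzero t (by rw [abs_of_nonpos (by linarith)]; linarith), zero_mul]
  · rw [restrictCylinder_apply]
    have hC0 : 0 ≤ C := (norm_nonneg _).trans (hC z)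
    by_cases hz : z ∈ tsupport y
    · have : χ (z.1 : ℝ) = 1 := χ.one_of_mem_closedBall (by
        rw [Metric.mem_closedBall, Real.dist_eq, abs_le]
        have := hδ z hz
        constructor <;> simp only [χ] <;> linarith)
      simp only [this, one_mul]
      have := (abs_le.1 (hC z)).1
      linarith
    · rw [image_eq_zero_of_notMem_tsupport hz, add_zero]
      exact mul_nonneg χ.nonneg hC0

end Cylinder

namespace IsLeraySolution

variable {T₀ ν ℓ : ℝ} {u₀ : E d → E d} {f u : ℝ → E d → E d} {p : ℝ → E d → ℝ}
  {Du : ℝ → E d → Fin d → Fin d → ℝ}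

/-- A non-negative defect is a Radon measure. -/
theorem exists_representsDefect (hT₀ : 0 < T₀) (hu : IsLeraySolution T₀ ν u₀ f u p Du)
    (hD : HasNonnegDefect T₀ ν f u p Du) :
    ∃ D : Measure (ℝ × E d), SFinite D ∧ RepresentsDefect T₀ ν f u p Du D := by
  let cone : PointedCone ℝ C_c(ClosedCylinder d T₀, ℝ) :=
    { carrier := {g | ∀ z, 0 ≤ g z}
      add_mem' := fun ha hb z => add_nonneg (ha z) (hb z)
      zero_mem' := fun z => le_rfl
      smul_mem' := fun c g hg z => mul_nonneg c.2 (hg z) }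
  let e := LinearEquiv.ofInjective (restrictCylinder d T₀) (restrictCylinder_injective T₀)
  -- The defect as a partially defined functional on the range of the restriction map. The Riesz
  -- extension theorem needs its positivity there and the domination by test functions.
  let F : C_c(ClosedCylinder d T₀, ℝ) →ₗ.[ℝ] ℝ :=
    ⟨LinearMap.range (restrictCylinder d T₀), (hu.defectFunctional hD) ∘ₗ e.symm.toLinearMap⟩
  have hF : ∀ φ : interiorTests d T₀, F (e φ) = energyDefect T₀ ν f u p Du φ.1 := fun φ => by
    change hu.defectFunctional hD (e.symm (e φ)) = _
    rw [e.symm_apply_apply]; rfl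
  obtain ⟨g, hg, hpos⟩ := riesz_extension cone F
    (fun x hx => by
      obtain ⟨φ, rfl⟩ := e.surjective x
      rw [hF]
      exact hD.nonneg _ φ.2 (nonneg_of_restrictCylinder hx))
    (fun y => by
      obtain ⟨φ, hφ⟩ := exists_restrictCylinder_add_nonneg hT₀ y
      exact ⟨e φ, hφ⟩)
  let Λ : C_c(ClosedCylinder d T₀, ℝ) →ₚ[ℝ] ℝ :=
    PositiveLinearMap.mk₀ g fun y hy => hpos y fun z => hy z
  -- The closed cell counts opposite faces separately. Reduction modulo the lattice moves any mass
  -- on them into the half-open cell, and periodic test functions do not notice.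
  let π : ClosedCylinder d T₀ → ℝ × E d := fun z => (z.1, ZSpan.fract (latticeBasis d) z.2)
  have hπ : Measurable π :=
    (measurable_subtype_coe.comp measurable_fst).prodMk
      (measurable_lattice_fract.comp (measurable_subtype_coe.comp measurable_snd))
  refine ⟨(RealRMK.rieszMeasure Λ).map π, inferInstance, ?_, fun φ hφ => ?_⟩
  · rw [Measure.map_apply hπ (measurableSet_Ioo.prod measurableSet_cell).compl]
    have : π ⁻¹' (Ioo 0 T₀ ×ˢ cell d)ᶜ = ∅ := by
      ext z
      simp [π, fract_mem_cell]
    rw [this, measure_empty]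
  · have hm : AEStronglyMeasurable (Function.uncurry φ) ((RealRMK.rieszMeasure Λ).map π) :=
      hφ.smooth.continuous.aestronglyMeasurable
    have hcomp : Function.uncurry φ ∘ π = restrictCylinder d T₀ ⟨φ, hφ⟩ := by
      ext z
      exact (hφ.periodic z.1).apply_fract z.2
    rw [integrable_map_measure hm hπ.aemeasurable, integral_map hπ.aemeasurable hm]
    change _ ∧ ∫ z, (Function.uncurry φ ∘ π) z ∂_ = _
    rw [hcomp]
    refine ⟨(restrictCylinder d T₀ ⟨φ, hφ⟩).continuous.integrable_of_hasCompactSupport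
      (restrictCylinder d T₀ ⟨φ, hφ⟩).hasCompactSupport, ?_⟩
    rw [RealRMK.integral_rieszMeasure]
    exact (hg (e ⟨φ, hφ⟩)).trans (hF ⟨φ, hφ⟩)

end IsLeraySolution

/-! ### Smooth approximations of the indicator of a time interval -/

section Ramp

open Filter Topology

variable (β : ContDiffBump (0 : ℝ))

/-- A smooth transition from `0` to `1` around `0`, with derivative the normalized bump `β`. -/
noncomputable def ramp (s : ℝ) : ℝ := ∫ r in -β.rOut..s, β.normed volume r

lemma hasDerivAt_ramp (s : ℝ) : HasDerivAt (ramp β) (β.normed volume s) s :=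
  intervalIntegral.integral_hasDerivAt_right (β.continuous_normed.intervalIntegrable _ _)
    (β.continuous_normed.stronglyMeasurableAtFilter _ _) β.continuous_normed.continuousAt

lemma deriv_ramp : deriv (ramp β) = β.normed volume := funext fun s => (hasDerivAt_ramp β s).deriv

lemma contDiff_ramp : ContDiff ℝ ∞ (ramp β) := by
  refine contDiff_infty_iff_deriv.2 ⟨fun s => (hasDerivAt_ramp β s).differentiableAt, ?_⟩
  rw [deriv_ramp]
  exact β.contDiff_normed

lemma normed_eq_zero {s : ℝ} (hs : β.rOut ≤ |s|) : β.normed volume s = 0 := by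
  have : s ∉ Function.support (β.normed volume) := by
    rw [β.support_normed_eq, Metric.mem_ball, dist_zero_right, Real.norm_eq_abs]
    exact not_lt.2 hs
  exact Function.notMem_support.1 this

lemma ramp_eq_zero {s : ℝ} (hs : s ≤ -β.rOut) : ramp β s = 0 := by
  refine intervalIntegral.integral_zero_ae (Eventually.of_forall fun r hr => ?_)
  rw [uIoc_of_ge hs] at hr
  refine normed_eq_zero β ?_
  have := β.rOut_pos
  rw [abs_of_nonpos (by linarith [hr.2])]
  linarith [hr.2]

lemma ramp_eq_one {s : ℝ} (hs : β.rOut ≤ s) : ramp β s = 1 := by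
  have hp := β.rOut_pos
  rw [← β.integral_normed (μ := volume), ramp, intervalIntegral.integral_of_le (by linarith)]
  refine setIntegral_eq_integral_of_forall_compl_eq_zero fun r hr => normed_eq_zero β ?_
  rw [mem_Ioc, not_and_or, not_lt, not_le] at hr
  rcases hr with hr | hr
  · rw [abs_of_nonpos (by linarith)]; linarith
  · rw [abs_of_nonneg (by linarith)]; linarith

lemma monotone_ramp : Monotone (ramp β) := by
  refine monotone_of_deriv_nonneg (fun s => (hasDerivAt_ramp β s).differentiableAt) fun s => ?_
  rw [deriv_ramp]
  exact β.nonneg_normed s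

lemma ramp_nonneg (s : ℝ) : 0 ≤ ramp β s := by
  rcases le_total s (-β.rOut) with h | h
  · rw [ramp_eq_zero β h]
  · rw [← ramp_eq_zero β le_rfl]; exact monotone_ramp β h

lemma ramp_le_one (s : ℝ) : ramp β s ≤ 1 := by
  rcases le_total s β.rOut with h | h
  · rw [← ramp_eq_one β le_rfl]; exact monotone_ramp β h
  · rw [ramp_eq_one β h]

/-- A smooth approximation of the indicator function of `(0,T)`. -/
noncomputable def plateau (T t : ℝ) : ℝ := ramp β (t - 2 * β.rOut) - ramp β (t - T)

variable {T : ℝ}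

lemma contDiff_plateau : ContDiff ℝ ∞ (plateau β T) :=
  ((contDiff_ramp β).comp (contDiff_id.sub contDiff_const)).sub
    ((contDiff_ramp β).comp (contDiff_id.sub contDiff_const))

lemma deriv_plateau (t : ℝ) : deriv (plateau β T) t
    = β.normed volume (t - 2 * β.rOut) - β.normed volume (t - T) := by
  have h : ∀ a, HasDerivAt (fun t => ramp β (t - a)) (β.normed volume (t - a)) t := fun a =>
    (hasDerivAt_ramp β (t - a)).comp_sub_const t a
  exact ((h _).sub (h _)).deriv

lemma plateau_eq_zero_of_le (hT : 4 * β.rOut ≤ T) {t : ℝ} (ht : t ≤ β.rOut) :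
    plateau β T t = 0 := by
  have hp := β.rOut_pos
  rw [plateau, ramp_eq_zero β (by linarith), ramp_eq_zero β (by linarith), sub_zero]

lemma plateau_eq_zero_of_ge (hT : 4 * β.rOut ≤ T) {t : ℝ} (ht : T + β.rOut ≤ t) :
    plateau β T t = 0 := by
  have hp := β.rOut_pos
  rw [plateau, ramp_eq_one β (by linarith), ramp_eq_one β (by linarith), sub_self]

lemma plateau_eq_one {t : ℝ} (h1 : 3 * β.rOut ≤ t) (h2 : t ≤ T - β.rOut) :
    plateau β T t = 1 := by
  have hp := β.rOut_pos
  rw [plateau, ramp_eq_one β (by linarith), ramp_eq_zero β (by linarith), sub_zero]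

lemma plateau_mem_Icc (hT : 4 * β.rOut ≤ T) (t : ℝ) : plateau β T t ∈ Icc (0 : ℝ) 1 := by
  have hp := β.rOut_pos
  have h1 := ramp_nonneg β (t - T)
  have h2 := ramp_le_one β (t - 2 * β.rOut)
  refine ⟨?_, by unfold plateau; linarith⟩
  unfold plateau
  exact sub_nonneg.2 (monotone_ramp β (by linarith))

end Ramp

/-! ### Mass of a measure that is minus a distributional derivative -/

section MeasureFormula

open Filter Topology

/-- A sequence of bump functions concentrating at the origin. -/
noncomputable def bumpSeq (n : ℕ) : ContDiffBump (0 : ℝ) :=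
  ⟨1 / 2 * (1 / ((n : ℝ) + 1)), 1 / ((n : ℝ) + 1), by positivity, by
    have : 0 < 1 / ((n : ℝ) + 1) := by positivity
    linarith⟩

lemma tendsto_bumpSeq : Tendsto (fun n => (bumpSeq n).rOut) atTop (𝓝 0) :=
  tendsto_one_div_add_atTop_nhds_zero_nat

variable {T₀ c : ℝ} {K : ℝ → ℝ} {ρ : Measure ℝ}

/-- Lebesgue differentiation: mollifications of `K`, extended by zero, converge to `K` almost
everywhere. -/
lemma ae_tendsto_integral_bump (hK : Integrable K (volume.restrict (Ioo 0 T₀))) :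
    ∀ᵐ T ∂volume.restrict (Ioo 0 T₀),
      Tendsto (fun n => ∫ t in Ioo 0 T₀, K t * (bumpSeq n).normed volume (t - T)) atTop
        (𝓝 (K T)) := by
  have hi : Integrable ((Ioo 0 T₀).indicator K) := (integrable_indicator_iff measurableSet_Ioo).2 hK
  -- The constant `2` bounds the ratio of outer to inner radius of the bumps, which is exactly `2`
  -- for `bumpSeq`.
  have h := ContDiffBump.ae_convolution_tendsto_right_of_locallyIntegrable (μ := volume)
    (φ := bumpSeq) (K := 2) tendsto_bumpSeq (Eventually.of_forall fun n => by
      simp only [bumpSeq]; linarith) hi.locallyIntegrable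
  rw [ae_restrict_iff' measurableSet_Ioo]
  filter_upwards [h] with T hT hmem
  rw [indicator_of_mem hmem] at hT
  refine hT.congr fun n => ?_
  rw [convolution_eq_swap, ← integral_indicator measurableSet_Ioo]
  refine integral_congr_ae (Eventually.of_forall fun t => ?_)
  simp only [ContinuousLinearMap.lsmul_apply, smul_eq_mul]
  rw [← ContDiffBump.normed_neg, neg_sub]
  by_cases ht : t ∈ Ioo 0 T₀
  · rw [indicator_of_mem ht, indicator_of_mem ht, mul_comm]
  · rw [indicator_of_notMem ht, indicator_of_notMem ht, mul_zero]

/-- The bump centred at `2 * rOut` lives on times between `rOut` and `3 * rOut`. It is eventually a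
probability density on an interval next to `0` where `K` is within `ε / 2` of `c`. -/
lemma tendsto_integral_bump_zero (hT₀ : 0 < T₀) (hK : Integrable K (volume.restrict (Ioo 0 T₀)))
    (hc : ∀ ε > 0, ∃ δ > 0, ∀ᵐ t ∂volume.restrict (Ioo 0 δ), |K t - c| ≤ ε) :
    Tendsto (fun n => ∫ t in Ioo 0 T₀,
      K t * (bumpSeq n).normed volume (t - 2 * (bumpSeq n).rOut)) atTop (𝓝 c) := by
  rw [Metric.tendsto_atTop]
  intro ε hε
  obtain ⟨δ, hδ, hKδ⟩ := hc (ε / 2) (by positivity)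
  have hev : ∀ᶠ n in atTop, (bumpSeq n).rOut < min δ T₀ / 3 :=
    tendsto_bumpSeq.eventually_lt_const (by have := lt_min hδ hT₀; linarith)
  obtain ⟨N, hN⟩ := eventually_atTop.1 hev
  refine ⟨N, fun n hn => ?_⟩
  set β := bumpSeq n
  have hr : 3 * β.rOut < min δ T₀ := by linarith [hN n hn]
  have hr1 := hr.trans_le (min_le_left _ _)
  have hr2 := hr.trans_le (min_le_right _ _)
  have hp := β.rOut_pos
  have hsupp : ∀ t, t ∉ Ioo 0 (3 * β.rOut) → β.normed volume (t - 2 * β.rOut) = 0 := by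
    intro t ht
    refine normed_eq_zero β ?_
    rw [mem_Ioo, not_and_or, not_lt, not_lt] at ht
    rcases ht with ht | ht
    · rw [abs_of_nonpos (by linarith)]; linarith
    · rw [abs_of_nonneg (by linarith)]; linarith
  have hcont : Continuous fun t => β.normed volume (t - 2 * β.rOut) :=
    β.continuous_normed.comp (by fun_prop)
  have hone : ∫ t in Ioo 0 T₀, β.normed volume (t - 2 * β.rOut) = 1 := by
    rw [setIntegral_eq_integral_of_forall_compl_eq_zero fun t ht => hsupp t fun h =>
      ht (show t ∈ Ioo 0 T₀ from ⟨h.1, h.2.trans hr2⟩),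
      integral_sub_right_eq_self (fun t => β.normed volume t),
      β.integral_normed]
  have hint : Integrable (fun t => β.normed volume (t - 2 * β.rOut))
      (volume.restrict (Ioo 0 T₀)) := by
    by_contra hni
    rw [integral_undef hni] at hone
    exact zero_ne_one hone
  obtain ⟨C, hC⟩ := β.hasCompactSupport_normed (μ := volume).exists_bound_of_continuous
    β.continuous_normed
  have hintK : Integrable (fun t => K t * β.normed volume (t - 2 * β.rOut))
      (volume.restrict (Ioo 0 T₀)) :=
    hK.mul_bdd hcont.aestronglyMeasurable (Eventually.of_forall fun t => hC _)
  have hdiff : (∫ t in Ioo 0 T₀, K t * β.normed volume (t - 2 * β.rOut)) - c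
      = ∫ t in Ioo 0 T₀, (K t - c) * β.normed volume (t - 2 * β.rOut) := by
    simp only [sub_mul]
    rw [integral_sub hintK (hint.const_mul c), integral_const_mul, hone, mul_one]
  rw [Real.dist_eq, hdiff, ← Real.norm_eq_abs]
  calc _ ≤ ∫ t in Ioo 0 T₀, ε / 2 * β.normed volume (t - 2 * β.rOut) := by
        refine norm_integral_le_of_norm_le (hint.const_mul _) ?_
        have h1 := ae_imp_of_ae_restrict hKδ
        refine ae_restrict_of_ae ?_
        filter_upwards [h1] with t ht
        rw [norm_mul, Real.norm_eq_abs, Real.norm_of_nonneg (β.nonneg_normed _)]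
        by_cases hmem : t ∈ Ioo 0 (3 * β.rOut)
        · exact mul_le_mul_of_nonneg_right (ht ⟨hmem.1, hmem.2.trans hr1⟩) (β.nonneg_normed _)
        · rw [hsupp t hmem, mul_zero, mul_zero]
    _ = ε / 2 := by rw [integral_const_mul, hone, mul_one]
    _ < ε := by linarith

/-- If `ρ` is minus the distributional derivative of `K` on `(0,T₀)` and `c` is the limit of `K`
at `0`, then `ρ (0,T) = c - K(T)` for almost every `T`. -/
lemma ae_measure_Ioo_eq (hT₀ : 0 < T₀) [SFinite ρ] (hK : Integrable K (volume.restrict (Ioo 0 T₀)))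
    (hc : ∀ ε > 0, ∃ δ > 0, ∀ᵐ t ∂volume.restrict (Ioo 0 δ), |K t - c| ≤ ε)
    (hρ : ∀ χ : ℝ → ℝ, ContDiff ℝ ∞ χ → (∃ a > 0, ∀ t ≤ a, χ t = 0) →
      (∃ b < T₀, ∀ t, b ≤ t → χ t = 0) →
      Integrable χ ρ ∧ ∫ t, χ t ∂ρ = ∫ t in Ioo 0 T₀, K t * deriv χ t) :
    ∀ᵐ T ∂volume.restrict (Ioo 0 T₀),
      ρ (Ioo 0 T) < ⊤ ∧ (ρ (Ioo 0 T)).toReal = c - K T := by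
  have hsmall : ∀ r > 0, ∀ᶠ n in atTop, (bumpSeq n).rOut < r := fun r hr =>
    tendsto_bumpSeq.eventually_lt_const hr
  have hform : ∀ T ∈ Ioo 0 T₀, ∀ᶠ n in atTop, Integrable (plateau (bumpSeq n) T) ρ ∧
      ∫ t, plateau (bumpSeq n) T t ∂ρ
        = (∫ t in Ioo 0 T₀, K t * (bumpSeq n).normed volume (t - 2 * (bumpSeq n).rOut))
          - ∫ t in Ioo 0 T₀, K t * (bumpSeq n).normed volume (t - T) := by
    intro T hT
    filter_upwards [hsmall (T / 4) (by linarith [hT.1]), hsmall (T₀ - T) (by linarith [hT.2])]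
      with n h1 h2
    set β := bumpSeq n
    have h4 : 4 * β.rOut ≤ T := by linarith
    -- The rising ramp is centred at `2 * rOut`, not at `0`, so that the plateau vanishes up to time
    -- `rOut` and is an interior test function.
    obtain ⟨hi, he⟩ := hρ _ (contDiff_plateau β)
      ⟨β.rOut, β.rOut_pos, fun t ht => plateau_eq_zero_of_le β h4 ht⟩
      ⟨T + β.rOut, by linarith, fun t ht => plateau_eq_zero_of_ge β h4 ht⟩
    refine ⟨hi, ?_⟩
    obtain ⟨C, hC⟩ := β.hasCompactSupport_normed (μ := volume).exists_bound_of_continuous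
      β.continuous_normed
    have hib : ∀ a, Integrable (fun t => K t * β.normed volume (t - a))
        (volume.restrict (Ioo 0 T₀)) := fun a =>
      hK.mul_bdd (β.continuous_normed.comp (by fun_prop)).aestronglyMeasurable
        (Eventually.of_forall fun t => hC _)
    rw [he, ← integral_sub (hib _) (hib _)]
    simp only [deriv_plateau, mul_sub]
  have hlim := tendsto_integral_bump_zero hT₀ hK hc
  have hfin : ∀ᵐ T ∂volume.restrict (Ioo 0 T₀), T ∈ Ioo 0 T₀ ∧ ρ (Ioo 0 T) < ⊤ ∧
      Tendsto (fun n => ∫ t, plateau (bumpSeq n) T t ∂ρ) atTop (𝓝 (c - K T)) := by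
    filter_upwards [ae_tendsto_integral_bump hK, ae_restrict_mem measurableSet_Ioo] with T h1 hT
    have h2 : Tendsto (fun n => ∫ t, plateau (bumpSeq n) T t ∂ρ) atTop (𝓝 (c - K T)) := by
      refine (hlim.sub h1).congr' ?_
      filter_upwards [hform T hT] with n hn
      exact hn.2.symm
    refine ⟨hT, ?_, h2⟩
    -- Finiteness comes first, from Fatou: the plateaus are eventually `1` at each point of `(0,T)`,
    -- and their integrals converge. Nothing is assumed about local finiteness of `ρ`.
    have h3 : ρ (Ioo 0 T)
        ≤ liminf (fun n => ∫⁻ t, ENNReal.ofReal (plateau (bumpSeq n) T t) ∂ρ) atTop := by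
      refine le_trans ?_ (lintegral_liminf_le fun n =>
        (contDiff_plateau (bumpSeq n)).continuous.measurable.ennreal_ofReal)
      rw [← lintegral_indicator_one measurableSet_Ioo]
      refine lintegral_mono fun t => ?_
      by_cases ht : t ∈ Ioo 0 T
      · rw [indicator_of_mem ht]
        refine le_liminf_of_le (by isBoundedDefault) ?_
        filter_upwards [hsmall (t / 3) (by linarith [ht.1]), hsmall (T - t) (by linarith [ht.2])]
          with n h4 h5
        rw [plateau_eq_one _ (by linarith) (by linarith), ENNReal.ofReal_one]; rfl
      · rw [indicator_of_notMem ht]; exact zero_le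
    refine h3.trans_lt ?_
    have h4 : Tendsto (fun n => ∫⁻ t, ENNReal.ofReal (plateau (bumpSeq n) T t) ∂ρ) atTop
        (𝓝 (ENNReal.ofReal (c - K T))) := by
      refine ((ENNReal.continuous_ofReal.tendsto _).comp h2).congr' ?_
      filter_upwards [hform T hT, hsmall (T / 4) (by linarith [hT.1])] with n hn h5
      exact ofReal_integral_eq_lintegral_ofReal hn.1
        (Eventually.of_forall fun t => (plateau_mem_Icc _ (by linarith) t).1)
    rw [h4.liminf_eq]
    exact ENNReal.ofReal_lt_top
  -- An s-finite measure has at most countably many atoms. At an atom `T` the plateaus need not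
  -- converge to the indicator of `(0,T)`.
  have hatom : ∀ᵐ T ∂volume.restrict (Ioo 0 T₀), ρ {T} = 0 := by
    refine ae_restrict_of_ae ?_
    have := (Measure.countable_meas_level_set_pos (μ := ρ) (g := id) measurable_id).ae_notMem
      (volume : Measure ℝ)
    filter_upwards [this] with T hT
    simpa using hT
  filter_upwards [hfin, hatom] with T ⟨hT, hTfin, hTlim⟩ hT0
  refine ⟨hTfin, ?_⟩
  -- The plateaus extend slightly beyond `T`, so the dominating function is the indicator of a
  -- longer interval. Finite mass is known for almost every end point, hence for some `T'` beyond
  -- `T`.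
  obtain ⟨T', hTT', hT'⟩ : ∃ T' > T, ρ (Ioo 0 T') < ⊤ := by
    by_contra! hno
    have h1 : ∀ᵐ T' ∂volume.restrict (Ioo T T₀), False := by
      filter_upwards [ae_mono (Measure.restrict_mono (Ioo_subset_Ioo_left hT.1.le) le_rfl) hfin,
        ae_restrict_mem measurableSet_Ioo] with T' h2 h3
      exact (h2.2.1.trans_le (hno T' h3.1)).false
    rw [eventually_false_iff_eq_bot, ae_eq_bot, Measure.restrict_eq_zero, Real.volume_Ioo,
      ENNReal.ofReal_eq_zero] at h1
    linarith [hT.2]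
  have hdom : Tendsto (fun n => ∫ t, plateau (bumpSeq n) T t ∂ρ) atTop
      (𝓝 (∫ t, (Ioo 0 T).indicator (fun _ => (1 : ℝ)) t ∂ρ)) := by
    refine tendsto_integral_filter_of_dominated_convergence
      ((Ioo 0 T').indicator fun _ => (1 : ℝ)) ?_ ?_ ?_ ?_
    · exact Eventually.of_forall fun n => (contDiff_plateau _).continuous.aestronglyMeasurable
    · filter_upwards [hsmall (T / 4) (by linarith [hT.1]), hsmall (T' - T) (by linarith)]
        with n h1 h2
      refine Eventually.of_forall fun t => ?_
      have h3 := plateau_mem_Icc (bumpSeq n) (T := T) (by linarith) t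
      rw [Real.norm_of_nonneg h3.1]
      by_cases ht : t ∈ Ioo 0 T'
      · rw [indicator_of_mem ht]; exact h3.2
      · rw [indicator_of_notMem ht]
        rw [mem_Ioo, not_and_or, not_lt, not_lt] at ht
        have hp := (bumpSeq n).rOut_pos
        rcases ht with ht | ht
        · rw [plateau_eq_zero_of_le _ (by linarith) (by linarith)]
        · rw [plateau_eq_zero_of_ge _ (by linarith) (by linarith)]
    · exact (integrable_indicator_iff measurableSet_Ioo).2 (integrableOn_const hT'.ne)
    · have h1 : ∀ᵐ t ∂ρ, t ≠ T := by simpa [ae_iff] using hT0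
      filter_upwards [h1] with t ht
      refine tendsto_const_nhds.congr' ?_
      rcases le_or_gt t 0 with h2 | h2
      · filter_upwards [hsmall (T / 4) (by linarith [hT.1])] with n h3
        rw [indicator_of_notMem (fun h => absurd h.1 (not_lt.2 h2)),
          plateau_eq_zero_of_le _ (by linarith) (h2.trans (bumpSeq n).rOut_pos.le)]
      rcases lt_or_gt_of_ne ht with h3 | h3
      · filter_upwards [hsmall (t / 3) (by linarith), hsmall (T - t) (by linarith)] with n h4 h5
        rw [indicator_of_mem (show t ∈ Ioo 0 T from ⟨h2, h3⟩),
          plateau_eq_one _ (by linarith) (by linarith)]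
      · filter_upwards [hsmall (T / 4) (by linarith [hT.1]), hsmall (t - T) (by linarith)]
          with n h4 h5
        rw [indicator_of_notMem (fun h => absurd h.2 (not_lt.2 h3.le)),
          plateau_eq_zero_of_ge _ (by linarith) (by linarith)]
  rw [tendsto_nhds_unique hTlim hdom, integral_indicator_const _ measurableSet_Ioo]
  simp [Measure.real]

end MeasureFormula

/-! ### Density of smooth periodic functions in `L²` -/

section Density

lemma IsSmoothPeriodic.memLp {ψ : E d → ℝ} (h : IsSmoothPeriodic ψ) : MemLp ψ 2 (torus d) := by
  obtain ⟨C, -, hC⟩ := h.exists_bound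
  exact MemLp.of_bound h.continuous.aestronglyMeasurable C (Filter.Eventually.of_forall hC)

/-- The smooth periodic functions, as a subspace of `L²(𝕋^d)`. -/
def smoothL2 (d : ℕ) : Submodule ℝ (Lp ℝ 2 (torus d)) where
  carrier := {F | ∃ ψ, IsSmoothPeriodic ψ ∧ F =ᵐ[torus d] ψ}
  add_mem' := by
    rintro F F' ⟨ψ, hψ, h⟩ ⟨ψ', hψ', h'⟩
    refine ⟨_, hψ.add hψ', ?_⟩
    filter_upwards [Lp.coeFn_add F F', h, h'] with x h1 h2 h3
    rw [h1, Pi.add_apply, h2, h3]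
  zero_mem' := ⟨_, .const 0, Lp.coeFn_zero _ _ _⟩
  smul_mem' := by
    rintro c F ⟨ψ, hψ, h⟩
    refine ⟨_, hψ.const_mul c, ?_⟩
    filter_upwards [Lp.coeFn_smul c F, h] with x h1 h2
    rw [h1, Pi.smul_apply, h2, smul_eq_mul]

/-- This reduces to the corresponding fact on `ℝ^d`: `v` is extended periodically from the cell, and
by unfolding its integral against a compactly supported `g` is the torus integral against the
periodization of `g`. -/
lemma ae_eq_zero_of_integral_smooth_eq_zero {v : E d → ℝ} (hv : Integrable v (torus d))
    (h : ∀ ψ, IsSmoothPeriodic ψ → ∫ x, v x * ψ x ∂torus d = 0) : v =ᵐ[torus d] 0 := by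
  set w : E d → ℝ := fun x => v (ZSpan.fract (latticeBasis d) x) with hw
  have hp : IsPeriodic w := fun i x => by
    have hi : EuclideanSpace.single i (1 : ℝ) ∈ lattice d :=
      Submodule.subset_span ⟨i, latticeBasis_apply i⟩
    simp only [hw, ZSpan.fract_add_ZSpan _ _ hi]
  have hwv : ∀ᵐ x ∂torus d, w x = v x := by
    filter_upwards [ae_restrict_mem measurableSet_cell] with x hx
    rw [cell_eq] at hx
    simp only [hw, ZSpan.fract_eq_self.2 hx]
  have hwi : Integrable w (torus d) := hv.congr (hwv.mono fun x hx => hx.symm)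
  have hzero : ∀ᵐ x, w x = 0 := by
    refine ae_eq_zero_of_integral_contDiff_smul_eq_zero (hp.locallyIntegrable hwi)
      fun g hg hgc => ?_
    rw [integral_mul_periodize hgc hg.continuous hp hwi,
      ← h _ ⟨contDiff_periodize hgc hg, periodic_periodize g⟩]
    refine integral_congr_ae ?_
    filter_upwards [hwv] with x hx
    rw [hx, smul_eq_mul, mul_comm]
  filter_upwards [hwv, ae_restrict_of_ae hzero] with x h1 h2
  rw [← h1, h2]; rfl

/-- Smooth periodic functions are dense in `L²(𝕋^d)`. -/
lemma exists_smooth_integral_sq_sub_le {v : E d → ℝ} (hv : MemLp v 2 (torus d)) {ε : ℝ}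
    (hε : 0 < ε) : ∃ ψ, IsSmoothPeriodic ψ ∧ ∫ x, (v x - ψ x) ^ 2 ∂torus d ≤ ε := by
  have hdense : (smoothL2 d).topologicalClosure = ⊤ := by
    -- In a Hilbert space density amounts to a trivial orthogonal complement, and a function
    -- orthogonal to all smooth ones vanishes by the preceding lemma.
    rw [Submodule.topologicalClosure_eq_top_iff, Submodule.eq_bot_iff]
    intro F hF
    rw [Submodule.mem_orthogonal'] at hF
    have hFi : Integrable F (torus d) := (Lp.memLp F).integrable one_le_two
    refine (Lp.eq_zero_iff_ae_eq_zero).2 (ae_eq_zero_of_integral_smooth_eq_zero hFi fun ψ hψ => ?_)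
    have h1 := hF (hψ.memLp.toLp ψ) ⟨ψ, hψ, hψ.memLp.coeFn_toLp⟩
    rw [L2.inner_def] at h1
    rw [← h1]
    refine integral_congr_ae ?_
    filter_upwards [hψ.memLp.coeFn_toLp] with x hx
    rw [hx]
    simp [mul_comm]
  have hmem : hv.toLp v ∈ closure (smoothL2 d : Set (Lp ℝ 2 (torus d))) := by
    rw [← Submodule.topologicalClosure_coe, hdense]; trivial
  obtain ⟨F, ⟨ψ, hψ, hFψ⟩, hdist⟩ := Metric.mem_closure_iff.1 hmem (Real.sqrt ε)
    (Real.sqrt_pos.2 hε)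
  refine ⟨ψ, hψ, ?_⟩
  have h1 : ∫ x, (v x - ψ x) ^ 2 ∂torus d = ‖hv.toLp v - F‖ ^ 2 := by
    rw [← real_inner_self_eq_norm_sq, L2.inner_def]
    refine integral_congr_ae ?_
    filter_upwards [Lp.coeFn_sub (hv.toLp v) F, hv.coeFn_toLp, hFψ] with x a1 a2 a3
    rw [a1, Pi.sub_apply, a2, a3, real_inner_self_eq_norm_sq, Real.norm_eq_abs, sq_abs]
  rw [h1, ← dist_eq_norm]
  calc _ ≤ (Real.sqrt ε) ^ 2 := by gcongr
    _ = ε := Real.sq_sqrt hε.le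

end Density

/-! ### The exact energy balance and the total dissipation -/

/-- The rate of change `∫ (u·f - ν|∇u|²)` of the kinetic energy, up to the defect. -/
noncomputable def powerInput (ν : ℝ) (v w : E d → E d) (A : E d → Fin d → Fin d → ℝ) : ℝ :=
  ∫ x, (inner ℝ (v x) (w x) - ν * sqNorm (A x)) ∂torus d

/-- The kinetic energy minus the accumulated power input. -/
noncomputable def netEnergy (ν : ℝ) (f u : ℝ → E d → E d) (Du : ℝ → E d → Fin d → Fin d → ℝ)
    (t : ℝ) : ℝ :=
  1 / 2 * ∫ x, ‖u t x‖ ^ 2 ∂torus d - ∫ s in 0..t, powerInput ν (u s) (f s) (Du s)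

namespace IsLeraySolution

open Filter Topology

variable {T₀ ν ℓ : ℝ} {u₀ : E d → E d} {f u : ℝ → E d → E d} {p : ℝ → E d → ℝ}
  {Du : ℝ → E d → Fin d → Fin d → ℝ}

lemma integrable_inner (hu : IsLeraySolution T₀ ν u₀ f u p Du) :
    Integrable (fun z : ℝ × E d => inner ℝ (u z.1 z.2) (f z.1 z.2)) (spaceTime d T₀) :=
  integrable_inner_of_memLp hu.u_memLp hu.f_memLp

lemma integrable_sqNorm (hu : IsLeraySolution T₀ ν u₀ f u p Du) :
    Integrable (fun z : ℝ × E d => sqNorm (Du z.1 z.2)) (spaceTime d T₀) :=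
  integrable_sqNorm_of_memLp hu.Du_memLp

lemma integrable_powerInput_uncurry (hu : IsLeraySolution T₀ ν u₀ f u p Du) :
    Integrable (fun z : ℝ × E d => inner ℝ (u z.1 z.2) (f z.1 z.2) - ν * sqNorm (Du z.1 z.2))
      (spaceTime d T₀) :=
  hu.integrable_inner.sub (hu.integrable_sqNorm.const_mul ν)

lemma integrable_powerInput (hu : IsLeraySolution T₀ ν u₀ f u p Du) :
    Integrable (fun t => powerInput ν (u t) (f t) (Du t)) (volume.restrict (Ioo 0 T₀)) :=
  hu.integrable_powerInput_uncurry.integral_prod_left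

lemma integrable_energy (hu : IsLeraySolution T₀ ν u₀ f u p Du) :
    Integrable (fun t => 1 / 2 * ∫ x, ‖u t x‖ ^ 2 ∂torus d) (volume.restrict (Ioo 0 T₀)) :=
  (Integrable.integral_prod_left (f := fun z : ℝ × E d => ‖u z.1 z.2‖ ^ 2)
    (integrable_norm_sq_of_memLp hu.u_memLp)).const_mul _

lemma intervalIntegrable_powerInput (hT₀ : 0 < T₀) (hu : IsLeraySolution T₀ ν u₀ f u p Du) :
    IntervalIntegrable (fun t => powerInput ν (u t) (f t) (Du t)) volume 0 T₀ := by
  rw [intervalIntegrable_iff_integrableOn_Ioo_of_le hT₀.le]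
  exact hu.integrable_powerInput

lemma absolutelyContinuous_work (hT₀ : 0 < T₀) (hu : IsLeraySolution T₀ ν u₀ f u p Du) :
    AbsolutelyContinuousOnInterval (fun t => ∫ s in 0..t, powerInput ν (u s) (f s) (Du s)) 0 T₀ :=
  (hu.intervalIntegrable_powerInput hT₀).absolutelyContinuousOnInterval_intervalIntegral
    left_mem_uIcc

lemma integrable_work (hT₀ : 0 < T₀) (hu : IsLeraySolution T₀ ν u₀ f u p Du) :
    Integrable (fun t => ∫ s in 0..t, powerInput ν (u s) (f s) (Du s))
      (volume.restrict (Ioo 0 T₀)) := by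
  have h := (hu.absolutelyContinuous_work hT₀).continuousOn
  rw [uIcc_of_le hT₀.le] at h
  exact h.integrableOn_Icc.mono_set Ioo_subset_Icc_self

lemma integrable_netEnergy (hT₀ : 0 < T₀) (hu : IsLeraySolution T₀ ν u₀ f u p Du) :
    Integrable (netEnergy ν f u Du) (volume.restrict (Ioo 0 T₀)) :=
  hu.integrable_energy.sub (hu.integrable_work hT₀)

lemma integral_powerInput (hu : IsLeraySolution T₀ ν u₀ f u p Du) {t : ℝ} (ht : t ∈ Ioo 0 T₀) :
    ∫ s in 0..t, powerInput ν (u s) (f s) (Du s)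
      = ∫ z : ℝ × E d, inner ℝ (u z.1 z.2) (f z.1 z.2) ∂spaceTime d t
        - ν * ∫ z : ℝ × E d, sqNorm (Du z.1 z.2) ∂spaceTime d t := by
  have hm := spaceTime_mono (d := d) ht.2.le
  have i1 := hu.integrable_inner.mono_measure hm
  have i2 := (hu.integrable_sqNorm.const_mul ν).mono_measure hm
  have i3 : Integrable (fun z : ℝ × E d =>
      inner ℝ (u z.1 z.2) (f z.1 z.2) - ν * sqNorm (Du z.1 z.2)) (spaceTime d t) := i1.sub i2
  rw [← integral_const_mul, ← integral_sub i1 i2, spaceTime_eq, integral_prod _ i3,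
    intervalIntegral.integral_of_le ht.1.le, integral_Ioc_eq_integral_Ioo]
  rfl

/-- The defect of the energy balance, tested with a function of time, is minus the distributional
derivative of the net energy. -/
lemma energyDefect_time (hT₀ : 0 < T₀) (hu : IsLeraySolution T₀ ν u₀ f u p Du) {χ : ℝ → ℝ}
    (hχ : ContDiff ℝ ∞ χ) (h0 : χ 0 = 0) (hT : χ T₀ = 0) :
    energyDefect T₀ ν f u p Du (fun t _ => χ t)
      = ∫ t in Ioo 0 T₀, netEnergy ν f u Du t * deriv χ t := by
  have hχd : Continuous (deriv χ) := hχ.continuous_deriv (by simp)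
  have hbound : ∀ {g F : ℝ → ℝ}, Continuous g → Integrable F (volume.restrict (Ioo 0 T₀)) →
      Integrable (fun t => F t * g t) (volume.restrict (Ioo 0 T₀)) := by
    intro g F hg hF
    obtain ⟨C, hC⟩ := (isCompact_Icc (a := (0 : ℝ)) (b := T₀)).exists_bound_of_continuousOn
      hg.continuousOn
    refine hF.mul_bdd (c := C) hg.aestronglyMeasurable ?_
    filter_upwards [ae_restrict_mem measurableSet_Ioo] with t ht
    exact hC t (Ioo_subset_Icc_self ht)
  have hpd : ∀ (j : Fin d) (c : ℝ) (x : E d), pd j (fun _ => c) x = 0 := fun j c x => by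
    simp [pd]
  have hlap : ∀ (c : ℝ) (x : E d), lap (fun _ => c) x = 0 := fun c x =>
    Finset.sum_eq_zero fun j _ => by rw [funext (hpd j c)]; exact hpd j 0 x
  have hE : Integrable (fun z : ℝ × E d => 1 / 2 * ‖u z.1 z.2‖ ^ 2) (spaceTime d T₀) :=
    (integrable_norm_sq_of_memLp hu.u_memLp).const_mul _
  -- For a test function constant in space all spatial derivatives vanish, so the energy current,
  -- pressure included, drops out.
  have e1 : energyDefect T₀ ν f u p Du (fun t _ => χ t)
      = ∫ z : ℝ × E d, (1 / 2 * ‖u z.1 z.2‖ ^ 2 * deriv χ z.1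
        + (inner ℝ (u z.1 z.2) (f z.1 z.2) - ν * sqNorm (Du z.1 z.2)) * χ z.1)
        ∂spaceTime d T₀ := by
    unfold energyDefect
    refine integral_congr_ae (Eventually.of_forall fun z => ?_)
    simp only [hpd, hlap, mul_zero, Finset.sum_const_zero]
    ring
  have i1 := Integrable.mul_continuous_spaceTime hE (hχd.comp continuous_fst)
  have i2 := Integrable.mul_continuous_spaceTime hu.integrable_powerInput_uncurry
    (hχ.continuous.comp continuous_fst)
  have e2 : energyDefect T₀ ν f u p Du (fun t _ => χ t)
      = (∫ t in Ioo 0 T₀, (1 / 2 * ∫ x, ‖u t x‖ ^ 2 ∂torus d) * deriv χ t)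
        + ∫ t in Ioo 0 T₀, powerInput ν (u t) (f t) (Du t) * χ t := by
    rw [e1]
    refine (integral_add i1 i2).trans ?_
    rw [spaceTime_eq, integral_prod _ i1, integral_prod _ i2]
    simp only [Function.comp_apply, integral_mul_const, integral_const_mul, powerInput]
  have hχac : AbsolutelyContinuousOnInterval χ 0 T₀ :=
    (hχ.of_le (by simp)).contDiffOn.absolutelyContinuousOnInterval
  have hparts := (hu.absolutelyContinuous_work hT₀).integral_mul_deriv_eq_deriv_mul hχac
  have hderiv : ∫ t in 0..T₀, deriv (fun t => ∫ s in 0..t, powerInput ν (u s) (f s) (Du s)) t * χ t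
      = ∫ t in 0..T₀, powerInput ν (u t) (f t) (Du t) * χ t := by
    refine intervalIntegral.integral_congr_ae ?_
    filter_upwards [(hu.intervalIntegrable_powerInput hT₀).ae_hasDerivAt_integral] with t ht hmem
    rw [(ht (uIoc_subset_uIcc hmem) 0 left_mem_uIcc).deriv]
  rw [hderiv, h0, hT, mul_zero, mul_zero, sub_zero, zero_sub,
    intervalIntegral.integral_of_le hT₀.le, intervalIntegral.integral_of_le hT₀.le,
    integral_Ioc_eq_integral_Ioo, integral_Ioc_eq_integral_Ioo] at hparts
  rw [e2]
  simp only [netEnergy, sub_mul]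
  rw [integral_sub (hbound hχd hu.integrable_energy) (hbound hχd (hu.integrable_work hT₀)), hparts]
  ring

/-- A rearrangement of the global energy inequality, which supplies the upper half of the
convergence of the net energy to `½‖u₀‖²` at time `0`. -/
lemma ae_netEnergy_le (hu : IsLeraySolution T₀ ν u₀ f u p Du) :
    ∀ᵐ t ∂volume.restrict (Ioo 0 T₀),
      netEnergy ν f u Du t ≤ 1 / 2 * ∫ x, ‖u₀ x‖ ^ 2 ∂torus d := by
  filter_upwards [hu.energy_le, ae_restrict_mem measurableSet_Ioo] with t h1 h2
  rw [netEnergy, hu.integral_powerInput h2]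
  linarith

/-- Weak continuity at the initial time gives lower semicontinuity of the energy there. -/
lemma exists_sub_le_netEnergy (hT₀ : 0 < T₀) (hν : 0 ≤ ν) (hu : IsLeraySolution T₀ ν u₀ f u p Du)
    {ε : ℝ} (hε : 0 < ε) : ∃ δ > 0, δ < T₀ ∧ ∀ᵐ t ∂volume.restrict (Ioo 0 δ),
      1 / 2 * ∫ x, ‖u₀ x‖ ^ 2 ∂torus d - ε ≤ netEnergy ν f u Du t := by
  -- The tolerance `ε / (d + 1)` per component makes the total squared error at most `ε`, also for
  -- `d = 0`; the factor `½` in the energy turns this into `ε / 2`.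
  have hchoose : ∀ i : Fin d, ∃ ψ, IsSmoothPeriodic ψ ∧
      ∫ x, (u₀ x i - ψ x) ^ 2 ∂torus d ≤ ε / (d + 1) := fun i =>
    exists_smooth_integral_sq_sub_le (memLp_apply hu.u₀_memLp i) (by positivity)
  choose ψ hψ hψε using hchoose
  -- Completing the square around `ψ`: the energy is an affine functional of `v`, which is weakly
  -- continuous, plus a non-negative remainder. The remainder is small at `u₀` and is dropped at
  -- later times.
  have hkin : ∀ {v : E d → E d}, MemLp v 2 (torus d) →
      1 / 2 * ∫ x, ‖v x‖ ^ 2 ∂torus d = ∑ i, ∫ x, v x i * ψ i x ∂torus d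
        - 1 / 2 * ∑ i, ∫ x, ψ i x * ψ i x ∂torus d
        + 1 / 2 * ∑ i, ∫ x, (v x i - ψ i x) ^ 2 ∂torus d := by
    intro v hv
    have hi : ∀ i, ∫ x, (v x i - ψ i x) ^ 2 ∂torus d = ∫ x, v x i * v x i ∂torus d
        - 2 * ∫ x, v x i * ψ i x ∂torus d + ∫ x, ψ i x * ψ i x ∂torus d := fun i => by
      have j1 := integrable_apply_mul hv hv i i
      have j2 := ((hψ i).integrable_mul (integrable_apply hv i)).const_mul 2
      rw [← integral_const_mul, ← integral_sub j1 j2,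
        ← integral_add (by exact j1.sub j2) ((hψ i).mul (hψ i)).integrable]
      exact integral_congr_ae (Eventually.of_forall fun x => by simp only; ring)
    simp only [norm_sq_eq_sum]
    rw [integral_finsetSum _ fun i _ => integrable_apply_mul hv hv i i]
    simp only [hi, Finset.sum_add_distrib, Finset.sum_sub_distrib, ← Finset.mul_sum]
    ring
  set L : ℝ → ℝ := fun t => ∑ i, (∫ x, u₀ x i * ψ i x ∂torus d
      + ∫ s in 0..t, momentumRhs ν (u s) (f s) (p s) i (ψ i))
      - 1 / 2 * ∑ i, ∫ x, ψ i x * ψ i x ∂torus d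
      - ∫ s in 0..t, powerInput ν (u s) (f s) (Du s) with hL
  have hLc : ContinuousOn L (Icc 0 T₀) := by
    have c1 : ∀ i, ContinuousOn
        (fun t => ∫ s in 0..t, momentumRhs ν (u s) (f s) (p s) i (ψ i)) (Icc 0 T₀) := fun i => by
      have := ((hu.intervalIntegrable_momentumRhs hT₀ i
        (hψ i)).absolutelyContinuousOnInterval_intervalIntegral left_mem_uIcc).continuousOn
      rwa [uIcc_of_le hT₀.le] at this
    have c2 := (hu.absolutelyContinuous_work hT₀).continuousOn
    rw [uIcc_of_le hT₀.le] at c2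
    exact ((continuousOn_finsetSum _ fun i _ => continuousOn_const.add (c1 i)).sub
      continuousOn_const).sub c2
  have hL0 : 1 / 2 * ∫ x, ‖u₀ x‖ ^ 2 ∂torus d - ε / 2 ≤ L 0 := by
    rw [hkin hu.u₀_memLp]
    have h1 : ∑ i, ∫ x, (u₀ x i - ψ i x) ^ 2 ∂torus d ≤ ε := by
      calc _ ≤ ∑ _i : Fin d, ε / (d + 1) := Finset.sum_le_sum fun i _ => hψε i
        _ = d * (ε / (d + 1)) := by simp
        _ ≤ ε := by rw [mul_div_assoc', div_le_iff₀ (by positivity)]; nlinarith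
    simp only [hL, intervalIntegral.integral_same, add_zero, sub_zero]
    linarith
  obtain ⟨δ, hδ, hδL⟩ := Metric.continuousWithinAt_iff.1 (hLc 0 ⟨le_rfl, hT₀.le⟩) (ε / 2)
    (by positivity)
  refine ⟨min δ (T₀ / 2), lt_min hδ (by positivity), (min_le_right _ _).trans_lt (by linarith), ?_⟩
  have hle : min δ (T₀ / 2) ≤ T₀ := (min_le_right _ _).trans (by linarith)
  filter_upwards [ae_restrict_Ioo_mono hle (hu.ae_isGoodTime hT₀ hν),
    ae_restrict_mem measurableSet_Ioo] with t h1 h2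
  have h3 := hδL (x := t) ⟨h2.1.le, h2.2.le.trans hle⟩ (by
    rw [Real.dist_eq, sub_zero, abs_of_pos h2.1]; exact h2.2.trans_le (min_le_left _ _))
  rw [Real.dist_eq, abs_lt] at h3
  have h4 : L t ≤ netEnergy ν f u Du t := by
    rw [netEnergy, hkin h1.slice.v_memLp]
    simp only [hL, h1.integral_eq _ _ (hψ _)]
    have : 0 ≤ ∑ i, ∫ x, (u t x i - ψ i x) ^ 2 ∂torus d :=
      Finset.sum_nonneg fun i _ => integral_nonneg fun x => sq_nonneg _
    linarith
  linarith [h3.1]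

/-- The total mass of the defect up to almost every time. -/
theorem ae_defect_eq (hT₀ : 0 < T₀) (hν : 0 ≤ ν) (hu : IsLeraySolution T₀ ν u₀ f u p Du)
    {D : Measure (ℝ × E d)} [SFinite D] (hD : RepresentsDefect T₀ ν f u p Du D) :
    ∀ᵐ T ∂volume.restrict (Ioo 0 T₀), D (Ioo 0 T ×ˢ cell d) < ⊤ ∧
      (D (Ioo 0 T ×ˢ cell d)).toReal
        = 1 / 2 * ∫ x, ‖u₀ x‖ ^ 2 ∂torus d - netEnergy ν f u Du T := by
  have hmain := ae_measure_Ioo_eq (ρ := D.map Prod.fst) hT₀ (hu.integrable_netEnergy hT₀)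
    (c := 1 / 2 * ∫ x, ‖u₀ x‖ ^ 2 ∂torus d) (fun ε hε => by
      obtain ⟨δ, hδ, hδT, h⟩ := hu.exists_sub_le_netEnergy hT₀ hν hε
      refine ⟨δ, hδ, ?_⟩
      filter_upwards [h, ae_restrict_Ioo_mono hδT.le hu.ae_netEnergy_le] with t h1 h2
      rw [abs_le]; constructor <;> linarith)
    (fun χ hχ ha hb => by
      obtain ⟨a, ha0, ha⟩ := ha
      obtain ⟨b, hb0, hb⟩ := hb
      have htest : IsInteriorTest T₀ fun t (_ : E d) => χ t :=
        ⟨⟨hχ.comp contDiff_fst, fun _ _ _ => rfl, b, hb0, fun t ht _ => hb t ht⟩, a, ha0,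
          fun t ht _ => ha t ht⟩
      obtain ⟨h1, h2⟩ := hD.2 _ htest
      have hm : AEStronglyMeasurable χ (D.map Prod.fst) := hχ.continuous.aestronglyMeasurable
      rw [integrable_map_measure hm measurable_fst.aemeasurable,
        integral_map measurable_fst.aemeasurable hm,
        ← hu.energyDefect_time hT₀ hχ (ha 0 ha0.le) (hb T₀ hb0.le)]
      exact ⟨h1, h2⟩)
  filter_upwards [hmain, ae_restrict_mem measurableSet_Ioo] with T h1 h2
  -- The time marginal of `D` sees all of `ℝ^d`, but `D` has no mass off the cell.
  have heq : D (Ioo 0 T ×ˢ cell d) = D.map Prod.fst (Ioo 0 T) := by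
    rw [Measure.map_apply measurable_fst measurableSet_Ioo]
    refine le_antisymm (measure_mono fun z hz => hz.1) ?_
    calc D (Prod.fst ⁻¹' Ioo 0 T) ≤ D (Ioo 0 T ×ˢ cell d ∪ (Ioo 0 T₀ ×ˢ cell d)ᶜ) := by
          refine measure_mono fun z hz => ?_
          by_cases hc : z.2 ∈ cell d
          · exact Or.inl ⟨hz, hc⟩
          · exact Or.inr fun h => hc h.2
      _ ≤ D (Ioo 0 T ×ˢ cell d) + D (Ioo 0 T₀ ×ˢ cell d)ᶜ := measure_union_le _ _
      _ = D (Ioo 0 T ×ˢ cell d) := by rw [hD.1, add_zero]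
  rwa [heq]

lemma integral_cumulantTrace (hu : IsLeraySolution T₀ ν u₀ f u p Du) {G : E d → ℝ}
    (hG : IsMollifier G) (hℓ : 0 < ℓ) {T : ℝ} (hT : T ≤ T₀) :
    ∫ z : ℝ × E d, cumulantTrace G ℓ (u z.1) (f z.1) z.2 ∂spaceTime d T
      = ∫ z : ℝ × E d, inner ℝ (u z.1 z.2) (f z.1 z.2) ∂spaceTime d T
        - ∫ z : ℝ × E d, inner ℝ (cg G ℓ (u z.1) z.2) (cg G ℓ (f z.1) z.2) ∂spaceTime d T := by
  have hm := spaceTime_mono (d := d) hT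
  have i1 := (hu.integrable_cumulantTrace hG hℓ).mono_measure hm
  have i2 := hu.integrable_inner.mono_measure hm
  have i3 := (hu.integrable_inner_cg hG hℓ).mono_measure hm
  rw [spaceTime_eq, integral_prod _ i1, integral_prod _ i2, integral_prod _ i3,
    ← integral_sub i2.integral_prod_left i3.integral_prod_left]
  refine integral_congr_ae ?_
  filter_upwards [ae_restrict_Ioo_mono hT hu.ae_isSlice] with t ht
  exact LeraySol.integral_cumulantTrace ht.v_periodic ht.v_memLp ht.w_periodic ht.w_memLp hG hℓ

/-- The formula for the total dissipation up to a time at which the total mass of the defect is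
given by the global energy balance. -/
theorem dissipation_eq (hT₀ : 0 < T₀) (hν : 0 < ν) (hu : IsLeraySolution T₀ ν u₀ f u p Du)
    {T : ℝ} (hT : T ∈ Ioo 0 T₀) (hgood : IsGoodTime ν u₀ f u p T) {m : ℝ}
    (hm : m = 1 / 2 * ∫ x, ‖u₀ x‖ ^ 2 ∂torus d - netEnergy ν f u Du T) {G : E d → ℝ}
    (hG : IsMollifier G) (hℓ : 0 < ℓ) :
    ν * ∫ z : ℝ × E d, sqNorm (Du z.1 z.2) ∂spaceTime d T + m
      = ∫ z : ℝ × E d, flux G ℓ (u z.1) z.2 ∂spaceTime d T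
        + ∫ z : ℝ × E d, ν * sqNorm (cgGrad G ℓ (u z.1) z.2) ∂spaceTime d T
        + 1 / 2 * ∫ x, cumulantTrace G ℓ u₀ u₀ x ∂torus d
        - 1 / 2 * ∫ x, cumulantTrace G ℓ (u T) (u T) x ∂torus d
        + ∫ z : ℝ × E d, cumulantTrace G ℓ (u z.1) (f z.1) z.2 ∂spaceTime d T := by
  have h1 := hu.integral_resolved_energy hT₀ hν hT hgood hG hℓ
  rw [netEnergy, hu.integral_powerInput hT] at hm
  rw [integral_cumulantTrace_self hu.u₀_periodic hu.u₀_memLp hG hℓ,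
    integral_cumulantTrace_self (hu.u_periodic T) hgood.slice.v_memLp hG hℓ,
    hu.integral_cumulantTrace hG hℓ hT.2.le]
  -- The exact balance minus the resolved balance. The cumulant integrals have been rewritten as
  -- differences of exact and resolved energies and works, so what remains is linear.
  linarith

end IsLeraySolution

end LeraySol

/-! ### The main theorem -/

theorem lemma2 (d : ℕ) (T₀ : ℝ) (hT₀ : 0 < T₀) (ν : ℝ) (hν : 0 < ν)
    (u₀ : LeraySol.E d → LeraySol.E d)
    (f u : ℝ → LeraySol.E d → LeraySol.E d)
    (p : ℝ → LeraySol.E d → ℝ)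
    (Du : ℝ → LeraySol.E d → Fin d → Fin d → ℝ)
    (hu : LeraySol.IsLeraySolution T₀ ν u₀ f u p Du) :
    -- The resolved energy balance, for every `x` and almost every `t`: `e` is the absolutely
    -- continuous (in `t`) representative of the resolved energy at `x`.
    (∀ G : LeraySol.E d → ℝ, LeraySol.IsMollifier G → ∀ ℓ : ℝ, 0 < ℓ →
      (∀ᵐ t ∂volume.restrict (Ioo 0 T₀),
        ContDiff ℝ ∞ (LeraySol.cg G ℓ (u t)) ∧
        ContDiff ℝ ∞ (LeraySol.current ν G ℓ (u t) (p t))) ∧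
      ∀ x : LeraySol.E d, ∃ e : ℝ → ℝ,
        AbsolutelyContinuousOnInterval e 0 T₀ ∧
        e 0 = 1 / 2 * ‖LeraySol.cg G ℓ u₀ x‖ ^ 2 ∧
        ∀ᵐ t ∂volume.restrict (Ioo 0 T₀),
          e t = 1 / 2 * ‖LeraySol.cg G ℓ (u t) x‖ ^ 2 ∧
          ∃ e' : ℝ, HasDerivAt e e' t ∧
            e' + LeraySol.divergence (LeraySol.current ν G ℓ (u t) (p t)) x
              = -LeraySol.flux G ℓ (u t) x
                - ν * LeraySol.sqNorm (LeraySol.cgGrad G ℓ (u t) x)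
                + inner ℝ (LeraySol.cg G ℓ (u t) x) (LeraySol.cg G ℓ (f t) x)) ∧
    -- The global formula for the total dissipation, with `D` the Radon measure `D[u]`.
    (LeraySol.HasNonnegDefect T₀ ν f u p Du → ∃ D : Measure (ℝ × LeraySol.E d),
      LeraySol.RepresentsDefect T₀ ν f u p Du D ∧
      ∀ᵐ T ∂volume.restrict (Ioo 0 T₀),
        D (Ioo 0 T ×ˢ LeraySol.cell d) < ⊤ ∧
        ∀ G : LeraySol.E d → ℝ, LeraySol.IsMollifier G → ∀ ℓ : ℝ, 0 < ℓ →
          Integrable (fun z : ℝ × LeraySol.E d => LeraySol.flux G ℓ (u z.1) z.2)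
            (LeraySol.spaceTime d T) ∧
          Integrable (fun z : ℝ × LeraySol.E d =>
            LeraySol.sqNorm (LeraySol.cgGrad G ℓ (u z.1) z.2)) (LeraySol.spaceTime d T) ∧
          Integrable (LeraySol.cumulantTrace G ℓ u₀ u₀) (LeraySol.torus d) ∧
          Integrable (LeraySol.cumulantTrace G ℓ (u T) (u T)) (LeraySol.torus d) ∧
          Integrable (fun z : ℝ × LeraySol.E d =>
            LeraySol.cumulantTrace G ℓ (u z.1) (f z.1) z.2) (LeraySol.spaceTime d T) ∧
          ν * ∫ z : ℝ × LeraySol.E d, LeraySol.sqNorm (Du z.1 z.2) ∂LeraySol.spaceTime d T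
              + (D (Ioo 0 T ×ˢ LeraySol.cell d)).toReal
            = ∫ z : ℝ × LeraySol.E d, LeraySol.flux G ℓ (u z.1) z.2 ∂LeraySol.spaceTime d T
              + ∫ z : ℝ × LeraySol.E d,
                  ν * LeraySol.sqNorm (LeraySol.cgGrad G ℓ (u z.1) z.2) ∂LeraySol.spaceTime d T
              + 1 / 2 * ∫ x, LeraySol.cumulantTrace G ℓ u₀ u₀ x ∂LeraySol.torus d
              - 1 / 2 * ∫ x, LeraySol.cumulantTrace G ℓ (u T) (u T) x ∂LeraySol.torus d
              + ∫ z : ℝ × LeraySol.E d,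
                  LeraySol.cumulantTrace G ℓ (u z.1) (f z.1) z.2 ∂LeraySol.spaceTime d T) := by
  refine ⟨fun G hG ℓ hℓ => ⟨?_, fun x => hu.resolved_energy_balance hT₀ hν hG hℓ x⟩, fun hD => ?_⟩
  · filter_upwards [hu.ae_isSlice] with t ht
    exact ⟨ht.contDiff_cg hG hℓ, ht.contDiff_current hG hℓ ν⟩
  · obtain ⟨D, hsf, hrep⟩ := hu.exists_representsDefect hT₀ hD
    refine ⟨D, hrep, ?_⟩
    -- The times are selected before `G` and `ℓ` are introduced. This is possible because good times
    -- serve all smooth tests and the mass of the defect does not involve the mollifier.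
    filter_upwards [hu.ae_defect_eq hT₀ hν.le hrep, hu.ae_isGoodTime hT₀ hν.le,
      ae_restrict_mem measurableSet_Ioo] with T hdef hgood hT
    have hm := LeraySol.spaceTime_mono (d := d) hT.2.le
    exact ⟨hdef.1, fun G hG ℓ hℓ =>
      ⟨(hu.integrable_flux hG hℓ).mono_measure hm,
        (hu.integrable_sqNorm_cgGrad hG hℓ).mono_measure hm,
        LeraySol.integrable_cumulantTrace hu.u₀_periodic hu.u₀_memLp hu.u₀_periodic hu.u₀_memLp
          hG hℓ,
        LeraySol.integrable_cumulantTrace (hu.u_periodic T) hgood.slice.v_memLp (hu.u_periodic T)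
          hgood.slice.v_memLp hG hℓ,
        (hu.integrable_cumulantTrace hG hℓ).mono_measure hm,
        hu.dissipation_eq hT₀ hν hT hgood hdef.2 hG hℓ⟩⟩
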